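/- Let $X$ be the space of real-valued even functions $u\in H^{1/2}(\mathbb{R})$ with $\partial_x^{-1}u\in L^2(\mathbb{R})$, and write $$\|u\|_X=\|u\|_{H^{1/2}}+\|\partial_x^{-1}u\|_{L^2},$$ a norm that makes sense for all real $u\in H^{1/2}(\mathbb{R})$ with $\partial_x^{-1}u\in L^2(\mathbb{R})$, even or not. Here $\partial_x^{1/2}$, $\partial_x^{-1}$ and $\mathcal{H}$ (the Hilbert transform) are the Fourier multipliers with symbols $|\xi|^{1/2}$, $(i\xi)^{-1}$ and $-i\,\mathrm{sgn}\,\xi$. For $\gamma,c>0$ and $\lambda>0$ let $$I(u)=\int_{\mathbb{R}}\Big(\tfrac12(\partial_x^{1/2}u)^2+\tfrac c2u^2+\tfrac\gamma2(\partial_x^{-1}u)^2\Big)dx,\qquad K(u)=\tfrac13\int_{\mathbb{R}}u^3\,dx,\qquad M_\lambda=\inf\{I(u):u\in X,\ K(u)=\lambda\}.$$ **Proposition 2.3.** Let $\gamma>0$, $c>0$ and $\lambda>0$. 1. Let $(\psi_n)_n\subset X$ be a minimizing sequence for $M_\lambda$, i.e. $K(\psi_n)=\lambda$ for all $n$ and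 $I(\psi_n)\to M_\lambda$. Then there exist a subsequence $(\psi_{n_k})_k$, scalars $y_k\in\mathbb{R}$ and $\psi\in X$ such that $\|\psi_{n_k}(\cdot+y_k)-\psi\|_X\to0$ as $k\to\infty$, and moreover $K(\psi)=\lambda$ and $I(\psi)=M_\lambda$. 2. In particular there is a $\psi\in X$ with $K(\psi)=\lambda$ and $I(\psi)=M_\lambda$. 3. There is an even ground state, i.e. a solution $\psi\in X$ of $\mathcal{H}\partial_x\psi+c\psi-\gamma\partial_x^{-2}\psi=\psi^2$ that satisfies $I(\psi)=M_{\lambda'}$ and $K(\psi)=\lambda'$ for some $\lambda'>0$. -/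

import Mathlib

open MeasureTheory Filter Topology FourierTransform
open scoped SchwartzMap

noncomputable section

namespace RotationBO

/-- Real-valued square-integrable functions on the line (modulo a.e. equality). -/
abbrev L2R : Type := Lp ℝ 2 (volume : Measure ℝ)

/-- Complex-valued square-integrable functions on the line (modulo a.e. equality). -/
abbrev L2C : Type := Lp ℂ 2 (volume : Measure ℝ)

/-- A real `L²` function seen as a complex one. -/
def toC (u : L2R) : L2C := Complex.ofRealCLM.compLp u

/-- `u` lies in the domain of the Fourier multiplier with symbol `m`, i.e. `m · 𝓕 u ∈ L²`.
The Fourier transform is `𝓕 u (ξ) = ∫ u(x) exp (-2 π i x ξ) dx`. -/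
def InDomain (m : ℝ → ℂ) (u : L2R) : Prop :=
  MemLp (fun ξ : ℝ => m ξ * (𝓕 (toC u) : L2C) ξ) 2 volume

open Classical in
/-- The Fourier multiplier with symbol `m`, `u ↦ 𝓕⁻¹ (m · 𝓕 u)`, on its natural domain in `L²`
(and `0` outside the domain). -/
def multiplier (m : ℝ → ℂ) (u : L2R) : L2C :=
  if h : InDomain m u then 𝓕⁻ (h.toLp _ : L2C) else 0

/-- The symbol `2 π i ξ` of `∂ₓ`. -/
def symbDeriv (ξ : ℝ) : ℂ := 2 * Real.pi * Complex.I * ξ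

/-- The symbol `-i sgn ξ` of the Hilbert transform `u ↦ p.v. (1/π) ∫ u(y) / (x - y) dy`. -/
def symbHilbert (ξ : ℝ) : ℂ := -Complex.I * (Real.sign ξ : ℝ)

/-- The symbol `|2 π ξ| ^ (1/2)` of the half derivative. -/
def symbHalf (ξ : ℝ) : ℂ := (Real.sqrt |2 * Real.pi * ξ| : ℝ)

/-- The symbol `(2 π i ξ)⁻¹` of `∂ₓ⁻¹` (its value at the single point `ξ = 0` is irrelevant). -/
def symbAnti (ξ : ℝ) : ℂ := (symbDeriv ξ)⁻¹

/-- The half derivative `∂ₓ^{1/2} u` (that is `D_x^{1/2} u`). -/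
def halfDeriv (u : L2R) : L2C := multiplier symbHalf u

/-- The antiderivative `∂ₓ⁻¹ u`. -/
def antideriv (u : L2R) : L2C := multiplier symbAnti u

/-- The space `X` of the even functions `u ∈ H^{1/2}(ℝ)` with `∂ₓ⁻¹ u ∈ L²(ℝ)`. -/
def X : Set L2R :=
  {u | TemperedDistribution.MemSobolev (1 / 2) 2 ((toC u : L2C) : 𝓢'(ℝ, ℂ)) ∧
    InDomain symbAnti u ∧ ∀ᵐ x : ℝ, u (-x) = u x}

/-- The `H^{1/2}` norm, `‖u‖² = ∫ (1 + |2 π ξ|) |𝓕 u (ξ)|² dξ = ‖u‖²_{L²} + ‖∂ₓ^{1/2} u‖²_{L²}`. -/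
def normHhalf (u : L2R) : ℝ := Real.sqrt (‖u‖ ^ 2 + ‖halfDeriv u‖ ^ 2)

/-- The norm of `X`, `‖u‖_{H^{1/2}} + ‖∂ₓ⁻¹ u‖_{L²}`. It makes sense for all `u ∈ H^{1/2}` with
`∂ₓ⁻¹ u ∈ L²`, even or not. -/
def normX (u : L2R) : ℝ := normHhalf u + ‖antideriv u‖

/-- The translate `u(· + y)`. -/
def translate (y : ℝ) (u : L2R) : L2R :=
  Lp.compMeasurePreserving (fun x : ℝ => x + y) (measurePreserving_add_right volume y) u

/-- The functional `I(u) = ∫ ½ (∂ₓ^{1/2} u)² + c/2 u² + γ/2 (∂ₓ⁻¹ u)²`. -/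
def energyI (γ c : ℝ) (u : L2R) : ℝ :=
  ∫ x : ℝ, (1 / 2 * ‖halfDeriv u x‖ ^ 2 + c / 2 * (u x) ^ 2 + γ / 2 * ‖antideriv u x‖ ^ 2)

/-- The functional `K(u) = ⅓ ∫ u³`. -/
def cubicK (u : L2R) : ℝ := 1 / 3 * ∫ x : ℝ, (u x) ^ 3

/-- `M_λ = inf {I(u) : u ∈ X, K(u) = λ}`. -/
def infM (γ c lam : ℝ) : ℝ := sInf (energyI γ c '' {u | u ∈ X ∧ cubicK u = lam})

/-- A minimizing sequence for `M_λ`. -/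
def IsMinimizingSeq (γ c lam : ℝ) (u : ℕ → L2R) : Prop :=
  (∀ n, u n ∈ X ∧ cubicK (u n) = lam) ∧
    Tendsto (fun n => energyI γ c (u n)) atTop (𝓝 (infM γ c lam))

/-- `ψ` achieves the infimum `M_λ`. -/
def IsMinimizer (γ c lam : ℝ) (ψ : L2R) : Prop :=
  ψ ∈ X ∧ cubicK ψ = lam ∧ energyI γ c ψ = infM γ c lam

/-- The solitary wave equation `H ∂ₓ ψ + c ψ - γ ∂ₓ⁻² ψ = ψ²` for `ψ ∈ L²`, where the operators
on the left are Fourier multipliers: both sides have the same Fourier transform. Note that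
`ψ² ∈ L¹`, so that the Fourier transform on the right is the classical Fourier integral. -/
def SolvesSolitaryEq (γ c : ℝ) (ψ : L2R) : Prop :=
  ∀ᵐ ξ : ℝ,
    (symbHilbert ξ * symbDeriv ξ + c - γ * (symbDeriv ξ ^ 2)⁻¹) * (𝓕 (toC ψ) : L2C) ξ
      = 𝓕 (fun x : ℝ => ((ψ x ^ 2 : ℝ) : ℂ)) ξ

/-- An even ground state: a solution of the solitary wave equation that achieves the infimum
`M_λ` for some `λ > 0`. -/
def IsEvenGroundState (γ c : ℝ) (ψ : L2R) : Prop :=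
  SolvesSolitaryEq γ c ψ ∧ ∃ lam : ℝ, 0 < lam ∧ IsMinimizer γ c lam ψ

end RotationBO

end

/-!
Write `w(ξ) = |2πξ| + c + γ / (2πξ)²`. With `g = w^{1/2} 𝓕 u` the energy becomes `I(u) = ½ ‖g‖²`,
so the real functions of finite energy form a real Hilbert space `herm`, on which translations act
by modulations and `∫ u³` is a bounded cubic form (an `L⁴` bound by half a derivative,
`lintegral_fourierInv_pow_four_le`). By homogeneity, minimizing `I` under `K = λ` means maximizing
`∫ u³ / ‖g‖³` over the even vectors; let `A` be the maximal value.

The argument for compactness is carried out for an abstract `InvariantCubicForm`. The cubic form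
is compact up to translations: it tends to zero along a bounded sequence all of whose translates
tend weakly to zero (`tri_vanishing`), because the high frequencies are small in `L²` and the low
frequencies are given pointwise by inner products with translates of one fixed vector. Therefore a
minimizing sequence `uₙ` has translates by some `yₙ` with a nonzero weak limit `g`.

* If `yₙ` stays bounded along a subsequence, the `uₙ` have a nonzero weak limit themselves, and
  the mass cannot split, by `a³ + b³ < (a² + b²)^{3/2}`. So the convergence is strong
  (`tendsto_of_weakTo_even`).

* If `|yₙ| → ∞`, then by evenness `uₙ` contains the bump `g` near `yₙ` and its reflection at the
  opposite point. Two distant copies of a vector show that the constant of the cubic form on the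
  whole space is at most `√2 A` (`cub_le_sqrt_two_mul`), and by the same inequality the two bumps
  must carry the whole mass, so that `g` attains this constant. This is impossible
  (`cub_ne_sqrt_two_mul`): then `g` satisfies the Euler–Lagrange equation, and if `s > 0` is the
  inner product of `g` with a translate of its reflection, the superposition of the two is, after
  a translation, an even vector whose cubic form exceeds `A` times the cube of its norm. Such a
  translate exists (`exists_inner_modHerm_pos`): the inner products, as a function of the
  translation, are the Fourier transform of `g(-ξ)²`, which by the Euler–Lagrange equation is
  `O(ξ²)` at `0`. Hence they have mean zero, and they are not identically zero.

Thus even minimizing sequences converge along a subsequence without any translations. Finally a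
minimizer satisfies the solitary wave equation up to a positive Lagrange multiplier, which scaling
removes.
-/

noncomputable section

namespace RotationBO

/-! ### The Fourier transform on `L¹ ∩ L²` -/

theorem ae_eq_of_forall_schwartz {f g : ℝ → ℂ} (hf : LocallyIntegrable f volume)
    (hg : LocallyIntegrable g volume)
    (h : ∀ φ : 𝓢(ℝ, ℂ), ∫ x, φ x * f x = ∫ x, φ x * g x) : f =ᵐ[volume] g := by
  refine ae_eq_of_integral_contDiff_smul_eq hf hg fun φ hφ hφc => ?_
  have h1 : HasCompactSupport (fun x => (φ x : ℂ)) := hφc.comp_left (g := ((↑) : ℝ → ℂ)) rfl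
  have h2 : ContDiff ℝ ((⊤ : ℕ∞) : WithTop ℕ∞) (fun x => (φ x : ℂ)) :=
    Complex.ofRealCLM.contDiff.comp hφ
  simpa [Complex.real_smul] using h (h1.toSchwartzMap h2)

/-- On `L¹ ∩ L²` the `L²` Fourier transform is given by the Fourier integral. -/
theorem fourier_toLp_ae_eq {F : ℝ → ℂ} (h2 : MemLp F 2 volume) (h1 : Integrable F) :
    (𝓕 (h2.toLp F) : L2C) =ᵐ[volume] 𝓕 F := by
  have hc : Continuous (𝓕 F) :=
    VectorFourier.fourierIntegral_continuous Real.continuous_fourierChar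
      (by exact continuous_inner) h1
  refine ae_eq_of_forall_schwartz ((Lp.memLp _).locallyIntegrable (by norm_num))
    hc.locallyIntegrable fun φ => ?_
  have e := congrArg (fun T : 𝓢'(ℝ, ℂ) => T φ) (Lp.fourier_toTemperedDistribution_eq (h2.toLp F))
  simp only [TemperedDistribution.fourier_apply, Lp.toTemperedDistribution_apply, smul_eq_mul] at e
  rw [← e]
  have := VectorFourier.integral_fourierIntegral_smul_eq_flip (μ := (volume : Measure ℝ))
    (ν := (volume : Measure ℝ)) (L := innerₗ ℝ) Real.continuous_fourierChar
    (by exact continuous_inner) φ.integrable h1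
  rw [flip_innerₗ] at this
  simp only [smul_eq_mul] at this
  refine (integral_congr_ae ?_).trans this
  filter_upwards [h2.coeFn_toLp] with x hx
  rw [hx]
  rfl

theorem fourierInv_toLp_ae_eq {F : ℝ → ℂ} (h2 : MemLp F 2 volume) (h1 : Integrable F) :
    (𝓕⁻ (h2.toLp F) : L2C) =ᵐ[volume] 𝓕⁻ F := by
  have hc : Continuous (𝓕⁻ F) := by
    have : Continuous (𝓕 F) :=
      VectorFourier.fourierIntegral_continuous Real.continuous_fourierChar
        (by exact continuous_inner) h1
    have e : 𝓕⁻ F = fun x => 𝓕 F (-x) := by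
      ext x; rw [Real.fourierInv_eq_fourier_neg]
    rw [e]; exact this.comp continuous_neg
  refine ae_eq_of_forall_schwartz ((Lp.memLp _).locallyIntegrable (by norm_num))
    hc.locallyIntegrable fun φ => ?_
  have e := congrArg (fun T : 𝓢'(ℝ, ℂ) => T φ)
    (Lp.fourierInv_toTemperedDistribution_eq (h2.toLp F))
  simp only [TemperedDistribution.fourierInv_apply, Lp.toTemperedDistribution_apply,
    smul_eq_mul] at e
  rw [← e]
  have := VectorFourier.integral_fourierIntegral_smul_eq_flip (μ := (volume : Measure ℝ))
    (ν := (volume : Measure ℝ)) (L := -innerₗ ℝ) Real.continuous_fourierChar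
    (by exact continuous_inner.neg) φ.integrable h1
  have h3 : (-innerₗ ℝ : ℝ →ₗ[ℝ] ℝ →ₗ[ℝ] ℝ).flip = -innerₗ ℝ := by
    ext; simp
  rw [h3] at this
  simp only [smul_eq_mul] at this
  refine (integral_congr_ae ?_).trans this
  filter_upwards [h2.coeFn_toLp] with x hx
  rw [hx, SchwartzMap.fourierInv_coe]
  rfl

/-- Continuous maps on `L²` that agree on `L¹ ∩ L²` are equal. -/
theorem L2C.eq_of_forall_integrable {Y : Type*} [TopologicalSpace Y] [T2Space Y] {A B : L2C → Y}
    (hA : Continuous A) (hB : Continuous B)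
    (h : ∀ F : L2C, Integrable F volume → A F = B F) (f : L2C) : A f = B f := by
  refine DenseRange.induction_on (p := fun f => A f = B f)
    (SchwartzMap.denseRange_toLpCLM (E := ℝ) (F := ℂ) (p := 2) (μ := volume) ENNReal.ofNat_ne_top) f
    (isClosed_eq hA hB) fun φ => h _ ?_
  exact φ.integrable.congr (φ.coeFn_toLp 2 volume).symm

/-! ### Multiplication, reflection, translation and conjugation on `L²` -/

/-- Multiplication by an essentially bounded function, as an operator on `L²`. -/
def mulL (b : ℝ → ℂ) (hb : MemLp b ⊤ volume) : L2C →L[ℂ] L2C :=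
  LinearMap.mkContinuous
    { toFun := fun f => ((Lp.memLp f).mul (r := 2) hb).toLp (b * ⇑f)
      map_add' := fun f g => by
        refine Lp.ext ?_
        filter_upwards [((Lp.memLp (f + g)).mul (r := 2) hb).coeFn_toLp,
          ((Lp.memLp f).mul (r := 2) hb).coeFn_toLp, ((Lp.memLp g).mul (r := 2) hb).coeFn_toLp,
          Lp.coeFn_add f g, Lp.coeFn_add (((Lp.memLp f).mul (r := 2) hb).toLp (b * ⇑f))
            (((Lp.memLp g).mul (r := 2) hb).toLp (b * ⇑g))] with x h1 h2 h3 h4 h5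
        rw [h1, h5, Pi.add_apply, h2, h3]
        simp only [Pi.mul_apply, h4, Pi.add_apply]
        ring
      map_smul' := fun k f => by
        refine Lp.ext ?_
        filter_upwards [((Lp.memLp (k • f)).mul (r := 2) hb).coeFn_toLp,
          ((Lp.memLp f).mul (r := 2) hb).coeFn_toLp,
          Lp.coeFn_smul k f, Lp.coeFn_smul k (((Lp.memLp f).mul (r := 2) hb).toLp (b * ⇑f))]
          with x h1 h2 h4 h5
        rw [RingHom.id_apply, h1, h5, Pi.smul_apply, h2]
        simp only [Pi.mul_apply, h4, Pi.smul_apply, smul_eq_mul]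
        ring }
    (eLpNorm b ⊤ volume).toReal fun f => by
      refine Lp.norm_le_mul_norm_of_ae_le_mul ?_
      filter_upwards [((Lp.memLp f).mul (r := 2) hb).coeFn_toLp, ae_le_eLpNormEssSup (f := b)
        (μ := volume)] with x h1 h2
      simp only [LinearMap.coe_mk, AddHom.coe_mk, h1, Pi.mul_apply, norm_mul]
      gcongr
      rw [← toReal_enorm, eLpNorm_exponent_top]
      refine ENNReal.toReal_mono ?_ h2
      rw [← eLpNorm_exponent_top]
      exact hb.2.ne

theorem coeFn_mulL (b : ℝ → ℂ) (hb : MemLp b ⊤ volume) (f : L2C) :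
    mulL b hb f =ᵐ[volume] fun x => b x * f x :=
  ((Lp.memLp f).mul (r := 2) hb).coeFn_toLp

theorem norm_mulL_le {b : ℝ → ℂ} (hb : MemLp b ⊤ volume) {C : ℝ} (hC : ∀ x, ‖b x‖ ≤ C)
    (f : L2C) : ‖mulL b hb f‖ ≤ C * ‖f‖ := by
  refine Lp.norm_le_mul_norm_of_ae_le_mul ?_
  filter_upwards [coeFn_mulL b hb f] with x h1
  rw [h1, norm_mul]
  exact mul_le_mul_of_nonneg_right (hC x) (norm_nonneg _)

theorem real_inner_L2C (f g : L2C) : inner ℝ f g = ∫ x, inner ℝ (f x) (g x) :=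
  L2.inner_def f g

theorem complex_real_inner (z w : ℂ) : inner ℝ z w = (z * starRingEnd ℂ w).re := by
  rw [Complex.inner]
  simp [Complex.mul_re, mul_comm]

theorem inner_mulL_left {b : ℝ → ℂ} (hb : MemLp b ⊤ volume) {b' : ℝ → ℂ}
    (hb' : MemLp b' ⊤ volume) (h : ∀ x, b' x = starRingEnd ℂ (b x)) (f g : L2C) :
    inner ℝ (mulL b hb f) g = inner ℝ f (mulL b' hb' g) := by
  rw [real_inner_L2C, real_inner_L2C]
  refine integral_congr_ae ?_
  filter_upwards [coeFn_mulL b hb f, coeFn_mulL b' hb' g] with x h1 h2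
  rw [h1, h2, complex_real_inner, complex_real_inner, h, map_mul, Complex.conj_conj]
  ring_nf

/-- The reflection `f ↦ f(-·)` of `L²`. -/
def reflL : L2C →ₗᵢ[ℂ] L2C :=
  Lp.compMeasurePreservingₗᵢ ℂ (fun x : ℝ => -x) (Measure.measurePreserving_neg volume)

theorem coeFn_reflL (f : L2C) : reflL f =ᵐ[volume] fun x => f (-x) :=
  Lp.coeFn_compMeasurePreserving f (Measure.measurePreserving_neg volume)

/-- The translation `f ↦ f(· + y)` of `L²`. -/
def transL (y : ℝ) : L2C →ₗᵢ[ℂ] L2C :=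
  Lp.compMeasurePreservingₗᵢ ℂ (fun x : ℝ => x + y) (measurePreserving_add_right volume y)

theorem coeFn_transL (y : ℝ) (f : L2C) : transL y f =ᵐ[volume] fun x => f (x + y) :=
  Lp.coeFn_compMeasurePreserving f (measurePreserving_add_right volume y)

theorem ae_comp_neg {p : ℝ → Prop} (h : ∀ᵐ x, p x) : ∀ᵐ x : ℝ, p (-x) :=
  (Measure.measurePreserving_neg (volume : Measure ℝ)).quasiMeasurePreserving.ae h

theorem ae_comp_add {p : ℝ → Prop} (y : ℝ) (h : ∀ᵐ x, p x) : ∀ᵐ x : ℝ, p (x + y) :=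
  (measurePreserving_add_right (volume : Measure ℝ) y).quasiMeasurePreserving.ae h

/-- Pointwise complex conjugation on `L²`. -/
def conjL : L2C →L[ℝ] L2C :=
  ContinuousLinearMap.compLpL 2 volume (Complex.conjCLE : ℂ →L[ℝ] ℂ)

theorem coeFn_conjL (f : L2C) : conjL f =ᵐ[volume] fun x => starRingEnd ℂ (f x) := by
  filter_upwards [ContinuousLinearMap.coeFn_compLp (Complex.conjCLE : ℂ →L[ℝ] ℂ) f] with x hx
  exact hx

theorem fourierInv_ae_eq {F : L2C} (h1 : Integrable F volume) :
    (𝓕⁻ F : L2C) =ᵐ[volume] fun x =>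
      ∫ ξ, Complex.exp ((2 * Real.pi * (ξ * x) : ℝ) * Complex.I) * F ξ := by
  have := fourierInv_toLp_ae_eq (Lp.memLp F) h1
  rw [Lp.toLp_coeFn] at this
  filter_upwards [this] with x hx
  rw [hx, Real.fourierInv_eq']
  simp only [smul_eq_mul, RCLike.inner_apply, conj_trivial]
  refine integral_congr_ae (ae_of_all _ fun ξ => ?_)
  simp [mul_comm]

/-- The character `ξ ↦ exp (2 π i y ξ)`, the symbol of the translation by `y`. -/
def symbTrans (y ξ : ℝ) : ℂ := Complex.exp ((2 * Real.pi * (ξ * y) : ℝ) * Complex.I)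

theorem norm_symbTrans (y ξ : ℝ) : ‖symbTrans y ξ‖ = 1 := Complex.norm_exp_ofReal_mul_I _

theorem continuous_symbTrans (y : ℝ) : Continuous (symbTrans y) := by
  unfold symbTrans; fun_prop

theorem symbTrans_add (y z ξ : ℝ) : symbTrans (y + z) ξ = symbTrans y ξ * symbTrans z ξ := by
  rw [symbTrans, symbTrans, symbTrans, ← Complex.exp_add]
  push_cast; ring_nf

theorem conj_symbTrans (y ξ : ℝ) : starRingEnd ℂ (symbTrans y ξ) = symbTrans (-y) ξ := by
  rw [symbTrans, symbTrans, ← Complex.exp_conj, map_mul, Complex.conj_ofReal, Complex.conj_I]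
  push_cast; ring_nf

theorem symbTrans_neg (y ξ : ℝ) : symbTrans y (-ξ) = symbTrans (-y) ξ := by
  simp [symbTrans]

theorem memLp_symbTrans (y : ℝ) : MemLp (symbTrans y) ⊤ volume :=
  memLp_top_of_bound (continuous_symbTrans y).aestronglyMeasurable 1
    (ae_of_all _ fun ξ => (norm_symbTrans y ξ).le)

/-- Multiplication by the character `ξ ↦ exp (2 π i y ξ)`. -/
abbrev modL (y : ℝ) : L2C →L[ℂ] L2C := mulL (symbTrans y) (memLp_symbTrans y)

theorem continuous_fourierInv_L2C : Continuous (fun f : L2C => (𝓕⁻ f : L2C)) :=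
  (Lp.fourierTransformₗᵢ ℝ ℂ).symm.continuous

theorem fourierInv_modL (y : ℝ) (f : L2C) : (𝓕⁻ (modL y f) : L2C) = transL y (𝓕⁻ f) := by
  refine L2C.eq_of_forall_integrable (continuous_fourierInv_L2C.comp (modL y).continuous)
    ((transL y).continuous.comp continuous_fourierInv_L2C) (fun F hF => ?_) f
  have h1 : Integrable (modL y F) volume := by
    refine hF.mono (Lp.aestronglyMeasurable _) ?_
    filter_upwards [coeFn_mulL _ (memLp_symbTrans y) F] with ξ h
    rw [h, norm_mul, norm_symbTrans, one_mul]
  refine Lp.ext ?_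
  filter_upwards [fourierInv_ae_eq h1, coeFn_transL y (𝓕⁻ F),
    ae_comp_add y (fourierInv_ae_eq hF)] with x h2 h3 h4
  rw [Function.comp_apply, Function.comp_apply, h2, h3, h4]
  refine integral_congr_ae ?_
  filter_upwards [coeFn_mulL _ (memLp_symbTrans y) F] with ξ h
  rw [h, symbTrans, ← mul_assoc, ← Complex.exp_add]
  congr 2
  push_cast; ring

theorem fourierInv_reflL (f : L2C) : (𝓕⁻ (reflL f) : L2C) = reflL (𝓕⁻ f) := by
  refine L2C.eq_of_forall_integrable (continuous_fourierInv_L2C.comp reflL.continuous)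
    (reflL.continuous.comp continuous_fourierInv_L2C) (fun F hF => ?_) f
  have h1 : Integrable (reflL F) volume := hF.comp_neg.congr (coeFn_reflL F).symm
  refine Lp.ext ?_
  filter_upwards [fourierInv_ae_eq h1, coeFn_reflL (𝓕⁻ F),
    ae_comp_neg (fourierInv_ae_eq hF)] with x h2 h3 h4
  rw [Function.comp_apply, Function.comp_apply, h2, h3, h4, ← integral_neg_eq_self]
  refine integral_congr_ae ?_
  filter_upwards [ae_comp_neg (coeFn_reflL F)] with ξ h
  rw [h]
  simp

theorem fourierInv_reflL_conjL (f : L2C) :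
    (𝓕⁻ (reflL (conjL f)) : L2C) = conjL (𝓕⁻ f) := by
  refine L2C.eq_of_forall_integrable
    (continuous_fourierInv_L2C.comp (reflL.continuous.comp conjL.continuous))
    (conjL.continuous.comp continuous_fourierInv_L2C) (fun F hF => ?_) f
  have h0 : Integrable (conjL F) volume := by
    refine hF.mono (Lp.aestronglyMeasurable _) ?_
    filter_upwards [coeFn_conjL F] with ξ h
    rw [h, RCLike.norm_conj]
  have h1 : Integrable (reflL (conjL F)) volume := h0.comp_neg.congr (coeFn_reflL _).symm
  refine Lp.ext ?_
  filter_upwards [fourierInv_ae_eq h1, coeFn_conjL (𝓕⁻ F), fourierInv_ae_eq hF] with x h2 h3 h4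
  simp only [Function.comp_apply]
  rw [h2, h3, h4, ← integral_neg_eq_self, ← integral_conj]
  refine integral_congr_ae ?_
  filter_upwards [ae_comp_neg (coeFn_reflL (conjL F)), coeFn_conjL F] with ξ h h'
  rw [h, neg_neg, h', map_mul, ← Complex.exp_conj, map_mul, Complex.conj_ofReal, Complex.conj_I]
  push_cast; ring_nf

/-! ### An `L⁴` bound by half a derivative -/

open Classical in
/-- The symbol `1_{|ξ| ≤ N}` of the sharp frequency cutoff. -/
def symbLow (N ξ : ℝ) : ℂ := if |ξ| ≤ N then 1 else 0

theorem norm_symbLow_le (N ξ : ℝ) : ‖symbLow N ξ‖ ≤ 1 := by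
  unfold symbLow; split_ifs <;> simp

theorem measurable_symbLow (N : ℝ) : Measurable (symbLow N) :=
  Measurable.ite (measurableSet_le measurable_norm measurable_const) measurable_const
    measurable_const

theorem memLp_symbLow (N : ℝ) : MemLp (symbLow N) ⊤ volume :=
  memLp_top_of_bound (measurable_symbLow N).aestronglyMeasurable 1
    (ae_of_all _ (norm_symbLow_le N))

/-- The restriction of a function of the frequency to `|ξ| ≤ N`. -/
abbrev lowL (N : ℝ) : L2C →L[ℂ] L2C := mulL (symbLow N) (memLp_symbLow N)

theorem coeFn_sub_lowL (N : ℝ) (F : L2C) :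
    (F - lowL N F : L2C) =ᵐ[volume] fun ξ => if |ξ| ≤ N then 0 else F ξ := by
  filter_upwards [Lp.coeFn_sub F (lowL N F), coeFn_mulL _ (memLp_symbLow N) F] with ξ h1 h2
  rw [h1, Pi.sub_apply, h2, symbLow]
  split_ifs <;> simp

theorem lintegral_enorm_sq (f : L2C) : ∫⁻ x, ‖f x‖ₑ ^ 2 = ENNReal.ofReal (‖f‖ ^ 2) := by
  rw [Lp.norm_def, ← ENNReal.toReal_pow, ENNReal.ofReal_toReal
    (ENNReal.pow_ne_top (Lp.eLpNorm_ne_top f)), eLpNorm_eq_lintegral_rpow_enorm_toReal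
      (by norm_num) (by norm_num)]
  simp [← ENNReal.rpow_mul_natCast]

theorem memLp_low (N : ℝ) : MemLp (symbLow N) 2 volume := by
  classical
  have : symbLow N = Set.indicator (Set.Icc (-N) N) (fun _ => (1 : ℂ)) := by
    ext ξ
    simp only [symbLow, Set.indicator, Set.mem_Icc, abs_le]
  rw [this]
  exact memLp_indicator_const 2 measurableSet_Icc 1 (Or.inr (by simp))

theorem norm_sq_symbLow {N : ℝ} (hN : 0 ≤ N) : ‖(memLp_low N).toLp (symbLow N)‖ ^ 2 = 2 * N := by
  have h := lintegral_enorm_sq ((memLp_low N).toLp (symbLow N))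
  have h2 : ∫⁻ x, ‖(memLp_low N).toLp (symbLow N) x‖ₑ ^ 2 = ENNReal.ofReal (2 * N) := by
    have : ∀ᵐ x : ℝ, ‖(memLp_low N).toLp (symbLow N) x‖ₑ ^ 2 =
        Set.indicator (Set.Icc (-N) N) (fun _ => (1 : ENNReal)) x := by
      filter_upwards [(memLp_low N).coeFn_toLp] with x hx
      rw [hx, symbLow]
      by_cases hxN : |x| ≤ N
      · rw [if_pos hxN, Set.indicator_of_mem (by rwa [Set.mem_Icc, ← abs_le])]; simp
      · rw [if_neg hxN, Set.indicator_of_notMem (by rwa [Set.mem_Icc, ← abs_le])]; simp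
    rw [lintegral_congr_ae this, lintegral_indicator measurableSet_Icc, setLIntegral_const,
      one_mul, Real.volume_Icc]
    ring_nf
  rw [h2] at h
  have := congrArg ENNReal.toReal h
  rw [ENNReal.toReal_ofReal (by positivity), ENNReal.toReal_ofReal (by positivity)] at this
  exact this.symm

theorem integrable_lowL (N : ℝ) (F : L2C) : Integrable (lowL N F) volume := by
  refine ((memLp_low N).integrable_mul (Lp.memLp F)).congr ?_
  filter_upwards [coeFn_mulL _ (memLp_symbLow N) F] with ξ h
  rw [h, Pi.mul_apply]

/-- Frequencies `|ξ| ≤ N` contribute at most `√(2N) ‖F‖₂` to the size of `𝓕⁻ F`. -/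
theorem norm_fourierInv_lowL_le {N : ℝ} (hN : 0 ≤ N) (F : L2C) :
    ∀ᵐ x, ‖(𝓕⁻ (lowL N F) : L2C) x‖ ≤ Real.sqrt (2 * N) * ‖F‖ := by
  filter_upwards [fourierInv_ae_eq (integrable_lowL N F)] with x hx
  rw [hx]
  have h1 : ∫ ξ, Complex.exp ((2 * Real.pi * (ξ * x) : ℝ) * Complex.I) * lowL N F ξ =
      inner ℂ ((memLp_low N).toLp (symbLow N)) (modL x F) := by
    rw [L2.inner_def]
    refine integral_congr_ae ?_
    filter_upwards [(memLp_low N).coeFn_toLp, coeFn_mulL _ (memLp_symbTrans x) F,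
      coeFn_mulL _ (memLp_symbLow N) F] with ξ h2 h3 h4
    rw [h2, h3, h4, RCLike.inner_apply, symbLow, symbTrans]
    split_ifs <;> simp
  rw [h1]
  refine (norm_inner_le_norm _ _).trans ?_
  gcongr
  · rw [← norm_sq_symbLow hN, Real.sqrt_sq (norm_nonneg _)]
  · simpa using norm_mulL_le (memLp_symbTrans x) (fun ξ => (norm_symbTrans x ξ).le) F

theorem norm_fourierInv (F : L2C) : ‖(𝓕⁻ F : L2C)‖ = ‖F‖ :=
  (Lp.fourierTransformₗᵢ ℝ ℂ).symm.norm_map F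

theorem fourierInv_sub_L2C (F G : L2C) : (𝓕⁻ (F - G) : L2C) = 𝓕⁻ F - 𝓕⁻ G :=
  (Lp.fourierTransformₗᵢ ℝ ℂ).symm.map_sub F G

/-- The distribution function of `𝓕⁻ F` at height `t` is controlled by the frequencies
`|ξ| > t² / (8 A²)`, since the others contribute at most `t / 2`. -/
theorem volume_lt_norm_fourierInv_le {A : ℝ} (hA : 0 < A) {F : L2C} (hF : ‖F‖ ≤ A) {t : ℝ}
    (ht : 0 < t) :
    volume {x | t < ‖(𝓕⁻ F : L2C) x‖} ≤
      ENNReal.ofReal (4 / t ^ 2) *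
        ∫⁻ ξ, if |ξ| ≤ t ^ 2 / (8 * A ^ 2) then 0 else ‖F ξ‖ₑ ^ 2 := by
  set N := t ^ 2 / (8 * A ^ 2) with hN
  have hN0 : 0 ≤ N := by positivity
  have hs : Real.sqrt (2 * N) * ‖F‖ ≤ t / 2 := by
    have : 2 * N = (t / (2 * A)) ^ 2 := by rw [hN]; field_simp; ring
    rw [this, Real.sqrt_sq (by positivity)]
    calc t / (2 * A) * ‖F‖ ≤ t / (2 * A) * A := by gcongr
      _ = t / 2 := by field_simp
  set h : L2C := 𝓕⁻ (F - lowL N F) with hh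
  have h1 : volume {x | t < ‖(𝓕⁻ F : L2C) x‖} ≤
      volume {x | ENNReal.ofReal ((t / 2) ^ 2) ≤ ‖h x‖ₑ ^ 2} := by
    refine measure_mono_ae ?_
    filter_upwards [norm_fourierInv_lowL_le hN0 F, Lp.coeFn_sub (𝓕⁻ F : L2C) (𝓕⁻ (lowL N F))]
      with x hx1 hx2 hx3
    change t < _ at hx3
    change _ ≤ _
    rw [← ofReal_norm, ← ENNReal.ofReal_pow (norm_nonneg _)]
    refine ENNReal.ofReal_le_ofReal (pow_le_pow_left₀ (by positivity) ?_ 2)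
    rw [hh, fourierInv_sub_L2C, hx2, Pi.sub_apply]
    have := norm_sub_norm_le ((𝓕⁻ F : L2C) x) ((𝓕⁻ (lowL N F) : L2C) x)
    linarith
  refine h1.trans ?_
  have h2 : ENNReal.ofReal ((t / 2) ^ 2) * volume {x | ENNReal.ofReal ((t / 2) ^ 2) ≤ ‖h x‖ₑ ^ 2}
      ≤ ∫⁻ x, ‖h x‖ₑ ^ 2 :=
    mul_meas_ge_le_lintegral₀ ((Lp.aestronglyMeasurable h).enorm.pow_const 2) _
  have h3 : ∫⁻ x, ‖h x‖ₑ ^ 2 = ∫⁻ ξ, if |ξ| ≤ N then 0 else ‖F ξ‖ₑ ^ 2 := by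
    rw [lintegral_enorm_sq, hh, norm_fourierInv, ← lintegral_enorm_sq]
    refine lintegral_congr_ae ?_
    filter_upwards [coeFn_sub_lowL N F] with ξ hξ
    rw [hξ]
    split_ifs <;> simp
  rw [← h3]
  calc volume {x | ENNReal.ofReal ((t / 2) ^ 2) ≤ ‖h x‖ₑ ^ 2}
      = ENNReal.ofReal (4 / t ^ 2) * (ENNReal.ofReal ((t / 2) ^ 2) *
          volume {x | ENNReal.ofReal ((t / 2) ^ 2) ≤ ‖h x‖ₑ ^ 2}) := by
        rw [← mul_assoc, ← ENNReal.ofReal_mul (by positivity)]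
        have : 4 / t ^ 2 * (t / 2) ^ 2 = 1 := by field_simp; norm_num
        rw [this]; simp
    _ ≤ _ := by gcongr

/-- The inequality `∫ |f|⁴ ≤ 128 ‖f‖₂² ∫ |ξ| |𝓕 f|²`. By the layer cake formula
it reduces to a bound of `|{|f| > t}|`, and there the frequencies `|ξ| ≤ t² / (8 ‖f‖₂²)` of `f`
play no role (`volume_lt_norm_fourierInv_le`). -/
theorem lintegral_fourierInv_pow_four_le {A : ℝ} (hA : 0 < A) {F : L2C} (hF : ‖F‖ ≤ A) :
    ∫⁻ x, ‖(𝓕⁻ F : L2C) x‖ₑ ^ 4 ≤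
      ENNReal.ofReal (128 * A ^ 2) * ∫⁻ ξ, ENNReal.ofReal |ξ| * ‖F ξ‖ₑ ^ 2 := by
  have hm : AEMeasurable (fun x => ‖(𝓕⁻ F : L2C) x‖) volume :=
    (Lp.aestronglyMeasurable _).norm.aemeasurable
  have h0 := lintegral_rpow_eq_lintegral_meas_lt_mul volume
    (ae_of_all _ fun x => norm_nonneg ((𝓕⁻ F : L2C) x)) hm (p := 4) (by norm_num)
  have h1 : ∫⁻ x, ‖(𝓕⁻ F : L2C) x‖ₑ ^ 4 =
      ∫⁻ x, ENNReal.ofReal (‖(𝓕⁻ F : L2C) x‖ ^ (4 : ℝ)) := by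
    refine lintegral_congr fun x => ?_
    rw [← ofReal_norm, ← ENNReal.ofReal_pow (norm_nonneg _)]
    norm_cast
  have hFm : AEMeasurable (fun ξ => ‖F ξ‖ₑ ^ 2) volume :=
    (Lp.aestronglyMeasurable F).enorm.pow_const 2
  -- After bounding the distribution function, the integrand of the double integral over `(t, ξ)`.
  set G : ℝ → ℝ → ENNReal := fun t ξ =>
    ENNReal.ofReal t * if |ξ| ≤ t ^ 2 / (8 * A ^ 2) then 0 else ‖F ξ‖ₑ ^ 2 with hG
  have hGm : AEMeasurable (Function.uncurry G) ((volume.restrict (Set.Ioi 0)).prod volume) := by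
    have e : Function.uncurry G = fun p : ℝ × ℝ =>
        ENNReal.ofReal p.1 * Set.indicator {p : ℝ × ℝ | p.1 ^ 2 / (8 * A ^ 2) < |p.2|}
          (fun p => ‖F p.2‖ₑ ^ 2) p := by
      ext ⟨t, ξ⟩
      simp only [Function.uncurry, hG, Set.indicator, Set.mem_ofPred_eq, ← not_le, ite_not]
    rw [e]
    refine AEMeasurable.mul (by fun_prop) (AEMeasurable.indicator ?_ ?_)
    · exact hFm.comp_quasiMeasurePreserving Measure.quasiMeasurePreserving_snd
    · exact measurableSet_lt (by fun_prop) (by fun_prop)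
  calc ∫⁻ x, ‖(𝓕⁻ F : L2C) x‖ₑ ^ 4
      = ENNReal.ofReal 4 * ∫⁻ t in Set.Ioi (0 : ℝ),
          volume {x | t < ‖(𝓕⁻ F : L2C) x‖} * ENNReal.ofReal (t ^ ((4 : ℝ) - 1)) := by rw [h1, h0]
    _ ≤ ENNReal.ofReal 4 * ∫⁻ t in Set.Ioi (0 : ℝ), ENNReal.ofReal 4 * ∫⁻ ξ, G t ξ := by
        gcongr 1
        refine setLIntegral_mono' measurableSet_Ioi fun t ht => ?_
        have ht' : 0 < t := ht
        refine (mul_le_mul_left (volume_lt_norm_fourierInv_le hA hF ht') _).trans (le_of_eq ?_)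
        have h5 : ∫⁻ ξ, G t ξ = ENNReal.ofReal t *
            ∫⁻ ξ, if |ξ| ≤ t ^ 2 / (8 * A ^ 2) then 0 else ‖F ξ‖ₑ ^ 2 :=
          lintegral_const_mul' _ _ ENNReal.ofReal_ne_top
        rw [h5, ← mul_assoc, mul_right_comm, ← ENNReal.ofReal_mul (by positivity),
          ← ENNReal.ofReal_mul (by positivity)]
        congr 2
        have : t ^ ((4 : ℝ) - 1) = t ^ 3 := by
          rw [show (4 : ℝ) - 1 = (3 : ℕ) by norm_num, Real.rpow_natCast]
        rw [this]; field_simp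
    _ = ENNReal.ofReal 16 * ∫⁻ ξ, ∫⁻ t in Set.Ioi (0 : ℝ), G t ξ := by
        rw [lintegral_const_mul' _ _ ENNReal.ofReal_ne_top, ← mul_assoc,
          ← ENNReal.ofReal_mul (by norm_num), lintegral_lintegral_swap hGm]
        norm_num
    _ ≤ ENNReal.ofReal 16 *
          ∫⁻ ξ, ENNReal.ofReal (8 * A ^ 2) * (ENNReal.ofReal |ξ| * ‖F ξ‖ₑ ^ 2) := by
        gcongr with ξ
        set s := Real.sqrt (8 * A ^ 2 * |ξ|) with hs
        have hs2 : s * s = 8 * A ^ 2 * |ξ| := Real.mul_self_sqrt (by positivity)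
        have h6 : ∀ t ∈ Set.Ioi (0 : ℝ), G t ξ ≤
            (Set.Ioc 0 s).indicator (fun _ => ENNReal.ofReal s * ‖F ξ‖ₑ ^ 2) t := by
          intro t ht
          have ht' : 0 < t := ht
          simp only [hG]
          split_ifs with hc
          · simp
          · have hts : t ≤ s := by
              rw [not_le, div_lt_iff₀ (by positivity)] at hc
              exact Real.le_sqrt_of_sq_le (by linarith)
            rw [Set.indicator_of_mem (show t ∈ Set.Ioc 0 s from ⟨ht', hts⟩)]
            gcongr
        refine (setLIntegral_mono' measurableSet_Ioi h6).trans ?_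
        refine (setLIntegral_le_lintegral _ _).trans ?_
        rw [lintegral_indicator measurableSet_Ioc, setLIntegral_const, Real.volume_Ioc, sub_zero,
          mul_right_comm, ← ENNReal.ofReal_mul (Real.sqrt_nonneg _), hs2,
          ENNReal.ofReal_mul (by positivity), mul_assoc]
    _ = _ := by
        rw [lintegral_const_mul' _ _ ENNReal.ofReal_ne_top, ← mul_assoc,
          ← ENNReal.ofReal_mul (by norm_num)]
        ring_nf

/-! ### Weak convergence -/

section WeakConvergence

variable {H : Type*} [NormedAddCommGroup H] [InnerProductSpace ℝ H]

/-- Weak convergence of a sequence in a Hilbert space. -/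
def WeakTo (u : ℕ → H) (g : H) : Prop :=
  ∀ h : H, Tendsto (fun n => inner ℝ (u n) h) atTop (𝓝 (inner ℝ g h))

theorem WeakTo.comp {u : ℕ → H} {g : H} (hu : WeakTo u g) {φ : ℕ → ℕ}
    (hφ : Tendsto φ atTop atTop) : WeakTo (u ∘ φ) g := fun h => (hu h).comp hφ

theorem WeakTo.add {u v : ℕ → H} {g k : H} (hu : WeakTo u g) (hv : WeakTo v k) :
    WeakTo (fun n => u n + v n) (g + k) := fun h => by
  simpa only [inner_add_left] using (hu h).add (hv h)

theorem WeakTo.sub {u v : ℕ → H} {g k : H} (hu : WeakTo u g) (hv : WeakTo v k) :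
    WeakTo (fun n => u n - v n) (g - k) := fun h => by
  simpa only [inner_sub_left] using (hu h).sub (hv h)

theorem weakTo_const (g : H) : WeakTo (fun _ => g) g := fun _ => tendsto_const_nhds

theorem WeakTo.unique {u : ℕ → H} {g k : H} (hu : WeakTo u g) (hv : WeakTo u k) : g = k :=
  ext_inner_right ℝ fun h => tendsto_nhds_unique (hu h) (hv h)

/-- A bounded sequence in a separable Hilbert space has a weakly convergent subsequence. -/
theorem exists_subseq_weakTo [CompleteSpace H] [TopologicalSpace.SeparableSpace H] {u : ℕ → H}
    {B : ℝ} (hB : ∀ n, ‖u n‖ ≤ B) : ∃ (φ : ℕ → ℕ) (g : H), StrictMono φ ∧ WeakTo (u ∘ φ) g := by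
  have hc := WeakDual.isSeqCompact_closedBall ℝ H (0 : StrongDual ℝ H) B
  obtain ⟨l, -, φ, hφ, hl⟩ := hc
    (x := fun n => StrongDual.toWeakDual (InnerProductSpace.toDual ℝ H (u n))) fun n => by
      simpa using hB n
  refine ⟨φ, (InnerProductSpace.toDual ℝ H).symm (WeakDual.toStrongDual l), hφ, fun h => ?_⟩
  have := ((WeakDual.eval_continuous (𝕜 := ℝ) h).tendsto l).comp hl
  rw [InnerProductSpace.toDual_symm_apply]
  exact this

theorem WeakTo.tendsto_clm [CompleteSpace H] {u : ℕ → H} {g : H} (hu : WeakTo u g)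
    (L : H →L[ℝ] ℝ) : Tendsto (fun n => L (u n)) atTop (𝓝 (L g)) := by
  have e : ∀ x, L x = inner ℝ x ((InnerProductSpace.toDual ℝ H).symm L) := fun x => by
    rw [real_inner_comm, InnerProductSpace.toDual_symm_apply]
  simp only [e]
  exact hu _

end WeakConvergence

theorem exists_cube_eq (x : ℝ) : ∃ r : ℝ, r ^ 3 = x := by
  have h : ∀ x : ℝ, 0 ≤ x → ∃ r : ℝ, r ^ 3 = x := fun x hx =>
    ⟨x ^ ((3 : ℝ)⁻¹), by rw [← Real.rpow_mul_natCast hx]; norm_num⟩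
  rcases le_total 0 x with hx | hx
  · exact h x hx
  · obtain ⟨r, hr⟩ := h (-x) (by linarith)
    exact ⟨-r, by rw [Odd.neg_pow (by decide), hr, neg_neg]⟩

/-- Since `a³ + b³ < (a² + b²)^{3/2}` for positive `a` and `b`, splitting a vector into orthogonal
parts lowers the cubic form. -/
theorem eq_zero_of_cube_le {a b m : ℝ} (ha : 0 < a) (hb : 0 ≤ b) (hm : 0 ≤ m)
    (h2 : a ^ 2 + b ^ 2 = m ^ 2) (h3 : m ^ 3 ≤ a ^ 3 + b ^ 3) : b = 0 := by
  have hbm : b < m := lt_of_pow_lt_pow_left₀ 2 hm (by nlinarith)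
  have ham : a ≤ m := le_of_sq_le_sq (by nlinarith) hm
  by_contra hb0
  have h4 : 0 < b ^ 2 * (m - b) := mul_pos (by positivity) (by linarith)
  have h5 : 0 ≤ a ^ 2 * (m - a) := mul_nonneg (by positivity) (by linarith)
  nlinarith

/-! ### Minimizers of invariant cubic forms -/

/-- A bounded symmetric trilinear form `T` on a Hilbert space, invariant under an isometric
representation `τ` of the line and an isometric reflection `ρ` with `ρ τ_y = τ_{-y} ρ`.

* `τ_mixing`: translates to infinity tend weakly to zero;
* `tendsto_zero`: local compactness, `T(uₙ, uₙ, h) → 0` if `uₙ ⇀ 0`;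
* `vanishing`: a bounded sequence all of whose translates tend weakly to zero has a cubic form that
  tends to zero;
* `nondeg`: the form does not vanish identically on the vectors fixed by `ρ`;
* `interaction`: a nonzero critical point has a positive inner product with some translate of its
  reflection. -/
structure InvariantCubicForm (H : Type*) [NormedAddCommGroup H] [InnerProductSpace ℝ H] where
  T : H → H → H → ℝ
  add_left : ∀ f f' g h, T (f + f') g h = T f g h + T f' g h
  smul_left : ∀ (r : ℝ) f g h, T (r • f) g h = r * T f g h
  swap_left : ∀ f g h, T f g h = T g f h
  swap_right : ∀ f g h, T f g h = T f h g
  bnd : ℝ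
  bound : ∀ f g h, |T f g h| ≤ bnd * ‖f‖ * ‖g‖ * ‖h‖
  τ : ℝ → H →ₗ[ℝ] H
  τ_zero : ∀ f, τ 0 f = f
  τ_add : ∀ y z f, τ (y + z) f = τ y (τ z f)
  inner_τ : ∀ y f g, inner ℝ (τ y f) (τ y g) = inner ℝ f g
  T_τ : ∀ y f g h, T (τ y f) (τ y g) (τ y h) = T f g h
  τ_cont : ∀ f, Continuous fun y => τ y f
  τ_mixing : ∀ f g, Tendsto (fun y => inner ℝ (τ y f) g) (cocompact ℝ) (𝓝 0)
  ρ : H →ₗ[ℝ] H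
  ρ_ρ : ∀ f, ρ (ρ f) = f
  ρ_τ : ∀ y f, ρ (τ y f) = τ (-y) (ρ f)
  inner_ρ : ∀ f g, inner ℝ (ρ f) (ρ g) = inner ℝ f g
  T_ρ : ∀ f g h, T (ρ f) (ρ g) (ρ h) = T f g h
  tendsto_zero : ∀ (u : ℕ → H) (B : ℝ) (h : H), (∀ n, ‖u n‖ ≤ B) → WeakTo u 0 →
    Tendsto (fun n => T (u n) (u n) h) atTop (𝓝 0)
  vanishing : ∀ (u : ℕ → H) (B : ℝ), (∀ n, ‖u n‖ ≤ B) →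
    (∀ y : ℕ → ℝ, WeakTo (fun n => τ (y n) (u n)) 0) →
    Tendsto (fun n => T (u n) (u n) (u n)) atTop (𝓝 0)
  nondeg : ∃ g h, ρ g = g ∧ ρ h = h ∧ T g g h ≠ 0
  interaction : ∀ (g : H) (μ : ℝ), g ≠ 0 → μ ≠ 0 → (∀ h, T g g h = μ * inner ℝ g h) →
    ∃ y, 0 < inner ℝ g (τ y (ρ g))

namespace InvariantCubicForm

variable {H : Type*} [NormedAddCommGroup H] [InnerProductSpace ℝ H] (F : InvariantCubicForm H)

/-- The cubic form `f ↦ T(f, f, f)`. -/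
def cub (f : H) : ℝ := F.T f f f

/-- The vectors fixed by the reflection. -/
def even : Submodule ℝ H := LinearMap.eqLocus F.ρ LinearMap.id

theorem mem_even {f : H} : f ∈ F.even ↔ F.ρ f = f := Iff.rfl

theorem add_mid (f g g' h : H) : F.T f (g + g') h = F.T f g h + F.T f g' h := by
  rw [F.swap_left, F.add_left, F.swap_left g, F.swap_left g']

theorem add_right (f g h h' : H) : F.T f g (h + h') = F.T f g h + F.T f g h' := by
  rw [F.swap_right, F.add_mid, F.swap_right f h, F.swap_right f h']

theorem smul_mid (r : ℝ) (f g h : H) : F.T f (r • g) h = r * F.T f g h := by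
  rw [F.swap_left, F.smul_left, F.swap_left g]

theorem smul_right (r : ℝ) (f g h : H) : F.T f g (r • h) = r * F.T f g h := by
  rw [F.swap_right, F.smul_mid, F.swap_right f h]

theorem cub_smul (r : ℝ) (f : H) : F.cub (r • f) = r ^ 3 * F.cub f := by
  simp only [cub, F.smul_left, F.smul_mid, F.smul_right]; ring

theorem cub_neg (f : H) : F.cub (-f) = -F.cub f := by
  rw [← neg_one_smul ℝ, cub_smul]; ring

theorem cub_add (f g : H) :
    F.cub (f + g) = F.cub f + 3 * F.T f f g + 3 * F.T f g g + F.cub g := by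
  simp only [cub, F.add_left, F.add_mid, F.add_right]
  rw [F.swap_right f g f, F.swap_left g f f, F.swap_right f g f, F.swap_left g f g,
    F.swap_right g g f, F.swap_left g f g]
  ring

theorem cub_add_smul (f g : H) (t : ℝ) :
    F.cub (f + t • g) = F.cub f + 3 * F.T f f g * t + 3 * F.T f g g * t ^ 2 + F.cub g * t ^ 3 := by
  simp only [cub_add, cub_smul, F.smul_mid, F.smul_right]
  ring

theorem cub_bound (f : H) : |F.cub f| ≤ F.bnd * ‖f‖ ^ 3 :=
  (F.bound f f f).trans (le_of_eq (by ring))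

theorem τ_neg_τ (y : ℝ) (f : H) : F.τ (-y) (F.τ y f) = f := by
  rw [← F.τ_add, neg_add_cancel, F.τ_zero]

theorem norm_τ (y : ℝ) (f : H) : ‖F.τ y f‖ = ‖f‖ := by
  have := F.inner_τ y f f
  rw [real_inner_self_eq_norm_sq, real_inner_self_eq_norm_sq] at this
  exact (pow_left_inj₀ (norm_nonneg _) (norm_nonneg _) two_ne_zero).1 this

theorem norm_ρ (f : H) : ‖F.ρ f‖ = ‖f‖ := by
  have := F.inner_ρ f f
  rw [real_inner_self_eq_norm_sq, real_inner_self_eq_norm_sq] at this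
  exact (pow_left_inj₀ (norm_nonneg _) (norm_nonneg _) two_ne_zero).1 this

theorem inner_τ_left (y : ℝ) (f g : H) : inner ℝ (F.τ y f) g = inner ℝ f (F.τ (-y) g) := by
  rw [← F.inner_τ (-y), τ_neg_τ]

theorem inner_ρ_left (f g : H) : inner ℝ (F.ρ f) g = inner ℝ f (F.ρ g) := by
  rw [← F.inner_ρ, F.ρ_ρ]

theorem cub_τ (y : ℝ) (f : H) : F.cub (F.τ y f) = F.cub f := F.T_τ y f f f

theorem cub_ρ (f : H) : F.cub (F.ρ f) = F.cub f := F.T_ρ f f f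

/-- `h ↦ T(f, g, h)` as a continuous functional. -/
def functional (f g : H) : H →L[ℝ] ℝ :=
  LinearMap.mkContinuous
    { toFun := fun h => F.T f g h
      map_add' := F.add_right f g
      map_smul' := fun r h => F.smul_right r f g h } (F.bnd * ‖f‖ * ‖g‖) (F.bound f g)

theorem functional_apply (f g h : H) : F.functional f g h = F.T f g h := rfl

theorem weakTo_τ {u : ℕ → H} {y : ℕ → ℝ} {a : ℝ} {g : H} {B : ℝ} (hB : ∀ n, ‖u n‖ ≤ B)
    (hu : WeakTo u g) (hy : Tendsto y atTop (𝓝 a)) :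
    WeakTo (fun n => F.τ (y n) (u n)) (F.τ a g) := by
  intro h
  have hd : Tendsto (fun n => F.τ (-y n) h - F.τ (-a) h) atTop (𝓝 0) := by
    have h1 := ((F.τ_cont h).tendsto (-a)).comp hy.neg
    rw [← sub_self (F.τ (-a) h)]
    exact h1.sub_const _
  have h2 : Tendsto (fun n => inner ℝ (u n) (F.τ (-y n) h - F.τ (-a) h)) atTop (𝓝 0) := by
    refine squeeze_zero_norm (fun n => (norm_inner_le_norm _ _).trans
      (mul_le_mul_of_nonneg_right (hB n) (norm_nonneg _))) ?_
    simpa using hd.norm.const_mul B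
  have h3 := h2.add (hu (F.τ (-a) h))
  rw [zero_add] at h3
  rw [F.inner_τ_left]
  refine h3.congr fun n => ?_
  rw [F.inner_τ_left, ← inner_add_right, sub_add_cancel]

theorem weakTo_τ_zero {y : ℕ → ℝ} (hy : Tendsto (fun n => |y n|) atTop atTop) (g : H) :
    WeakTo (fun n => F.τ (y n) g) 0 := by
  intro h
  rw [inner_zero_left]
  refine (F.τ_mixing g h).comp ?_
  rw [← Metric.cobounded_eq_cocompact, ← tendsto_norm_atTop_iff_cobounded]
  exact hy

theorem tendsto_cub_zero {u : ℕ → H} (hu : Tendsto (fun n => ‖u n‖) atTop (𝓝 0)) :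
    Tendsto (fun n => F.cub (u n)) atTop (𝓝 0) := by
  refine squeeze_zero_norm (fun n => F.cub_bound (u n)) ?_
  simpa using (hu.pow 3).const_mul F.bnd

/-- Superposing `g` and a translate of its reflection gives a translate of an even vector. -/
theorem cub_pair_le {A : ℝ} (hA : ∀ f ∈ F.even, F.cub f ≤ A * ‖f‖ ^ 3) (g : H) (y : ℝ) :
    F.cub (g + F.τ y (F.ρ g)) ≤ A * ‖g + F.τ y (F.ρ g)‖ ^ 3 := by
  rw [← F.cub_τ (-(y / 2)), ← F.norm_τ (-(y / 2)) (g + F.τ y (F.ρ g))]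
  refine hA _ ?_
  rw [F.mem_even, map_add, ← F.τ_add, map_add, F.ρ_τ, F.ρ_τ, F.ρ_ρ, add_comm]
  congr 2 <;> ring_nf

theorem norm_pair_sq (g : H) (y : ℝ) :
    ‖g + F.τ y (F.ρ g)‖ ^ 2 = 2 * ‖g‖ ^ 2 + 2 * inner ℝ g (F.τ y (F.ρ g)) := by
  rw [norm_add_sq_real, F.norm_τ, F.norm_ρ]; ring

/-- `g` has the least norm among the even vectors on which the cubic form takes the value `Λ`. -/
def IsMinimal (Λ : ℝ) (g : H) : Prop :=
  g ∈ F.even ∧ F.cub g = Λ ∧ ∀ f ∈ F.even, F.cub f = Λ → ‖g‖ ≤ ‖f‖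

theorem IsMinimal.smul {Λ : ℝ} {g : H} (hg : F.IsMinimal Λ g) {t : ℝ} (ht : 0 < t) :
    F.IsMinimal (t ^ 3 * Λ) (t • g) := by
  obtain ⟨h1, h2, h3⟩ := hg
  refine ⟨F.even.smul_mem t h1, by rw [F.cub_smul, h2], fun f hf hfc => ?_⟩
  have := h3 (t⁻¹ • f) (F.even.smul_mem _ hf) (by rw [F.cub_smul, hfc]; field_simp)
  rw [norm_smul, norm_inv, Real.norm_of_nonneg ht.le, ← div_eq_inv_mul, le_div_iff₀ ht] at this
  rw [norm_smul, Real.norm_of_nonneg ht.le]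
  linarith

/-- The Euler–Lagrange equation of a maximizer of `T(f, f, f) / ‖f‖³` on a subspace. -/
theorem eulerLagrange {S : Submodule ℝ H} {A : ℝ} (hA : 0 < A)
    (hS : ∀ f ∈ S, F.cub f ≤ A * ‖f‖ ^ 3) {g : H} (hg : g ∈ S) (hg0 : g ≠ 0)
    (hext : F.cub g = A * ‖g‖ ^ 3) {h : H} (hh : h ∈ S) :
    F.T g g h = A * ‖g‖ * inner ℝ g h := by
  set c₁ := F.T g g h
  set s := inner ℝ g h
  set a := ‖g‖
  have ha : 0 < a := norm_pos_iff.2 hg0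
  have hn : ∀ t : ℝ, ‖g + t • h‖ ^ 2 = a ^ 2 + 2 * s * t + ‖h‖ ^ 2 * t ^ 2 := fun t => by
    rw [norm_add_sq_real, inner_smul_right, norm_smul, mul_pow, Real.norm_eq_abs, sq_abs]
    ring
  -- Squaring turns the inequality into one between polynomials in `t`, with equality at `t = 0`.
  set f : ℝ → ℝ := fun t => A ^ 2 * (a ^ 2 + 2 * s * t + ‖h‖ ^ 2 * t ^ 2) ^ 3 -
    (A * a ^ 3 + 3 * c₁ * t + 3 * F.T g h h * t ^ 2 + F.cub h * t ^ 3) ^ 2 with hf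
  have hmin : IsLocalMin f 0 := by
    refine Eventually.of_forall fun t => ?_
    have h1 : f 0 = 0 := by simp only [hf]; ring
    have hmem : g + t • h ∈ S := S.add_mem hg (S.smul_mem t hh)
    have h2 : |F.cub (g + t • h)| ≤ A * ‖g + t • h‖ ^ 3 := by
      refine abs_le'.2 ⟨hS _ hmem, ?_⟩
      rw [← F.cub_neg, ← norm_neg]
      exact hS _ (S.neg_mem hmem)
    have h3 := pow_le_pow_left₀ (abs_nonneg _) h2 2
    rw [sq_abs, F.cub_add_smul, hext] at h3
    have h4 : (A * ‖g + t • h‖ ^ 3) ^ 2 = A ^ 2 * (‖g + t • h‖ ^ 2) ^ 3 := by ring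
    rw [h4, hn] at h3
    rw [h1]
    exact sub_nonneg.2 h3
  have hd : HasDerivAt f (A ^ 2 * (3 * (a ^ 2) ^ 2 * (2 * s)) - 2 * (A * a ^ 3) * (3 * c₁)) 0 := by
    have h1 : HasDerivAt (fun t : ℝ => a ^ 2 + 2 * s * t + ‖h‖ ^ 2 * t ^ 2) (2 * s) 0 := by
      have := (((hasDerivAt_id (0 : ℝ)).const_mul (2 * s)).const_add (a ^ 2)).fun_add
        (((hasDerivAt_id (0 : ℝ)).pow 2).const_mul (‖h‖ ^ 2))
      simpa using this
    have h2 : HasDerivAt (fun t : ℝ => A * a ^ 3 + 3 * c₁ * t + 3 * F.T g h h * t ^ 2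
        + F.cub h * t ^ 3) (3 * c₁) 0 := by
      have := ((((hasDerivAt_id (0 : ℝ)).const_mul (3 * c₁)).const_add (A * a ^ 3)).fun_add
        (((hasDerivAt_id (0 : ℝ)).pow 2).const_mul (3 * F.T g h h))).fun_add
        (((hasDerivAt_id (0 : ℝ)).pow 3).const_mul (F.cub h))
      simpa using this
    have := ((h1.fun_pow 3).const_mul (A ^ 2)).fun_sub (h2.fun_pow 2)
    simpa using this
  have h0 := hmin.hasDerivAt_eq_zero hd
  have h5 : 6 * A * a ^ 3 * (A * a * s - c₁) = 0 := by linear_combination h0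
  have h6 : (6 * A * a ^ 3) ≠ 0 := by positivity
  linarith [(mul_eq_zero.1 h5).resolve_left h6]

/-- A cube takes all values, so the cubic form does on even vectors. -/
theorem exists_even_cub_eq (Λ : ℝ) : ∃ g ∈ F.even, F.cub g = Λ := by
  obtain ⟨f, hf, hf0⟩ : ∃ f ∈ F.even, F.cub f ≠ 0 := by
    by_contra! h0
    obtain ⟨g, h, hg, hh, hne⟩ := F.nondeg
    have h1 := h0 _ (F.even.add_mem hg hh)
    have h2 := h0 _ (F.even.sub_mem hg hh)
    have h3 := h0 h hh
    have h4 := h0 g hg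
    rw [F.cub_add] at h1
    have e : g - h = g + (-1 : ℝ) • h := by rw [neg_one_smul, sub_eq_add_neg]
    rw [e, F.cub_add_smul] at h2
    exact hne (by linarith)
  obtain ⟨r, hr⟩ : ∃ r : ℝ, r ^ 3 = Λ / F.cub f :=
    exists_cube_eq _
  exact ⟨r • f, F.even.smul_mem r hf, by rw [F.cub_smul, hr, div_mul_cancel₀ _ hf0]⟩

/-- A lower bound of the norm under the constraint `cub = Λ` is, by scaling, an upper bound of the
homogeneous quotient `cub f / ‖f‖³`. -/
theorem cub_le_of_forall_norm_le {Λ m : ℝ} (hΛ : 0 < Λ) (hm : 0 < m)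
    (h : ∀ f ∈ F.even, F.cub f = Λ → m ≤ ‖f‖) {f : H} (hf : f ∈ F.even) :
    F.cub f ≤ Λ / m ^ 3 * ‖f‖ ^ 3 := by
  rcases le_or_gt (F.cub f) 0 with h0 | h0
  · exact h0.trans (by positivity)
  obtain ⟨r, hr⟩ : ∃ r : ℝ, r ^ 3 = Λ / F.cub f :=
    exists_cube_eq _
  have hr0 : 0 < r := by
    have : 0 < r ^ 3 := by rw [hr]; positivity
    exact (Odd.pow_pos_iff (by decide)).1 this
  have h1 := h (r • f) (F.even.smul_mem r hf) (by rw [F.cub_smul, hr, div_mul_cancel₀ _ h0.ne'])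
  rw [norm_smul, Real.norm_of_nonneg hr0.le] at h1
  have h2 := pow_le_pow_left₀ hm.le h1 3
  rw [mul_pow, hr, div_mul_eq_mul_div, le_div_iff₀ h0] at h2
  rw [div_mul_eq_mul_div, le_div_iff₀ (by positivity)]
  linarith

/-- The Euler–Lagrange equation of a minimizer, tested against all vectors, even or not. -/
theorem IsMinimal.eulerLagrange {Λ : ℝ} (hΛ : 0 < Λ) {g : H} (hg : F.IsMinimal Λ g) :
    ∃ μ, 0 < μ ∧ ∀ h, F.T g g h = μ * inner ℝ g h := by
  obtain ⟨h1, h2, h3⟩ := hg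
  have hg0 : g ≠ 0 := by
    rintro rfl
    have := F.cub_smul 0 0
    rw [zero_smul, h2] at this
    norm_num at this
    exact hΛ.ne' this
  have hgp : 0 < ‖g‖ := norm_pos_iff.2 hg0
  have hEL : ∀ h ∈ F.even, F.T g g h = Λ / ‖g‖ ^ 3 * ‖g‖ * inner ℝ g h := fun h hh =>
    F.eulerLagrange (by positivity) (fun f hf => F.cub_le_of_forall_norm_le hΛ hgp h3 hf) h1 hg0
      (by rw [h2]; field_simp) hh
  refine ⟨Λ / ‖g‖ ^ 3 * ‖g‖, by positivity, fun h => ?_⟩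
  -- Both sides are unchanged when `h` is replaced by its reflection.
  have h4 := hEL (h + F.ρ h) (by rw [F.mem_even, map_add, F.ρ_ρ, add_comm])
  have h5 : F.T g g (F.ρ h) = F.T g g h := by
    rw [← F.T_ρ, F.mem_even.1 h1, F.ρ_ρ]
  have h6 : inner ℝ g (F.ρ h) = inner ℝ g h := by
    rw [← F.inner_ρ_left, F.mem_even.1 h1]
  rw [F.add_right, inner_add_right, h5, h6] at h4
  linarith

variable [CompleteSpace H]

/-- The splitting of the cubic form along a weakly convergent sequence. -/
theorem tendsto_cub_sub {u : ℕ → H} {g : H} {B : ℝ} (hB : ∀ n, ‖u n‖ ≤ B) (hu : WeakTo u g) :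
    Tendsto (fun n => F.cub (u n) - F.cub (u n - g)) atTop (𝓝 (F.cub g)) := by
  have hr : WeakTo (fun n => u n - g) 0 := by simpa using hu.sub (weakTo_const g)
  have h1 := F.tendsto_zero (fun n => u n - g) (B + ‖g‖) g
    (fun n => (norm_sub_le _ _).trans (by linarith [hB n])) hr
  have h2 := hr.tendsto_clm (F.functional g g)
  rw [map_zero] at h2
  have h3 := ((h1.const_mul 3).add (h2.const_mul 3)).add_const (F.cub g)
  simp only [mul_zero, zero_add] at h3
  refine h3.congr fun n => ?_
  have h4 := F.cub_add (u n - g) g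
  rw [sub_add_cancel] at h4
  rw [h4, F.functional_apply, F.swap_right g g, F.swap_left g]
  ring

theorem tendsto_cub {u : ℕ → H} {g : H} {B : ℝ} (hB : ∀ n, ‖u n‖ ≤ B)
    (hu : Tendsto u atTop (𝓝 g)) : Tendsto (fun n => F.cub (u n)) atTop (𝓝 (F.cub g)) := by
  simpa using (F.tendsto_cub_sub hB fun h => hu.inner tendsto_const_nhds).add
    (F.tendsto_cub_zero (tendsto_iff_norm_sub_tendsto_zero.1 hu))

/-- The constant of the cubic form on the whole space is at most `√2` times the one on the even
vectors: separate `g` and its reflection by a large distance. -/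
theorem cub_le_sqrt_two_mul {A : ℝ} (hA : ∀ f ∈ F.even, F.cub f ≤ A * ‖f‖ ^ 3) (g : H) :
    F.cub g ≤ A * Real.sqrt 2 * ‖g‖ ^ 3 := by
  have hy : Tendsto (fun n : ℕ => |(n : ℝ)|) atTop atTop :=
    tendsto_abs_atTop_atTop.comp tendsto_natCast_atTop_atTop
  have hw : WeakTo (fun n : ℕ => F.τ n (F.ρ g)) 0 := F.weakTo_τ_zero hy _
  have hw2 : WeakTo (fun n : ℕ => g + F.τ n (F.ρ g)) g := by
    simpa using (weakTo_const g).add hw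
  have h1 := F.tendsto_cub_sub (B := ‖g‖ + ‖g‖)
    (fun n => (norm_add_le _ _).trans (by rw [F.norm_τ, F.norm_ρ])) hw2
  simp only [add_sub_cancel_left, F.cub_τ, F.cub_ρ] at h1
  have h2 : Tendsto (fun n : ℕ => ‖g + F.τ n (F.ρ g)‖) atTop (𝓝 (Real.sqrt 2 * ‖g‖)) := by
    have h3 := ((hw g).const_mul 2).const_add (2 * ‖g‖ ^ 2)
    simp only [inner_zero_left, mul_zero, add_zero] at h3
    have h4 := h3.sqrt
    rw [Real.sqrt_mul (by norm_num), Real.sqrt_sq (norm_nonneg _)] at h4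
    refine h4.congr fun n => ?_
    rw [real_inner_comm, ← F.norm_pair_sq, Real.sqrt_sq (norm_nonneg _)]
  have h5 := le_of_tendsto_of_tendsto' h1 (((h2.pow 3).const_mul A).sub_const (F.cub g))
    fun n => sub_le_sub_right (F.cub_pair_le hA g n) _
  have h6 : (Real.sqrt 2 * ‖g‖) ^ 3 = 2 * (Real.sqrt 2 * ‖g‖ ^ 3) := by
    rw [mul_pow, pow_succ (Real.sqrt 2), Real.sq_sqrt (by norm_num)]; ring
  rw [h6] at h5
  linarith

/-- The bound `cub_le_sqrt_two_mul` is never attained: by the Euler–Lagrange equation, `g` and a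
suitable translate of its reflection attract each other, so that their superposition would violate
the bound for even vectors. -/
theorem cub_ne_sqrt_two_mul {A : ℝ} (hA0 : 0 < A) (hA : ∀ f ∈ F.even, F.cub f ≤ A * ‖f‖ ^ 3)
    {g : H} (hg : g ≠ 0) : F.cub g ≠ A * Real.sqrt 2 * ‖g‖ ^ 3 := by
  intro hext
  have ha : 0 < ‖g‖ := norm_pos_iff.2 hg
  have hEL : ∀ h, F.T g g h = A * Real.sqrt 2 * ‖g‖ * inner ℝ g h := fun h =>
    F.eulerLagrange (S := ⊤) (by positivity) (fun f _ => F.cub_le_sqrt_two_mul hA f)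
      Submodule.mem_top hg hext Submodule.mem_top
  obtain ⟨y, hy⟩ := F.interaction g _ hg (by positivity) hEL
  set k := F.τ y (F.ρ g) with hk
  set s := inner ℝ g k
  -- `f ↦ τ_y ρ f` is an involution that exchanges `g` and `k`.
  have hkg : F.τ y (F.ρ k) = g := by
    rw [hk, F.ρ_τ, F.ρ_ρ, ← F.τ_add, add_neg_cancel, F.τ_zero]
  have hsym : F.T g k k = F.T g g k := by
    rw [← F.T_ρ, ← F.T_τ y, hkg, ← hk, F.swap_right, F.swap_left, F.swap_right]
  have h1 := F.cub_pair_le hA g y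
  rw [← hk, F.cub_add, hsym, hEL, hk, F.cub_τ, F.cub_ρ, ← hk, hext] at h1
  have h2 : ‖g + k‖ ^ 2 = 2 * ‖g‖ ^ 2 + 2 * s := F.norm_pair_sq g y
  have hs : s ≤ ‖g‖ ^ 2 := by
    have := real_inner_le_norm g k
    rw [hk, F.norm_τ, F.norm_ρ, ← hk] at this
    rw [sq]; exact this
  set a := ‖g‖
  have h3 : A * (Real.sqrt 2 * (2 * a ^ 3 + 6 * a * s)) ≤ A * ‖g + k‖ ^ 3 := by
    refine le_trans (le_of_eq ?_) h1
    ring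
  have h4 := pow_le_pow_left₀ (by positivity) (le_of_mul_le_mul_left h3 hA0) 2
  have h5 : (‖g + k‖ ^ 3) ^ 2 = (2 * a ^ 2 + 2 * s) ^ 3 := by rw [← h2]; ring
  rw [h5, mul_pow, Real.sq_sqrt (by norm_num)] at h4
  -- With `x = s / a² ∈ (0, 1]` the bound reads `1 + 3 x ≤ (1 + x)^{3/2}`, which is false.
  have h6 : 3 * a ^ 4 * s + 6 * a ^ 2 * s ^ 2 ≤ s ^ 3 := by nlinarith
  have h7 : s ^ 3 ≤ a ^ 4 * s := by
    have := pow_le_pow_left₀ hy.le hs 2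
    nlinarith
  have h8 : 0 < a ^ 4 * s := by positivity
  nlinarith [sq_nonneg (a * s)]

/-- A bounded sequence on which the cubic form does not tend to zero has, up to the action of
`τ`, a nonzero weak limit point. -/
theorem exists_weakTo_ne_zero [TopologicalSpace.SeparableSpace H] {u : ℕ → H} {B Λ : ℝ}
    (hB : ∀ n, ‖u n‖ ≤ B) (hΛ : Λ ≠ 0) (hu : ∀ n, F.cub (u n) = Λ) :
    ∃ (φ : ℕ → ℕ) (y : ℕ → ℝ) (g : H), StrictMono φ ∧ g ≠ 0 ∧
      WeakTo (fun n => F.τ (y n) (u (φ n))) g := by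
  by_cases hv : ∀ y : ℕ → ℝ, WeakTo (fun n => F.τ (y n) (u n)) 0
  · have h1 := F.vanishing u B hB hv
    have h2 : Tendsto (fun _ : ℕ => Λ) atTop (𝓝 0) := h1.congr hu
    exact absurd (tendsto_nhds_unique tendsto_const_nhds h2) hΛ
  · simp only [WeakTo, not_forall] at hv
    obtain ⟨y, h, hh⟩ := hv
    rw [inner_zero_left, Metric.tendsto_atTop] at hh
    push Not at hh
    obtain ⟨ε, hε, hf⟩ := hh
    obtain ⟨φ₁, hφ₁, h1⟩ := extraction_of_frequently_atTop (frequently_atTop.2 hf)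
    obtain ⟨φ₂, g, hφ₂, hg⟩ := exists_subseq_weakTo
      (u := fun n => F.τ (y (φ₁ n)) (u (φ₁ n))) (B := B) fun n => by rw [F.norm_τ]; exact hB _
    refine ⟨φ₁ ∘ φ₂, y ∘ φ₁ ∘ φ₂, g, hφ₁.comp hφ₂, ?_, hg⟩
    rintro rfl
    have h2 := (hg h).norm
    rw [inner_zero_left, norm_zero] at h2
    refine absurd (ge_of_tendsto' h2 fun n => ?_) (not_le.2 hε)
    have := h1 (φ₂ n)
    rwa [dist_zero_right] at this

/-- A maximizing sequence of even vectors with a nonzero weak limit `g` converges strongly: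
otherwise the mass splits between `g` and `u n - g`. -/
theorem tendsto_of_weakTo_even {A m : ℝ} (hA0 : 0 < A)
    (hA : ∀ f ∈ F.even, F.cub f ≤ A * ‖f‖ ^ 3) {u : ℕ → H} (hu : ∀ n, u n ∈ F.even)
    (hm : Tendsto (fun n => ‖u n‖) atTop (𝓝 m)) (hc : ∀ n, F.cub (u n) = A * m ^ 3) {g : H}
    (hg : WeakTo u g) (hg0 : g ≠ 0) : g ∈ F.even ∧ Tendsto u atTop (𝓝 g) := by
  obtain ⟨B, hB⟩ : ∃ B, ∀ n, ‖u n‖ ≤ B := by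
    obtain ⟨B, hB⟩ := hm.bddAbove_range
    exact ⟨B, fun n => hB ⟨n, rfl⟩⟩
  have hge : g ∈ F.even := by
    rw [F.mem_even]
    refine WeakTo.unique (u := u) (fun h => ?_) hg
    rw [F.inner_ρ_left]
    refine (hg (F.ρ h)).congr fun n => ?_
    rw [← F.inner_ρ_left, F.mem_even.1 (hu n)]
  refine ⟨hge, ?_⟩
  have hm0 : 0 ≤ m := ge_of_tendsto' hm fun n => norm_nonneg _
  have h1 : Tendsto (fun n => ‖u n - g‖ ^ 2) atTop (𝓝 (m ^ 2 - ‖g‖ ^ 2)) := by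
    have := ((hm.pow 2).sub ((hg g).const_mul 2)).add_const (‖g‖ ^ 2)
    rw [real_inner_self_eq_norm_sq] at this
    refine (this.congr fun n => ?_).trans (le_of_eq (by ring_nf))
    rw [norm_sub_sq_real]
  have hb0 : 0 ≤ m ^ 2 - ‖g‖ ^ 2 := ge_of_tendsto' h1 fun n => by positivity
  set b := Real.sqrt (m ^ 2 - ‖g‖ ^ 2) with hb
  have h2 : Tendsto (fun n => ‖u n - g‖) atTop (𝓝 b) := by
    refine h1.sqrt.congr fun n => ?_
    rw [Real.sqrt_sq (norm_nonneg _)]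
  have h3 : A * m ^ 3 - A * b ^ 3 ≤ F.cub g := by
    refine le_of_tendsto_of_tendsto' (((h2.pow 3).const_mul A).const_sub (A * m ^ 3))
      (F.tendsto_cub_sub hB hg) fun n => ?_
    rw [hc]
    exact sub_le_sub_left (hA _ (F.even.sub_mem (hu n) hge)) _
  have hbz : b = 0 := by
    refine eq_zero_of_cube_le (norm_pos_iff.2 hg0) (Real.sqrt_nonneg _) hm0 ?_ ?_ (a := ‖g‖)
      (m := m)
    · rw [hb, Real.sq_sqrt hb0]; ring
    · refine le_of_mul_le_mul_left ?_ hA0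
      linarith [hA g hge]
  rw [hbz] at h2
  exact tendsto_iff_norm_sub_tendsto_zero.2 h2

/-- A maximizing sequence of even vectors cannot break up into two bumps that drift apart: they
would carry the whole mass, and the bump `g` would attain the bound `cub_le_sqrt_two_mul`. -/
theorem not_tendsto_atTop_of_weakTo {A m : ℝ} (hA0 : 0 < A)
    (hA : ∀ f ∈ F.even, F.cub f ≤ A * ‖f‖ ^ 3) {u : ℕ → H} (hu : ∀ n, u n ∈ F.even)
    (hm : Tendsto (fun n => ‖u n‖) atTop (𝓝 m)) (hc : ∀ n, F.cub (u n) = A * m ^ 3) {g : H}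
    {y : ℕ → ℝ} (hg : WeakTo (fun n => F.τ (y n) (u n)) g) (hg0 : g ≠ 0) :
    ¬ Tendsto (fun n => |y n|) atTop atTop := by
  intro hy
  obtain ⟨B, hB⟩ : ∃ B, ∀ n, ‖u n‖ ≤ B := by
    obtain ⟨B, hB⟩ := hm.bddAbove_range
    exact ⟨B, fun n => hB ⟨n, rfl⟩⟩
  have hm0 : 0 ≤ m := ge_of_tendsto' hm fun n => norm_nonneg _
  -- By evenness the second bump is the reflection of the first one.
  have hg' : WeakTo (fun n => F.τ (-y n) (u n)) (F.ρ g) := fun h => by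
    rw [F.inner_ρ_left]
    refine (hg (F.ρ h)).congr fun n => ?_
    rw [← F.inner_ρ_left, F.ρ_τ, F.mem_even.1 (hu n)]
  -- The distance between the two bumps tends to infinity.
  have hy2 : Tendsto (fun n => |-(2 * y n)|) atTop atTop := by
    have := hy.const_mul_atTop (show (0 : ℝ) < 2 by norm_num)
    refine this.congr fun n => ?_
    rw [abs_neg, abs_mul, abs_two]
  have hfar : WeakTo (fun n => F.τ (-(2 * y n)) g) 0 := F.weakTo_τ_zero hy2 g
  set r : ℕ → H := fun n => u n - F.τ (-y n) g - F.τ (y n) (F.ρ g) with hr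
  have hre : ∀ n, r n ∈ F.even := fun n => by
    rw [F.mem_even, hr]
    simp only [map_sub, F.ρ_τ, F.ρ_ρ, neg_neg, F.mem_even.1 (hu n)]
    abel
  have hrn : ∀ n, ‖r n‖ ^ 2 = ‖u n‖ ^ 2 + 2 * ‖g‖ ^ 2 - 2 * inner ℝ (F.τ (y n) (u n)) g
      - 2 * inner ℝ (F.τ (-y n) (u n)) (F.ρ g)
      + 2 * inner ℝ (F.τ (-(2 * y n)) g) (F.ρ g) := fun n => by
    have e1 : inner ℝ (u n) (F.τ (-y n) g) = inner ℝ (F.τ (y n) (u n)) g := by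
      rw [F.inner_τ_left]
    have e2 : inner ℝ (u n) (F.τ (y n) (F.ρ g)) = inner ℝ (F.τ (-y n) (u n)) (F.ρ g) := by
      rw [F.inner_τ_left, neg_neg]
    have e3 : inner ℝ (F.τ (-y n) g) (F.τ (y n) (F.ρ g)) =
        inner ℝ (F.τ (-(2 * y n)) g) (F.ρ g) := by
      rw [F.inner_τ_left, F.inner_τ_left, ← F.τ_add, neg_neg, neg_neg, two_mul]
    rw [hr]
    simp only
    rw [norm_sub_sq_real, norm_sub_sq_real, inner_sub_left, e1, e2, e3, F.norm_τ, F.norm_τ,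
      F.norm_ρ]
    ring
  have h1 : Tendsto (fun n => ‖r n‖ ^ 2) atTop (𝓝 (m ^ 2 - 2 * ‖g‖ ^ 2)) := by
    have := ((((hm.pow 2).add_const (2 * ‖g‖ ^ 2)).sub ((hg g).const_mul 2)).sub
      ((hg' (F.ρ g)).const_mul 2)).add ((hfar (F.ρ g)).const_mul 2)
    rw [real_inner_self_eq_norm_sq, real_inner_self_eq_norm_sq, inner_zero_left, F.norm_ρ] at this
    exact (this.congr fun n => (hrn n).symm).trans (le_of_eq (by ring_nf))
  have hb0 : 0 ≤ m ^ 2 - 2 * ‖g‖ ^ 2 := ge_of_tendsto' h1 fun n => by positivity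
  set b := Real.sqrt (m ^ 2 - 2 * ‖g‖ ^ 2) with hb
  have h2 : Tendsto (fun n => ‖r n‖) atTop (𝓝 b) := by
    refine h1.sqrt.congr fun n => ?_
    rw [Real.sqrt_sq (norm_nonneg _)]
  have h3 : Tendsto (fun n => F.cub (u n) - F.cub (r n)) atTop (𝓝 (2 * F.cub g)) := by
    have k1 := F.tendsto_cub_sub (fun n => (F.norm_τ (y n) (u n)).trans_le (hB n)) hg
    have hw : WeakTo (fun n => F.τ (-y n) (u n) - F.τ (-(2 * y n)) g) (F.ρ g) := by
      simpa using hg'.sub hfar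
    have k2 := F.tendsto_cub_sub (B := B + ‖g‖) (fun n => (norm_sub_le _ _).trans
      (add_le_add ((F.norm_τ _ _).trans_le (hB n)) (F.norm_τ _ _).le)) hw
    rw [F.cub_ρ] at k2
    refine ((k1.add k2).congr fun n => ?_).trans (le_of_eq (by ring_nf))
    have e1 : F.τ (-(2 * y n)) (F.τ (y n) (u n) - g) =
        F.τ (-y n) (u n) - F.τ (-(2 * y n)) g := by
      rw [map_sub, ← F.τ_add]; congr 3; ring
    have e2 : F.τ (-y n) (r n) = F.τ (-y n) (u n) - F.τ (-(2 * y n)) g - F.ρ g := by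
      rw [hr]
      simp only [map_sub, ← F.τ_add, neg_add_cancel, F.τ_zero]
      congr 4; ring
    rw [← e2, F.cub_τ, F.cub_τ, ← e1, F.cub_τ]
    ring
  have h4 : A * m ^ 3 - A * b ^ 3 ≤ 2 * F.cub g := by
    refine le_of_tendsto_of_tendsto' (((h2.pow 3).const_mul A).const_sub (A * m ^ 3)) h3 fun n => ?_
    rw [hc]
    exact sub_le_sub_left (hA _ (hre n)) _
  have h5 := F.cub_le_sqrt_two_mul hA g
  have h6 : (Real.sqrt 2 * ‖g‖) ^ 3 = 2 * (Real.sqrt 2 * ‖g‖ ^ 3) := by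
    rw [mul_pow, pow_succ (Real.sqrt 2), Real.sq_sqrt (by norm_num)]; ring
  have h7 : (Real.sqrt 2 * ‖g‖) ^ 2 = 2 * ‖g‖ ^ 2 := by
    rw [mul_pow, Real.sq_sqrt (by norm_num)]
  have hg1 : 0 < ‖g‖ := norm_pos_iff.2 hg0
  have hb2 : b ^ 2 = m ^ 2 - 2 * ‖g‖ ^ 2 := Real.sq_sqrt hb0
  have hbz : b = 0 := by
    refine eq_zero_of_cube_le (a := Real.sqrt 2 * ‖g‖) (m := m) (by positivity)
      (Real.sqrt_nonneg _) hm0 (by rw [h7, hb2]; ring) ?_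
    refine le_of_mul_le_mul_left ?_ hA0
    rw [h6]
    linarith
  refine F.cub_ne_sqrt_two_mul hA0 hA hg0 (le_antisymm h5 ?_)
  have hmg : m = Real.sqrt 2 * ‖g‖ := by
    refine (pow_left_inj₀ hm0 (by positivity) two_ne_zero).1 ?_
    rw [h7]
    rw [hbz] at hb2
    linarith
  rw [hbz, hmg, h6] at h4
  linarith

/-- Maximizing sequences of even vectors for `T(f, f, f) / ‖f‖³` are relatively compact. -/
theorem exists_subseq_tendsto [TopologicalSpace.SeparableSpace H] {A m : ℝ} (hA0 : 0 < A)
    (hm0 : 0 < m) (hA : ∀ f ∈ F.even, F.cub f ≤ A * ‖f‖ ^ 3) {u : ℕ → H}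
    (hu : ∀ n, u n ∈ F.even) (hm : Tendsto (fun n => ‖u n‖) atTop (𝓝 m))
    (hc : ∀ n, F.cub (u n) = A * m ^ 3) :
    ∃ (φ : ℕ → ℕ) (g : H), StrictMono φ ∧ g ∈ F.even ∧ Tendsto (u ∘ φ) atTop (𝓝 g) := by
  obtain ⟨B, hB⟩ : ∃ B, ∀ n, ‖u n‖ ≤ B := by
    obtain ⟨B, hB⟩ := hm.bddAbove_range
    exact ⟨B, fun n => hB ⟨n, rfl⟩⟩
  obtain ⟨φ, y, g, hφ, hg0, hg⟩ :=
    F.exists_weakTo_ne_zero hB (show A * m ^ 3 ≠ 0 by positivity) hc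
  have hy := F.not_tendsto_atTop_of_weakTo hA0 hA (fun n => hu (φ n))
    (hm.comp hφ.tendsto_atTop) (fun n => hc (φ n)) hg hg0
  obtain ⟨R, hR⟩ : ∃ R, ∃ᶠ n in atTop, |y n| ≤ R := by
    rw [tendsto_atTop] at hy
    push Not at hy
    obtain ⟨R, hR⟩ := hy
    exact ⟨R, hR.mono fun n hn => hn.le⟩
  obtain ⟨a, -, φ₂, hφ₂, ha⟩ := tendsto_subseq_of_frequently_bounded
    (Metric.isBounded_Icc (-R) R) (hR.mono fun n hn => abs_le.1 hn)
  have h1 := F.weakTo_τ (fun n => (F.norm_τ _ _).trans_le (hB _)) (hg.comp hφ₂.tendsto_atTop)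
    ha.neg
  have h2 : WeakTo (u ∘ (φ ∘ φ₂)) (F.τ (-a) g) := fun h => by
    refine (h1 h).congr fun n => ?_
    simp only [Function.comp_apply, F.τ_neg_τ]
  have h3 : F.τ (-a) g ≠ 0 := by
    rw [← norm_pos_iff, F.norm_τ]; exact norm_pos_iff.2 hg0
  obtain ⟨he, ht⟩ := F.tendsto_of_weakTo_even hA0 hA (fun n => hu ((φ ∘ φ₂) n))
    (hm.comp (hφ.comp hφ₂).tendsto_atTop) (fun n => hc _) h2 h3
  exact ⟨φ ∘ φ₂, _, hφ.comp hφ₂, he, ht⟩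

/-- Minimizing sequences converge along a subsequence to a minimizer. -/
theorem exists_isMinimal_of_tendsto [TopologicalSpace.SeparableSpace H] {Λ m : ℝ} (hΛ : 0 < Λ)
    (hle : ∀ f ∈ F.even, F.cub f = Λ → m ≤ ‖f‖) {u : ℕ → H} (hu : ∀ n, u n ∈ F.even)
    (hc : ∀ n, F.cub (u n) = Λ) (hm : Tendsto (fun n => ‖u n‖) atTop (𝓝 m)) :
    ∃ (φ : ℕ → ℕ) (g : H), StrictMono φ ∧ F.IsMinimal Λ g ∧ Tendsto (u ∘ φ) atTop (𝓝 g) := by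
  have hm0 : 0 ≤ m := ge_of_tendsto' hm fun n => norm_nonneg _
  have hmp : 0 < m := by
    refine hm0.lt_of_ne fun h0 => ?_
    rw [← h0] at hm
    have h2 : Tendsto (fun _ : ℕ => Λ) atTop (𝓝 0) := (F.tendsto_cub_zero hm).congr hc
    exact hΛ.ne' (tendsto_nhds_unique tendsto_const_nhds h2)
  have hΛm : Λ = Λ / m ^ 3 * m ^ 3 := by field_simp
  obtain ⟨φ, g, hφ, hg, ht⟩ := F.exists_subseq_tendsto (A := Λ / m ^ 3) (by positivity) hmp
    (fun f hf => F.cub_le_of_forall_norm_le hΛ hmp hle hf) hu hm fun n => (hc n).trans hΛm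
  refine ⟨φ, g, hφ, ⟨hg, ?_, fun f hf hfc => ?_⟩, ht⟩
  · obtain ⟨B, hB⟩ : ∃ B, ∀ n, ‖u n‖ ≤ B := by
      obtain ⟨B, hB⟩ := hm.bddAbove_range
      exact ⟨B, fun n => hB ⟨n, rfl⟩⟩
    have h1 := F.tendsto_cub (fun n => hB (φ n)) ht
    exact tendsto_nhds_unique h1 (tendsto_const_nhds.congr fun n => (hc (φ n)).symm)
  · rw [tendsto_nhds_unique ht.norm (hm.comp hφ.tendsto_atTop)]
    exact hle f hf hfc

end InvariantCubicForm

/-! ### Modulations and Fourier transforms of real functions -/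

theorem integral_fourier_mul_eq {f g : ℝ → ℂ} (hf : Integrable f) (hg : Integrable g) :
    ∫ x, 𝓕 f x * g x = ∫ x, f x * 𝓕 g x := by
  have := VectorFourier.integral_fourierIntegral_smul_eq_flip (μ := (volume : Measure ℝ))
    (ν := (volume : Measure ℝ)) (L := innerₗ ℝ) Real.continuous_fourierChar
    (by exact continuous_inner) hf hg
  rw [flip_innerₗ] at this
  exact this

theorem continuous_fourier {f : ℝ → ℂ} (hf : Integrable f) : Continuous (𝓕 f) :=
  VectorFourier.fourierIntegral_continuous Real.continuous_fourierChar
    (by exact continuous_inner) hf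

theorem norm_fourier_le_integral_norm (f : ℝ → ℂ) (ξ : ℝ) : ‖𝓕 f ξ‖ ≤ ∫ x, ‖f x‖ :=
  VectorFourier.norm_fourierIntegral_le_integral_norm _ _ _ _ _

theorem ae_eq_zero_of_fourier_eq_zero {f : ℝ → ℂ} (hf : Integrable f) (h : 𝓕 f = 0) :
    f =ᵐ[volume] 0 := by
  refine ae_eq_of_forall_schwartz hf.locallyIntegrable (locallyIntegrable_const (0 : ℂ))
    fun φ => ?_
  have h1 := integral_fourier_mul_eq (𝓕⁻ φ).integrable hf
  rw [← SchwartzMap.fourier_coe, FourierTransform.fourier_fourierInv_eq, h] at h1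
  simpa using h1

theorem fourier_eq_symbTrans (f : ℝ → ℂ) (y : ℝ) : 𝓕 f (-y) = ∫ ξ, symbTrans y ξ * f ξ := by
  rw [← Real.fourierInv_eq_fourier_neg, Real.fourierInv_eq']
  refine integral_congr_ae (ae_of_all _ fun ξ => ?_)
  simp [symbTrans, mul_comm]

theorem integrable_mul_conj (f g : L2C) :
    Integrable (fun ξ => f ξ * starRingEnd ℂ (g ξ)) volume := by
  refine ((Lp.memLp f).integrable_mul (Lp.memLp (conjL g))).congr ?_
  filter_upwards [coeFn_conjL g] with ξ h
  rw [Pi.mul_apply, h]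

theorem inner_modL (y : ℝ) (f g : L2C) :
    inner ℝ (modL y f) g = (𝓕 (fun ξ => f ξ * starRingEnd ℂ (g ξ)) (-y)).re := by
  rw [fourier_eq_symbTrans, real_inner_L2C]
  have hi : Integrable (fun ξ => symbTrans y ξ * (f ξ * starRingEnd ℂ (g ξ))) volume :=
    (integrable_mul_conj f g).bdd_mul (continuous_symbTrans y).aestronglyMeasurable
      (ae_of_all _ fun ξ => (norm_symbTrans y ξ).le)
  rw [← RCLike.re_eq_complex_re, ← integral_re hi]
  refine integral_congr_ae ?_
  filter_upwards [coeFn_mulL _ (memLp_symbTrans y) f] with ξ h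
  rw [h, complex_real_inner, mul_assoc, RCLike.re_eq_complex_re]

theorem modL_zero (f : L2C) : modL 0 f = f := by
  refine Lp.ext ?_
  filter_upwards [coeFn_mulL _ (memLp_symbTrans 0) f] with ξ h
  rw [h]; simp [symbTrans]

theorem modL_add (y z : ℝ) (f : L2C) : modL (y + z) f = modL y (modL z f) := by
  refine Lp.ext ?_
  filter_upwards [coeFn_mulL _ (memLp_symbTrans (y + z)) f,
    coeFn_mulL _ (memLp_symbTrans y) (modL z f), coeFn_mulL _ (memLp_symbTrans z) f] with ξ h h1 h2
  rw [h, h1, h2, symbTrans_add, mul_assoc]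

theorem inner_modL_left (y : ℝ) (f g : L2C) : inner ℝ (modL y f) g = inner ℝ f (modL (-y) g) :=
  inner_mulL_left _ _ (fun ξ => (conj_symbTrans y ξ).symm) f g

theorem inner_modL_modL (y : ℝ) (f g : L2C) : inner ℝ (modL y f) (modL y g) = inner ℝ f g := by
  rw [inner_modL_left, ← modL_add, neg_add_cancel, modL_zero]

theorem continuous_modL (f : L2C) : Continuous fun y => modL y f := by
  rw [continuous_iff_continuousAt]
  intro y₀
  rw [ContinuousAt, tendsto_iff_norm_sub_tendsto_zero]
  have h1 : Tendsto (fun y => inner ℝ (modL y f) (modL y₀ f)) (𝓝 y₀) (𝓝 (‖f‖ ^ 2)) := by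
    have h2 : Continuous fun y => inner ℝ (modL y f) (modL y₀ f) := by
      simp only [inner_modL]
      exact Complex.continuous_re.comp
        ((continuous_fourier (integrable_mul_conj _ _)).comp continuous_neg)
    have h3 := h2.tendsto y₀
    rwa [inner_modL_modL, real_inner_self_eq_norm_sq] at h3
  have hn : ∀ y, ‖modL y f‖ ^ 2 = ‖f‖ ^ 2 := fun y => by
    rw [← real_inner_self_eq_norm_sq, inner_modL_modL, real_inner_self_eq_norm_sq]
  have h4 : Tendsto (fun y => ‖modL y f - modL y₀ f‖ ^ 2) (𝓝 y₀) (𝓝 0) := by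
    have := ((h1.const_mul 2).const_sub (‖f‖ ^ 2)).add_const (‖f‖ ^ 2)
    refine (this.congr fun y => ?_).trans (le_of_eq (by ring_nf))
    rw [norm_sub_sq_real, hn, hn]
  have h5 := h4.sqrt
  rw [Real.sqrt_zero] at h5
  exact h5.congr fun y => Real.sqrt_sq (norm_nonneg _)

theorem tendsto_inner_modL (f g : L2C) :
    Tendsto (fun y => inner ℝ (modL y f) g) (cocompact ℝ) (𝓝 0) := by
  simp only [inner_modL]
  have h1 := (Real.zero_at_infty_fourier (fun ξ => f ξ * starRingEnd ℂ (g ξ))).comp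
    (Homeomorph.neg ℝ).isClosedEmbedding.tendsto_cocompact
  have h2 := (Complex.continuous_re.tendsto 0).comp h1
  rw [Complex.zero_re] at h2
  exact h2

theorem reflL_reflL (f : L2C) : reflL (reflL f) = f := by
  refine Lp.ext ?_
  filter_upwards [coeFn_reflL (reflL f), ae_comp_neg (coeFn_reflL f)] with ξ h1 h2
  rw [h1, h2, neg_neg]

theorem reflL_mulL {b : ℝ → ℂ} (hb : MemLp b ⊤ volume) {b' : ℝ → ℂ} (hb' : MemLp b' ⊤ volume)
    (h : ∀ ξ, b (-ξ) = b' ξ) (f : L2C) : reflL (mulL b hb f) = mulL b' hb' (reflL f) := by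
  refine Lp.ext ?_
  filter_upwards [coeFn_reflL (mulL b hb f), ae_comp_neg (coeFn_mulL b hb f),
    coeFn_mulL b' hb' (reflL f), coeFn_reflL f] with ξ h1 h2 h3 h4
  rw [h1, h2, h3, h4, h]

theorem inner_reflL (f g : L2C) : inner ℝ (reflL f) (reflL g) = inner ℝ f g := by
  rw [real_inner_L2C, real_inner_L2C, ← integral_neg_eq_self]
  refine integral_congr_ae ?_
  filter_upwards [ae_comp_neg (coeFn_reflL f), ae_comp_neg (coeFn_reflL g)] with x h1 h2
  rw [h1, h2, neg_neg]

theorem mulL_comm {b : ℝ → ℂ} (hb : MemLp b ⊤ volume) {b' : ℝ → ℂ} (hb' : MemLp b' ⊤ volume)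
    (f : L2C) : mulL b hb (mulL b' hb' f) = mulL b' hb' (mulL b hb f) := by
  refine Lp.ext ?_
  filter_upwards [coeFn_mulL b hb (mulL b' hb' f), coeFn_mulL b' hb' f,
    coeFn_mulL b' hb' (mulL b hb f), coeFn_mulL b hb f] with ξ h1 h2 h3 h4
  rw [h1, h2, h3, h4, mul_left_comm]

theorem inner_fourier_left (f g : L2C) : inner ℝ (𝓕 f : L2C) g = inner ℝ f (𝓕⁻ g : L2C) := by
  obtain ⟨k, rfl⟩ := (Lp.fourierTransformₗᵢ ℝ ℂ).surjective g
  have h1 : (𝓕⁻ (Lp.fourierTransformₗᵢ ℝ ℂ k) : L2C) = k :=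
    (Lp.fourierTransformₗᵢ ℝ ℂ).symm_apply_apply k
  have h2 : (𝓕 f : L2C) = Lp.fourierTransformₗᵢ ℝ ℂ f := rfl
  rw [h1, h2, real_inner_eq_norm_add_mul_self_sub_norm_mul_self_sub_norm_mul_self_div_two,
    real_inner_eq_norm_add_mul_self_sub_norm_mul_self_sub_norm_mul_self_div_two, ← map_add,
    LinearIsometryEquiv.norm_map, LinearIsometryEquiv.norm_map, LinearIsometryEquiv.norm_map]

/-- The operator `g ↦ conj g(-·)`, which the inverse Fourier transform turns into complex
conjugation. -/
def starL : L2C →L[ℝ] L2C :=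
  (reflL.toContinuousLinearMap.restrictScalars ℝ).comp conjL

theorem coeFn_starL (g : L2C) : starL g =ᵐ[volume] fun ξ => starRingEnd ℂ (g (-ξ)) := by
  filter_upwards [coeFn_reflL (conjL g), ae_comp_neg (coeFn_conjL g)] with ξ h1 h2
  exact h1.trans h2

/-- The real Hilbert space of the `g ∈ L²` with `g(-ξ) = conj (g ξ)`, that is of the Fourier
transforms of real functions. -/
def herm : Submodule ℝ L2C := LinearMap.eqLocus (starL : L2C →ₗ[ℝ] L2C) LinearMap.id

theorem mem_herm {g : L2C} : g ∈ herm ↔ starL g = g := Iff.rfl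

theorem mem_herm_iff_ae {g : L2C} : g ∈ herm ↔ ∀ᵐ ξ, g (-ξ) = starRingEnd ℂ (g ξ) := by
  rw [mem_herm]
  constructor
  · intro h
    have h1 := coeFn_starL g
    rw [h] at h1
    filter_upwards [h1] with ξ h2
    rw [h2, Complex.conj_conj]
  · intro h
    refine Lp.ext ?_
    filter_upwards [coeFn_starL g, h] with ξ h1 h2
    rw [h1, h2, Complex.conj_conj]

instance : CompleteSpace herm := by
  have : IsClosed (herm : Set L2C) := isClosed_eq starL.continuous continuous_id
  exact this.completeSpace_coe

theorem mulL_mem_herm {b : ℝ → ℂ} (hb : MemLp b ⊤ volume)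
    (h : ∀ ξ, b (-ξ) = starRingEnd ℂ (b ξ)) {g : L2C} (hg : g ∈ herm) : mulL b hb g ∈ herm := by
  rw [mem_herm_iff_ae] at *
  filter_upwards [coeFn_mulL b hb g, ae_comp_neg (coeFn_mulL b hb g), hg] with ξ h1 h2 h3
  rw [h1, h2, h3, h, map_mul]

theorem reflL_mem_herm {g : L2C} (hg : g ∈ herm) : reflL g ∈ herm := by
  rw [mem_herm_iff_ae] at *
  filter_upwards [coeFn_reflL g, ae_comp_neg (coeFn_reflL g), ae_comp_neg hg] with ξ h1 h2 h3
  rw [h1, h2, h3]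

theorem conjL_toC (u : L2R) : conjL (toC u) = toC u := by
  refine Lp.ext ?_
  filter_upwards [coeFn_conjL (toC u), ContinuousLinearMap.coeFn_compLp Complex.ofRealCLM u]
    with x h1 h2
  rw [h1, show (toC u) x = (u x : ℂ) from h2, Complex.conj_ofReal]

theorem coeFn_toC (u : L2R) : toC u =ᵐ[volume] fun x => (u x : ℂ) :=
  ContinuousLinearMap.coeFn_compLp Complex.ofRealCLM u

theorem norm_toC (u : L2R) : ‖toC u‖ = ‖u‖ := by
  rw [Lp.norm_def, Lp.norm_def]
  congr 1
  refine eLpNorm_congr_norm_ae ?_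
  filter_upwards [coeFn_toC u] with x h
  rw [h, Complex.norm_real]

theorem fourier_mem_herm {f : L2C} (hf : conjL f = f) : (𝓕 f : L2C) ∈ herm := by
  have h1 := fourierInv_reflL_conjL (𝓕 f)
  rw [FourierTransform.fourierInv_fourier_eq, hf] at h1
  have h2 := congrArg (fun k : L2C => (𝓕 k : L2C)) h1
  simp only [FourierTransform.fourier_fourierInv_eq] at h2
  exact h2

/-- The real part of an `L²` function. -/
def reL : L2C →L[ℝ] L2R := ContinuousLinearMap.compLpL 2 volume Complex.reCLM

theorem coeFn_reL (f : L2C) : reL f =ᵐ[volume] fun x => (f x).re :=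
  ContinuousLinearMap.coeFn_compLp Complex.reCLM f

theorem norm_reL_le (f : L2C) : ‖reL f‖ ≤ ‖f‖ := by
  refine Lp.norm_le_norm_of_ae_le ?_
  filter_upwards [coeFn_reL f] with x h
  rw [h]
  exact Complex.abs_re_le_norm _

theorem toC_reL {g : L2C} (hg : g ∈ herm) : toC (reL (𝓕⁻ g)) = 𝓕⁻ g := by
  have h1 := fourierInv_reflL_conjL g
  have h2 : reflL (conjL g) = g := hg
  rw [h2] at h1
  refine Lp.ext ?_
  have h5 := coeFn_conjL (𝓕⁻ g)
  rw [← h1] at h5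
  filter_upwards [coeFn_toC (reL (𝓕⁻ g)), coeFn_reL (𝓕⁻ g), h5] with x h3 h4 h6
  rw [h3, h4]
  exact Complex.conj_eq_iff_re.1 h6.symm

theorem reL_toC (u : L2R) : reL (toC u) = u := by
  refine Lp.ext ?_
  filter_upwards [coeFn_reL (toC u), coeFn_toC u] with x h1 h2
  rw [h1, h2, Complex.ofReal_re]

/-! ### The energy space on the Fourier side -/

/-- The symbol `|2πξ| + c + γ / (2πξ)²` of the quadratic form `2 I`. -/
def weight (γ c ξ : ℝ) : ℝ := |2 * Real.pi * ξ| + c + γ * ((2 * Real.pi * ξ) ^ 2)⁻¹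

/-- The inverse square root of `weight`. -/
def symbRoot (γ c ξ : ℝ) : ℂ := ((Real.sqrt (weight γ c ξ))⁻¹ : ℝ)

section Weight

variable {γ c : ℝ}

theorem weight_neg (ξ : ℝ) : weight γ c (-ξ) = weight γ c ξ := by
  simp [weight]

theorem le_weight (hγ : 0 < γ) (ξ : ℝ) : c ≤ weight γ c ξ := by
  have h1 : 0 ≤ |2 * Real.pi * ξ| := abs_nonneg _
  have h2 : 0 ≤ γ * ((2 * Real.pi * ξ) ^ 2)⁻¹ := by positivity
  unfold weight; linarith

theorem abs_le_weight (hγ : 0 < γ) (hc : 0 < c) (ξ : ℝ) : |ξ| ≤ weight γ c ξ := by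
  have h1 : |ξ| ≤ |2 * Real.pi * ξ| := by
    rw [abs_mul, abs_of_pos (show 0 < 2 * Real.pi by positivity)]
    have := Real.pi_gt_three
    nlinarith [abs_nonneg ξ]
  have h2 : 0 ≤ γ * ((2 * Real.pi * ξ) ^ 2)⁻¹ := by positivity
  unfold weight; linarith

theorem weight_pos (hγ : 0 < γ) (hc : 0 < c) (ξ : ℝ) : 0 < weight γ c ξ :=
  hc.trans_le (le_weight hγ ξ)

theorem norm_symbRoot (ξ : ℝ) : ‖symbRoot γ c ξ‖ = (Real.sqrt (weight γ c ξ))⁻¹ := by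
  rw [symbRoot, Complex.norm_real, Real.norm_of_nonneg (by positivity)]

theorem norm_symbRoot_sq (hγ : 0 < γ) (hc : 0 < c) (ξ : ℝ) :
    ‖symbRoot γ c ξ‖ ^ 2 = (weight γ c ξ)⁻¹ := by
  rw [norm_symbRoot, inv_pow, Real.sq_sqrt (weight_pos hγ hc ξ).le]

theorem norm_symbRoot_le (hγ : 0 < γ) (hc : 0 < c) (ξ : ℝ) :
    ‖symbRoot γ c ξ‖ ≤ (Real.sqrt c)⁻¹ := by
  rw [norm_symbRoot]
  have := Real.sqrt_pos.2 hc
  gcongr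
  exact le_weight hγ ξ

theorem symbRoot_ne_zero (hγ : 0 < γ) (hc : 0 < c) (ξ : ℝ) : symbRoot γ c ξ ≠ 0 := by
  rw [← norm_pos_iff, norm_symbRoot]
  exact inv_pos.2 (Real.sqrt_pos.2 (weight_pos hγ hc ξ))

theorem symbRoot_neg (ξ : ℝ) : symbRoot γ c (-ξ) = symbRoot γ c ξ := by
  rw [symbRoot, weight_neg, symbRoot]

theorem conj_symbRoot (ξ : ℝ) : starRingEnd ℂ (symbRoot γ c ξ) = symbRoot γ c ξ :=
  Complex.conj_ofReal _

theorem measurable_weight : Measurable (weight γ c) := by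
  unfold weight; fun_prop

theorem measurable_symbRoot : Measurable (symbRoot γ c) := by
  have := measurable_weight (γ := γ) (c := c)
  unfold symbRoot; fun_prop

theorem memLp_symbRoot (hγ : 0 < γ) (hc : 0 < c) : MemLp (symbRoot γ c) ⊤ volume :=
  memLp_top_of_bound measurable_symbRoot.aestronglyMeasurable _
    (ae_of_all _ (norm_symbRoot_le hγ hc))

end Weight

section EnergySpace

variable {γ c : ℝ} (hγ : 0 < γ) (hc : 0 < c)

/-- Multiplication by `symbRoot`. -/
abbrev rootL : L2C →L[ℂ] L2C := mulL (symbRoot γ c) (memLp_symbRoot hγ hc)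

/-- The operator `g ↦ Re 𝓕⁻(weight^{-1/2} g)`. On `herm` it is a bijection onto the space of the
real `u` with `I(u) < ∞`, and `I` corresponds to `½ ‖g‖²`. -/
def fromFreq : L2C →L[ℝ] L2R :=
  reL.comp ((((Lp.fourierTransformₗᵢ ℝ ℂ).symm.toContinuousLinearEquiv :
    L2C →L[ℂ] L2C).comp (rootL hγ hc)).restrictScalars ℝ)

theorem fromFreq_apply (g : L2C) : fromFreq hγ hc g = reL (𝓕⁻ (rootL hγ hc g)) := rfl

theorem norm_rootL_le (g : L2C) : ‖rootL hγ hc g‖ ≤ (Real.sqrt c)⁻¹ * ‖g‖ :=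
  norm_mulL_le _ (norm_symbRoot_le hγ hc) g

theorem norm_fromFreq_le (g : L2C) : ‖fromFreq hγ hc g‖ ≤ (Real.sqrt c)⁻¹ * ‖g‖ := by
  rw [fromFreq_apply]
  exact (norm_reL_le _).trans ((norm_fourierInv _).trans_le (norm_rootL_le hγ hc g))

theorem rootL_mem_herm {g : L2C} (hg : g ∈ herm) : rootL hγ hc g ∈ herm :=
  mulL_mem_herm _ (fun ξ => by rw [symbRoot_neg, conj_symbRoot]) hg

theorem toC_fromFreq {g : L2C} (hg : g ∈ herm) :
    toC (fromFreq hγ hc g) = 𝓕⁻ (rootL hγ hc g) :=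
  toC_reL (rootL_mem_herm hγ hc hg)

theorem fourier_toC_fromFreq {g : L2C} (hg : g ∈ herm) :
    (𝓕 (toC (fromFreq hγ hc g)) : L2C) = rootL hγ hc g := by
  rw [toC_fromFreq hγ hc hg, FourierTransform.fourier_fourierInv_eq]

theorem rootL_injective {g : L2C} (h : rootL hγ hc g = 0) : g = 0 := by
  refine Lp.ext ?_
  have h1 := coeFn_mulL _ (memLp_symbRoot hγ hc) g
  rw [h] at h1
  filter_upwards [h1, Lp.coeFn_zero ℂ 2 (volume : Measure ℝ)] with ξ h2 h3
  rw [h3] at h2 ⊢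
  exact (mul_eq_zero.1 h2.symm).resolve_left (symbRoot_ne_zero hγ hc ξ)

theorem inner_fromFreq (u : L2R) (g : L2C) :
    inner ℝ u (fromFreq hγ hc g) = inner ℝ (rootL hγ hc (𝓕 (toC u))) g := by
  rw [inner_mulL_left _ (memLp_symbRoot hγ hc) (fun ξ => (conj_symbRoot ξ).symm),
    inner_fourier_left, fromFreq_apply, L2.inner_def, real_inner_L2C]
  refine integral_congr_ae ?_
  filter_upwards [coeFn_reL (𝓕⁻ (rootL hγ hc g)), coeFn_toC u] with x h1 h2
  rw [h1, h2, complex_real_inner]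
  simp [mul_comm]

theorem fromFreq_modL (y : ℝ) (g : L2C) :
    fromFreq hγ hc (modL y g) =ᵐ[volume] fun x => fromFreq hγ hc g (x + y) := by
  rw [fromFreq_apply, fromFreq_apply, mulL_comm, fourierInv_modL]
  filter_upwards [coeFn_reL (transL y (𝓕⁻ (rootL hγ hc g))), coeFn_transL y (𝓕⁻ (rootL hγ hc g)),
    ae_comp_add y (coeFn_reL (𝓕⁻ (rootL hγ hc g)))] with x h1 h2 h3
  rw [h1, h2, h3]

theorem fromFreq_reflL (g : L2C) :
    fromFreq hγ hc (reflL g) =ᵐ[volume] fun x => fromFreq hγ hc g (-x) := by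
  rw [fromFreq_apply, fromFreq_apply,
    ← reflL_mulL (memLp_symbRoot hγ hc) (memLp_symbRoot hγ hc) symbRoot_neg, fourierInv_reflL]
  filter_upwards [coeFn_reL (reflL (𝓕⁻ (rootL hγ hc g))), coeFn_reflL (𝓕⁻ (rootL hγ hc g)),
    ae_comp_neg (coeFn_reL (𝓕⁻ (rootL hγ hc g)))] with x h1 h2 h3
  rw [h1, h2, h3]

/-! ### The cubic form on the Fourier side -/

theorem lintegral_weight_rootL_le (g : L2C) :
    ∫⁻ ξ, ENNReal.ofReal |ξ| * ‖rootL hγ hc g ξ‖ₑ ^ 2 ≤ ENNReal.ofReal (‖g‖ ^ 2) := by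
  rw [← lintegral_enorm_sq]
  refine lintegral_mono_ae ?_
  filter_upwards [coeFn_mulL _ (memLp_symbRoot hγ hc) g] with ξ h
  rw [h, enorm_mul, mul_pow, ← mul_assoc]
  refine mul_le_of_le_one_left zero_le ?_
  rw [← ofReal_norm, ← ENNReal.ofReal_pow (norm_nonneg _), ← ENNReal.ofReal_mul (abs_nonneg _),
    norm_symbRoot_sq hγ hc, ENNReal.ofReal_le_one, ← div_eq_mul_inv,
    div_le_one (weight_pos hγ hc ξ)]
  exact abs_le_weight hγ hc ξ

/-- A constant for which `‖fromFreq g‖_{L⁴} ≤ embConst c * ‖g‖`. The summand `1` makes it at most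
its fourth power. -/
def embConst (c : ℝ) : ℝ := 1 + 128 / c

theorem eLpNorm_fromFreq_le (g : L2C) :
    eLpNorm (fromFreq hγ hc g) 4 volume ≤ ENNReal.ofReal (embConst c * ‖g‖) := by
  rcases eq_or_ne g 0 with rfl | hg
  · rw [map_zero, eLpNorm_congr_ae (Lp.coeFn_zero ℝ 2 volume)]; simp
  have hg0 : 0 < ‖g‖ := norm_pos_iff.2 hg
  have hL : 1 ≤ embConst c := by
    have : 0 < 128 / c := by positivity
    unfold embConst; linarith
  have h1 : ∫⁻ x, ‖fromFreq hγ hc g x‖ₑ ^ 4 ≤ ENNReal.ofReal ((embConst c * ‖g‖) ^ 4) := by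
    calc ∫⁻ x, ‖fromFreq hγ hc g x‖ₑ ^ 4
        ≤ ∫⁻ x, ‖(𝓕⁻ (rootL hγ hc g) : L2C) x‖ₑ ^ 4 := by
          refine lintegral_mono_ae ?_
          filter_upwards [coeFn_reL (𝓕⁻ (rootL hγ hc g))] with x hx
          rw [fromFreq_apply, hx]
          gcongr
          rw [← ofReal_norm, ← ofReal_norm]
          exact ENNReal.ofReal_le_ofReal (Complex.abs_re_le_norm _)
      _ ≤ ENNReal.ofReal (128 * ((Real.sqrt c)⁻¹ * ‖g‖) ^ 2) * ENNReal.ofReal (‖g‖ ^ 2) := by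
          refine (lintegral_fourierInv_pow_four_le (A := (Real.sqrt c)⁻¹ * ‖g‖) ?_
            (norm_rootL_le hγ hc g)).trans ?_
          · have := Real.sqrt_pos.2 hc
            positivity
          · gcongr
            exact lintegral_weight_rootL_le hγ hc g
      _ = ENNReal.ofReal (128 / c * ‖g‖ ^ 4) := by
          rw [← ENNReal.ofReal_mul (by positivity), mul_pow, inv_pow, Real.sq_sqrt hc.le]
          congr 1; ring
      _ ≤ _ := by
          refine ENNReal.ofReal_le_ofReal ?_
          rw [mul_pow]
          gcongr
          calc 128 / c ≤ embConst c := by unfold embConst; linarith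
            _ = embConst c ^ 1 := (pow_one _).symm
            _ ≤ embConst c ^ 4 := pow_le_pow_right₀ hL (by norm_num)
  rw [eLpNorm_eq_lintegral_rpow_enorm_toReal (by norm_num) (by norm_num)]
  have h2 : (ENNReal.toReal 4) = ((4 : ℕ) : ℝ) := by norm_num
  simp only [h2, ENNReal.rpow_natCast]
  rw [one_div, ENNReal.rpow_inv_le_iff (by norm_num), ENNReal.rpow_natCast,
    ← ENNReal.ofReal_pow (by positivity)]
  exact h1

theorem memLp_four_fromFreq (g : L2C) : MemLp (fromFreq hγ hc g) 4 volume :=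
  ⟨Lp.aestronglyMeasurable _, (eLpNorm_fromFreq_le hγ hc g).trans_lt ENNReal.ofReal_lt_top⟩

instance : ENNReal.HolderTriple 4 4 2 := ⟨by
  rw [← two_mul, show (4 : ENNReal) = 2 * 2 by norm_num,
    ENNReal.mul_inv (by norm_num) (by norm_num), ← mul_assoc,
    ENNReal.mul_inv_cancel (by norm_num) (by norm_num), one_mul]⟩

theorem memLp_prodFreq (f g : L2C) :
    MemLp (⇑(fromFreq hγ hc f) * ⇑(fromFreq hγ hc g)) 2 volume :=
  (memLp_four_fromFreq hγ hc g).mul (memLp_four_fromFreq hγ hc f)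

/-- The product of `fromFreq f` and `fromFreq g`, which lie in `L⁴`. -/
def prodFreq (f g : L2C) : L2R := (memLp_prodFreq hγ hc f g).toLp _

theorem coeFn_prodFreq (f g : L2C) :
    prodFreq hγ hc f g =ᵐ[volume] fun x => fromFreq hγ hc f x * fromFreq hγ hc g x :=
  (memLp_prodFreq hγ hc f g).coeFn_toLp

theorem norm_prodFreq_le (f g : L2C) :
    ‖prodFreq hγ hc f g‖ ≤ embConst c ^ 2 * ‖f‖ * ‖g‖ := by
  have hL : 0 ≤ embConst c := by unfold embConst; positivity
  rw [prodFreq, Lp.norm_toLp]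
  refine ENNReal.toReal_le_of_le_ofReal (by positivity) ?_
  have h1 := eLpNorm_smul_le_mul_eLpNorm (p := 4) (q := 4) (r := 2)
    (Lp.aestronglyMeasurable (fromFreq hγ hc g)) (Lp.aestronglyMeasurable (fromFreq hγ hc f))
  refine h1.trans ?_
  refine (mul_le_mul' (eLpNorm_fromFreq_le hγ hc f) (eLpNorm_fromFreq_le hγ hc g)).trans ?_
  rw [← ENNReal.ofReal_mul (by positivity)]
  exact ENNReal.ofReal_le_ofReal (le_of_eq (by ring))

theorem prodFreq_comm (f g : L2C) : prodFreq hγ hc f g = prodFreq hγ hc g f := by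
  refine Lp.ext ?_
  filter_upwards [coeFn_prodFreq hγ hc f g, coeFn_prodFreq hγ hc g f] with x h1 h2
  rw [h1, h2, mul_comm]

theorem prodFreq_add_left (f f' g : L2C) :
    prodFreq hγ hc (f + f') g = prodFreq hγ hc f g + prodFreq hγ hc f' g := by
  refine Lp.ext ?_
  filter_upwards [coeFn_prodFreq hγ hc (f + f') g, coeFn_prodFreq hγ hc f g,
    coeFn_prodFreq hγ hc f' g, Lp.coeFn_add (prodFreq hγ hc f g) (prodFreq hγ hc f' g),
    Lp.coeFn_add (fromFreq hγ hc f) (fromFreq hγ hc f')] with x h1 h2 h3 h4 h5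
  rw [h1, h4, Pi.add_apply, h2, h3, map_add, h5, Pi.add_apply, add_mul]

theorem prodFreq_smul_left (r : ℝ) (f g : L2C) :
    prodFreq hγ hc (r • f) g = r • prodFreq hγ hc f g := by
  refine Lp.ext ?_
  filter_upwards [coeFn_prodFreq hγ hc (r • f) g, coeFn_prodFreq hγ hc f g,
    Lp.coeFn_smul r (prodFreq hγ hc f g), Lp.coeFn_smul r (fromFreq hγ hc f)] with x h1 h2 h3 h4
  rw [h1, h3, Pi.smul_apply, h2, map_smul, h4, Pi.smul_apply, smul_eq_mul, smul_eq_mul, mul_assoc]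

/-- The trilinear form `∫ u v w` of the functions `u = fromFreq f`, `v = fromFreq g` and
`w = fromFreq h`. -/
def tri (f g h : L2C) : ℝ := inner ℝ (prodFreq hγ hc f g) (fromFreq hγ hc h)

theorem tri_eq (f g h : L2C) : tri hγ hc f g h =
    ∫ x, fromFreq hγ hc f x * fromFreq hγ hc g x * fromFreq hγ hc h x := by
  rw [tri, L2.inner_def]
  refine integral_congr_ae ?_
  filter_upwards [coeFn_prodFreq hγ hc f g] with x h1
  rw [h1, RCLike.inner_apply, conj_trivial, mul_comm]

theorem tri_swap_left (f g h : L2C) : tri hγ hc f g h = tri hγ hc g f h := by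
  rw [tri, prodFreq_comm, tri]

theorem tri_swap_right (f g h : L2C) : tri hγ hc f g h = tri hγ hc f h g := by
  rw [tri_eq, tri_eq]
  exact integral_congr_ae (ae_of_all _ fun x => mul_right_comm _ _ _)

theorem abs_tri_le (f g h : L2C) :
    |tri hγ hc f g h| ≤ embConst c ^ 2 * ‖f‖ * ‖g‖ * ‖fromFreq hγ hc h‖ :=
  (abs_real_inner_le_norm _ _).trans
    (mul_le_mul_of_nonneg_right (norm_prodFreq_le hγ hc f g) (norm_nonneg _))

theorem tri_bound (f g h : L2C) :
    |tri hγ hc f g h| ≤ embConst c ^ 2 * (Real.sqrt c)⁻¹ * ‖f‖ * ‖g‖ * ‖h‖ := by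
  refine (abs_tri_le hγ hc f g h).trans ?_
  calc embConst c ^ 2 * ‖f‖ * ‖g‖ * ‖fromFreq hγ hc h‖
      ≤ embConst c ^ 2 * ‖f‖ * ‖g‖ * ((Real.sqrt c)⁻¹ * ‖h‖) := by
        gcongr; exact norm_fromFreq_le hγ hc h
    _ = _ := by ring

theorem tri_modL (y : ℝ) (f g h : L2C) :
    tri hγ hc (modL y f) (modL y g) (modL y h) = tri hγ hc f g h := by
  rw [tri_eq, tri_eq, ← integral_add_right_eq_self (fun x => fromFreq hγ hc f x *
    fromFreq hγ hc g x * fromFreq hγ hc h x) y]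
  refine integral_congr_ae ?_
  filter_upwards [fromFreq_modL hγ hc y f, fromFreq_modL hγ hc y g, fromFreq_modL hγ hc y h]
    with x h1 h2 h3
  rw [h1, h2, h3]

theorem tri_reflL (f g h : L2C) :
    tri hγ hc (reflL f) (reflL g) (reflL h) = tri hγ hc f g h := by
  rw [tri_eq, tri_eq, ← integral_neg_eq_self]
  refine integral_congr_ae ?_
  filter_upwards [ae_comp_neg (fromFreq_reflL hγ hc f), ae_comp_neg (fromFreq_reflL hγ hc g),
    ae_comp_neg (fromFreq_reflL hγ hc h)] with x h1 h2 h3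
  rw [h1, h2, h3, neg_neg]

/-! ### Compactness of low frequencies -/

theorem norm_fromFreq_sub_lowL_le {N : ℝ} (hN : 0 < N) (g : L2C) :
    ‖fromFreq hγ hc (g - lowL N g)‖ ≤ (Real.sqrt N)⁻¹ * ‖g‖ := by
  have h0 : ‖rootL hγ hc (g - lowL N g)‖ ≤ (Real.sqrt N)⁻¹ * ‖g‖ := by
    refine Lp.norm_le_mul_norm_of_ae_le_mul ?_
    filter_upwards [coeFn_mulL _ (memLp_symbRoot hγ hc) (g - lowL N g), coeFn_sub_lowL N g]
      with ξ h1 h2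
    rw [h1, h2, norm_mul]
    split_ifs with h
    · rw [norm_zero, mul_zero]; positivity
    · refine mul_le_mul_of_nonneg_right ?_ (norm_nonneg _)
      have := Real.sqrt_pos.2 hN
      rw [norm_symbRoot]
      gcongr
      exact (not_le.1 h).le.trans (abs_le_weight hγ hc ξ)
  rw [fromFreq_apply]
  exact (norm_reL_le _).trans ((norm_fourierInv _).trans_le h0)

/-- The vector `weight^{-1/2} 1_{|ξ| ≤ N}`. The inner product with it is the value at `0` of the low
frequency part of `fromFreq g`. -/
def lowVec (N : ℝ) : L2C := rootL hγ hc ((memLp_low N).toLp (symbLow N))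

theorem symbLow_neg (N ξ : ℝ) : symbLow N (-ξ) = symbLow N ξ := by
  simp [symbLow]

theorem conj_symbLow (N ξ : ℝ) : starRingEnd ℂ (symbLow N ξ) = symbLow N ξ := by
  unfold symbLow; split_ifs <;> simp

theorem toLp_symbLow_mem_herm (N : ℝ) : (memLp_low N).toLp (symbLow N) ∈ herm := by
  rw [mem_herm_iff_ae]
  filter_upwards [(memLp_low N).coeFn_toLp, ae_comp_neg (memLp_low N).coeFn_toLp] with ξ h1 h2
  rw [h1, h2, symbLow_neg, conj_symbLow]

theorem reflL_toLp_symbLow (N : ℝ) :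
    reflL ((memLp_low N).toLp (symbLow N)) = (memLp_low N).toLp (symbLow N) := by
  refine Lp.ext ?_
  filter_upwards [(memLp_low N).coeFn_toLp, ae_comp_neg (memLp_low N).coeFn_toLp,
    coeFn_reflL ((memLp_low N).toLp (symbLow N))] with ξ h1 h2 h3
  rw [h3, h1, h2, symbLow_neg]

theorem lowVec_mem_herm (N : ℝ) : lowVec hγ hc N ∈ herm :=
  rootL_mem_herm hγ hc (toLp_symbLow_mem_herm N)

/-- The low frequency part of `fromFreq g` at `x` is the inner product of `lowVec` with the
translate of `g` by `x`. -/
theorem fromFreq_lowL (N : ℝ) (g : L2C) :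
    fromFreq hγ hc (lowL N g) =ᵐ[volume] fun x => inner ℝ (modL x g) (lowVec hγ hc N) := by
  rw [fromFreq_apply, mulL_comm]
  filter_upwards [coeFn_reL (𝓕⁻ (lowL N (rootL hγ hc g))),
    fourierInv_ae_eq (integrable_lowL N (rootL hγ hc g))] with x h1 h2
  rw [h1, h2, inner_modL, fourier_eq_symbTrans]
  congr 1
  refine integral_congr_ae ?_
  filter_upwards [coeFn_mulL _ (memLp_symbLow N) (rootL hγ hc g),
    coeFn_mulL _ (memLp_symbRoot hγ hc) g, (memLp_low N).coeFn_toLp,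
    coeFn_mulL _ (memLp_symbRoot hγ hc) ((memLp_low N).toLp (symbLow N))] with ξ h3 h4 h5 h6
  rw [h3, h4, lowVec, h6, h5, map_mul, conj_symbRoot, conj_symbLow, symbTrans]
  ring

theorem norm_modL (y : ℝ) (f : L2C) : ‖modL y f‖ = ‖f‖ := by
  have h := inner_modL_modL y f f
  rw [real_inner_self_eq_norm_sq, real_inner_self_eq_norm_sq] at h
  exact (pow_left_inj₀ (norm_nonneg _) (norm_nonneg _) two_ne_zero).1 h

theorem tri_sub_right (f g h h' : L2C) :
    tri hγ hc f g (h - h') = tri hγ hc f g h - tri hγ hc f g h' := by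
  rw [tri, map_sub, inner_sub_right, tri, tri]

theorem tendsto_zero_of_forall_approx {x : ℕ → ℝ}
    (h : ∀ ε > 0, ∃ v : ℕ → ℝ, Tendsto v atTop (𝓝 0) ∧ ∀ n, |x n| ≤ v n + ε) :
    Tendsto x atTop (𝓝 0) := by
  rw [Metric.tendsto_atTop]
  intro ε hε
  obtain ⟨v, hv, hx⟩ := h (ε / 2) (by positivity)
  obtain ⟨n₀, hn₀⟩ := (hv.eventually_lt_const (show 0 < ε / 2 by positivity)).exists_forall_of_atTop
  refine ⟨n₀, fun n hn => ?_⟩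
  rw [Real.dist_0_eq_abs]
  linarith [hx n, hn₀ n hn]

theorem exists_inv_sqrt_mul_le (C : ℝ) {ε : ℝ} (hε : 0 < ε) :
    ∃ N : ℝ, 0 < N ∧ C * (Real.sqrt N)⁻¹ ≤ ε := by
  refine ⟨((|C| + 1) / ε) ^ 2, by positivity, ?_⟩
  rw [Real.sqrt_sq (by positivity), inv_div, mul_div_assoc', div_le_iff₀ (by positivity)]
  nlinarith [le_abs_self C]

/-- Multiplication by a fixed function turns weak convergence of the low frequencies into strong
convergence in `L²`. -/
theorem tendsto_norm_prodFreq_lowL (N : ℝ) {u : ℕ → herm} {B : ℝ} (hB : ∀ n, ‖u n‖ ≤ B)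
    (hu : WeakTo u 0) (h : L2C) :
    Tendsto (fun n => ‖prodFreq hγ hc (lowL N (u n)) h‖) atTop (𝓝 0) := by
  have hB0 : 0 ≤ B := (norm_nonneg _).trans (hB 0)
  set k := lowVec hγ hc N
  have h1 : ∀ n, ‖prodFreq hγ hc (lowL N (u n)) h‖ ^ 2 =
      ∫ x, (inner ℝ (modL x (u n : L2C)) k) ^ 2 * (fromFreq hγ hc h x) ^ 2 := fun n => by
    rw [← real_inner_self_eq_norm_sq, L2.inner_def]
    refine integral_congr_ae ?_
    filter_upwards [coeFn_prodFreq hγ hc (lowL N (u n)) h, fromFreq_lowL hγ hc N (u n)]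
      with x h2 h3
    rw [h2, h3, real_inner_self_eq_norm_sq, norm_mul, mul_pow, Real.norm_eq_abs, Real.norm_eq_abs,
      sq_abs, sq_abs]
  have h2 : Tendsto (fun n => ∫ x, (inner ℝ (modL x (u n : L2C)) k) ^ 2 *
      (fromFreq hγ hc h x) ^ 2) atTop (𝓝 (∫ _ : ℝ, (0 : ℝ))) := by
    refine tendsto_integral_of_dominated_convergence
      (fun x => (B * ‖k‖) ^ 2 * (fromFreq hγ hc h x) ^ 2) (fun n => ?_) ?_ (fun n => ?_) ?_
    · have hcont : Continuous fun x => inner ℝ (modL x (u n : L2C)) k :=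
        (continuous_modL _).inner continuous_const
      exact (hcont.pow 2).aestronglyMeasurable.mul ((Lp.aestronglyMeasurable _).pow 2)
    · exact (Lp.memLp (fromFreq hγ hc h)).integrable_sq.const_mul _
    · refine ae_of_all _ fun x => ?_
      rw [Real.norm_of_nonneg (by positivity)]
      refine mul_le_mul_of_nonneg_right (sq_le_sq' ?_ ?_) (sq_nonneg _) <;>
      · have h3 := abs_real_inner_le_norm (modL x (u n : L2C)) k
        rw [norm_modL] at h3
        have h4 : ‖(u n : L2C)‖ * ‖k‖ ≤ B * ‖k‖ := by gcongr; exact hB n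
        linarith [(abs_le.1 h3).1, (abs_le.1 h3).2]
    · refine ae_of_all _ fun x => ?_
      have h3 := hu ⟨modL (-x) k, mulL_mem_herm _ (fun ξ => by
        rw [symbTrans_neg, conj_symbTrans]) (lowVec_mem_herm hγ hc N)⟩
      rw [inner_zero_left] at h3
      have h4 := (h3.pow 2).mul_const ((fromFreq hγ hc h x) ^ 2)
      simp only [ne_eq, OfNat.ofNat_ne_zero, not_false_eq_true, zero_pow, zero_mul] at h4
      refine h4.congr fun n => ?_
      rw [inner_modL_left]
      rfl
  simp only [integral_zero, ← h1] at h2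
  have h5 := h2.sqrt
  rw [Real.sqrt_zero] at h5
  exact h5.congr fun n => Real.sqrt_sq (norm_nonneg _)

/-- Local compactness: `∫ uₙ² v → 0` if `uₙ ⇀ 0`. -/
theorem tri_tendsto_zero {u : ℕ → herm} {B : ℝ} (h : L2C) (hB : ∀ n, ‖u n‖ ≤ B)
    (hu : WeakTo u 0) :
    Tendsto (fun n => tri hγ hc (u n) (u n) h) atTop (𝓝 0) := by
  have hB0 : 0 ≤ B := (norm_nonneg _).trans (hB 0)
  refine tendsto_zero_of_forall_approx fun ε hε => ?_
  obtain ⟨N, hN, hNε⟩ := exists_inv_sqrt_mul_le (embConst c ^ 2 * B * ‖h‖ * B) hε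
  refine ⟨fun n => ‖prodFreq hγ hc (lowL N (u n)) h‖ * ((Real.sqrt c)⁻¹ * B), ?_, fun n => ?_⟩
  · simpa using (tendsto_norm_prodFreq_lowL hγ hc N hB hu h).mul_const ((Real.sqrt c)⁻¹ * B)
  have e : tri hγ hc (u n) (u n) h = tri hγ hc (lowL N (u n)) h (u n) +
      tri hγ hc (u n) h ((u n : L2C) - lowL N (u n)) := by
    rw [tri_sub_right, tri_swap_right _ _ (u n : L2C) (u n) h,
      tri_swap_right _ _ (u n : L2C) h (lowL N _), tri_swap_left _ _ (u n : L2C) (lowL N _),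
      tri_swap_right _ _ (lowL N _) (u n : L2C)]
    ring
  rw [e]
  refine (abs_add_le _ _).trans (add_le_add ?_ ?_)
  · refine (abs_real_inner_le_norm _ _).trans ?_
    beta_reduce
    gcongr
    refine (norm_fromFreq_le hγ hc _).trans ?_
    gcongr
    exact hB n
  · refine (abs_tri_le hγ hc _ _ _).trans (le_trans ?_ hNε)
    calc embConst c ^ 2 * ‖(u n : L2C)‖ * ‖h‖ * ‖fromFreq hγ hc ((u n : L2C) - lowL N (u n))‖
        ≤ embConst c ^ 2 * B * ‖h‖ * ((Real.sqrt N)⁻¹ * B) := by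
          gcongr
          · exact hB n
          · refine (norm_fromFreq_sub_lowL_le hγ hc hN _).trans ?_
            gcongr
            exact hB n
      _ = _ := by ring

/-- The translation by `y` on the Fourier side. -/
def modHerm (y : ℝ) : herm →ₗ[ℝ] herm :=
  ((modL y).restrictScalars ℝ : L2C →ₗ[ℝ] L2C).restrict fun _ hg =>
    mulL_mem_herm (memLp_symbTrans y) (fun ξ => by rw [symbTrans_neg, conj_symbTrans]) hg

/-- The reflection `x ↦ -x` on the Fourier side. -/
def reflHerm : herm →ₗ[ℝ] herm :=
  (reflL.toLinearMap.restrictScalars ℝ).restrict fun _ hg => reflL_mem_herm hg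

theorem coe_reflHerm (g : herm) : (reflHerm g : L2C) = reflL g := rfl

/-- A bounded sequence that tends weakly to zero along all sequences of translations has small
low frequencies in the uniform norm, and its cubic integral tends to zero. -/
theorem tri_vanishing {u : ℕ → herm} {B : ℝ} (hB : ∀ n, ‖u n‖ ≤ B)
    (hu : ∀ y : ℕ → ℝ, WeakTo (fun n => modHerm (y n) (u n)) 0) :
    Tendsto (fun n => tri hγ hc (u n) (u n) (u n)) atTop (𝓝 0) := by
  have hB0 : 0 ≤ B := (norm_nonneg _).trans (hB 0)
  refine tendsto_zero_of_forall_approx fun ε hε => ?_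
  obtain ⟨N, hN, hNε⟩ := exists_inv_sqrt_mul_le (embConst c ^ 2 * B * B * B) hε
  set k := lowVec hγ hc N
  set s : ℕ → ℝ → ℝ := fun n x => |inner ℝ (modL x (u n : L2C)) k|
  have hbdd : ∀ n, BddAbove (Set.range (s n)) := fun n => by
    refine ⟨‖u n‖ * ‖k‖, ?_⟩
    rintro - ⟨x, rfl⟩
    have := abs_real_inner_le_norm (modL x (u n : L2C)) k
    rwa [norm_modL] at this
  have hex : ∀ n : ℕ, ∃ y, (⨆ x, s n x) - 1 / ((n : ℝ) + 1) < s n y := fun n =>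
    exists_lt_of_lt_ciSup (sub_lt_self _ (by positivity))
  choose y hy using hex
  have hsy : Tendsto (fun n : ℕ => s n (y n) + 1 / ((n : ℝ) + 1)) atTop (𝓝 0) := by
    have h1 := hu y ⟨k, lowVec_mem_herm hγ hc N⟩
    rw [inner_zero_left] at h1
    have h2 := h1.abs
    rw [abs_zero] at h2
    have h3 := h2.add (tendsto_one_div_add_atTop_nhds_zero_nat (𝕜 := ℝ))
    rw [add_zero] at h3
    exact h3
  have hle : ∀ n x, s n x ≤ s n (y n) + 1 / ((n : ℝ) + 1) := fun n x => by
    linarith [le_ciSup (hbdd n) x, hy n]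
  refine ⟨fun n => (s n (y n) + 1 / ((n : ℝ) + 1)) * ((Real.sqrt c)⁻¹ * B) *
    ((Real.sqrt c)⁻¹ * B), ?_, fun n => ?_⟩
  · simpa using (hsy.mul_const ((Real.sqrt c)⁻¹ * B)).mul_const ((Real.sqrt c)⁻¹ * B)
  have e : tri hγ hc (u n) (u n) (u n) = tri hγ hc (lowL N (u n)) (u n) (u n) +
      tri hγ hc (u n) (u n) ((u n : L2C) - lowL N (u n)) := by
    rw [tri_sub_right, tri_swap_right _ _ (u n : L2C) (u n) (lowL N _),
      tri_swap_left _ _ (u n : L2C) (lowL N _)]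
    ring
  have hR : ‖fromFreq hγ hc (u n)‖ ≤ (Real.sqrt c)⁻¹ * B := by
    refine (norm_fromFreq_le hγ hc _).trans ?_
    gcongr
    exact hB n
  rw [e]
  refine (abs_add_le _ _).trans (add_le_add ?_ ?_)
  · refine (abs_real_inner_le_norm _ _).trans ?_
    have h0 : 0 ≤ s n (y n) + 1 / ((n : ℝ) + 1) := (abs_nonneg _).trans (hle n 0)
    beta_reduce
    gcongr
    refine (Lp.norm_le_mul_norm_of_ae_le_mul (g := fromFreq hγ hc (u n))
      (c := s n (y n) + 1 / ((n : ℝ) + 1)) ?_).trans ?_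
    · filter_upwards [coeFn_prodFreq hγ hc (lowL N (u n)) (u n), fromFreq_lowL hγ hc N (u n)]
        with x h2 h3
      rw [h2, h3, norm_mul]
      exact mul_le_mul_of_nonneg_right (hle n x) (norm_nonneg _)
    · gcongr
  · refine (abs_tri_le hγ hc _ _ _).trans (le_trans ?_ hNε)
    calc embConst c ^ 2 * ‖(u n : L2C)‖ * ‖(u n : L2C)‖ *
          ‖fromFreq hγ hc ((u n : L2C) - lowL N (u n))‖
        ≤ embConst c ^ 2 * B * B * ((Real.sqrt N)⁻¹ * B) := by
          gcongr
          · exact hB n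
          · exact hB n
          · refine (norm_fromFreq_sub_lowL_le hγ hc hN _).trans ?_
            gcongr
            exact hB n
      _ = _ := by ring

/-! ### Critical points of the cubic form -/

/-- The vector `weight^{-1/2} 𝓕(u²)`, `u = fromFreq g`, which represents the functional
`h ↦ ∫ u² (fromFreq h)`; up to the factor `3` it is the gradient of `∫ u³`. -/
def gradFreq (g : L2C) : L2C := rootL hγ hc (𝓕 (toC (prodFreq hγ hc g g)))

theorem tri_eq_inner_gradFreq (g h : L2C) :
    tri hγ hc g g h = inner ℝ (gradFreq hγ hc g) h :=
  inner_fromFreq hγ hc _ h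

theorem gradFreq_mem_herm (g : L2C) : gradFreq hγ hc g ∈ herm :=
  rootL_mem_herm hγ hc (fourier_mem_herm (conjL_toC _))

theorem integrable_fromFreq_sq (g : L2C) :
    Integrable (fun x => ((fromFreq hγ hc g x ^ 2 : ℝ) : ℂ)) :=
  (Lp.memLp (fromFreq hγ hc g)).integrable_sq.ofReal

theorem gradFreq_ae_eq (g : L2C) : gradFreq hγ hc g =ᵐ[volume] fun ξ =>
    symbRoot γ c ξ * 𝓕 (fun x => ((fromFreq hγ hc g x ^ 2 : ℝ) : ℂ)) ξ := by
  have h0 : (fun x => ((fromFreq hγ hc g x ^ 2 : ℝ) : ℂ)) =ᵐ[volume] toC (prodFreq hγ hc g g) := by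
    filter_upwards [coeFn_toC (prodFreq hγ hc g g), coeFn_prodFreq hγ hc g g] with x h1 h2
    rw [h1, h2, sq]
  have h2 : MemLp (fun x => ((fromFreq hγ hc g x ^ 2 : ℝ) : ℂ)) 2 volume :=
    (memLp_congr_ae h0).2 (Lp.memLp _)
  have h3 : h2.toLp _ = toC (prodFreq hγ hc g g) := by
    refine Lp.ext ?_
    filter_upwards [h2.coeFn_toLp, h0] with x h4 h5
    rw [h4, h5]
  have h4 := fourier_toLp_ae_eq h2 (integrable_fromFreq_sq hγ hc g)
  rw [h3] at h4
  filter_upwards [h4, coeFn_mulL _ (memLp_symbRoot hγ hc) (𝓕 (toC (prodFreq hγ hc g g)))]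
    with ξ h5 h6
  rw [gradFreq, h6, h5]

theorem gradFreq_eq_of_forall {g : herm} {μ : ℝ}
    (h : ∀ k : herm, tri hγ hc g g k = μ * inner ℝ g k) : gradFreq hγ hc g = μ • (g : L2C) := by
  have h1 : (⟨gradFreq hγ hc g, gradFreq_mem_herm hγ hc g⟩ : herm) = μ • g := by
    refine ext_inner_right ℝ fun k => ?_
    exact ((tri_eq_inner_gradFreq hγ hc g k).symm.trans (h k)).trans
      (real_inner_smul_left g k μ).symm
  exact congrArg Subtype.val h1

/-- If `𝓕(u²)` vanishes, then so does `u`. -/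
theorem eq_zero_of_gradFreq_eq_zero {g : herm} (h : gradFreq hγ hc g = 0) : g = 0 := by
  have h1 := rootL_injective hγ hc h
  have h2 : toC (prodFreq hγ hc g g) = 0 := by
    rw [← norm_eq_zero, ← Lp.norm_fourier_eq, h1, norm_zero]
  have h3 : fromFreq hγ hc g = 0 := by
    refine Lp.ext ?_
    have h4 := coeFn_toC (prodFreq hγ hc g g)
    rw [h2] at h4
    filter_upwards [h4, Lp.coeFn_zero ℂ 2 (volume : Measure ℝ), coeFn_prodFreq hγ hc g g,
      Lp.coeFn_zero ℝ 2 (volume : Measure ℝ)] with x h5 h6 h7 h8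
    rw [h6, h7, Pi.zero_apply] at h5
    rw [h8]
    have h9 : fromFreq hγ hc g x * fromFreq hγ hc g x = 0 := by
      have := h5.symm
      exact_mod_cast this
    exact mul_self_eq_zero.1 h9
  have h4 := fourier_toC_fromFreq hγ hc g.2
  rw [h3] at h4
  have h5 : toC 0 = 0 := by rw [← norm_eq_zero, norm_toC, norm_zero]
  rw [h5] at h4
  have h6 : (𝓕 (0 : L2C) : L2C) = 0 := by rw [← norm_eq_zero, Lp.norm_fourier_eq, norm_zero]
  rw [h6] at h4
  exact Subtype.ext (rootL_injective hγ hc h4.symm)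

/-- The form does not vanish on even vectors: test `T(g, g, ·)` against the symmetrization of its
representing vector. -/
theorem tri_nondeg : ∃ g h : herm, reflHerm g = g ∧ reflHerm h = h ∧ tri hγ hc g g h ≠ 0 := by
  set g : herm := ⟨(memLp_low 1).toLp (symbLow 1), toLp_symbLow_mem_herm 1⟩ with hg
  set k : herm := ⟨gradFreq hγ hc g, gradFreq_mem_herm hγ hc g⟩ with hk
  have hgr : reflL (g : L2C) = g := reflL_toLp_symbLow 1
  have hg0 : g ≠ 0 := by
    intro h
    have h1 := norm_sq_symbLow (N := 1) zero_le_one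
    have h2 : (memLp_low 1).toLp (symbLow 1) = 0 := congrArg Subtype.val h
    rw [h2, norm_zero] at h1
    norm_num at h1
  refine ⟨g, k + reflHerm k, Subtype.ext hgr, ?_, ?_⟩
  · have : reflHerm (reflHerm k) = k := Subtype.ext (reflL_reflL _)
    rw [map_add, this, add_comm]
  have h1 : tri hγ hc g g k = ‖(k : L2C)‖ ^ 2 := by
    rw [tri_eq_inner_gradFreq, ← real_inner_self_eq_norm_sq]
  have h2 : tri hγ hc g g (reflHerm k) = ‖(k : L2C)‖ ^ 2 := by
    rw [← h1, ← tri_reflL hγ hc g g k, hgr, coe_reflHerm]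
  have h3 : tri hγ hc g g ((k + reflHerm k : herm) : L2C) =
      tri hγ hc g g k + tri hγ hc g g (reflHerm k) := by
    rw [Submodule.coe_add, tri, map_add, inner_add_right, tri, tri]
  rw [h3, h1, h2]
  intro h4
  have h5 : ‖(k : L2C)‖ = 0 := by nlinarith [norm_nonneg (k : L2C)]
  exact hg0 (eq_zero_of_gradFreq_eq_zero hγ hc (norm_eq_zero.1 h5))

/-! ### Attraction between a critical point and its reflection -/

instance : TopologicalSpace.SeparableSpace herm := by
  have : Fact ((2 : ENNReal) ≠ ⊤) := ⟨by norm_num⟩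
  have h : SecondCountableTopology L2C := Lp.SecondCountableTopology
  have : SecondCountableTopology herm :=
    TopologicalSpace.Subtype.secondCountableTopology (herm : Set L2C)
  infer_instance

/-- The Gaussian `x ↦ exp (-π b x²)`. -/
def gauss (b x : ℝ) : ℝ := Real.exp (-Real.pi * b * x ^ 2)

theorem integrable_gauss {b : ℝ} (hb : 0 < b) : Integrable (gauss b) := by
  have := integrable_exp_neg_mul_sq (b := Real.pi * b) (by positivity)
  refine this.congr (ae_of_all _ fun x => ?_)
  simp only [gauss]; ring_nf

theorem fourier_gauss {b : ℝ} (hb : 0 < b) (ξ : ℝ) :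
    𝓕 (fun x => (gauss b x : ℂ)) ξ = ((Real.sqrt b)⁻¹ * gauss b⁻¹ ξ : ℝ) := by
  have h := congrFun (fourier_gaussian_pi (b := (b : ℂ)) (by simpa using hb)) ξ
  have e : (fun x : ℝ => (gauss b x : ℂ)) =
      fun x : ℝ => Complex.exp (-Real.pi * b * (x : ℂ) ^ 2) := by
    ext x; rw [gauss]; push_cast; rfl
  rw [e, h]
  have h2 : ((b : ℂ) ^ (1 / 2 : ℂ)) = ((Real.sqrt b : ℝ) : ℂ) := by
    rw [Real.sqrt_eq_rpow, Complex.ofReal_cpow hb.le]; norm_num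
  rw [h2, gauss]
  push_cast
  rw [one_div]
  congr 2

/-- If `G ∈ L¹` vanishes to second order at `0`, its Fourier transform tested against wide
Gaussians tends to zero. -/
theorem norm_integral_fourier_mul_gauss_le {G : ℝ → ℂ} (hG : Integrable G) {C : ℝ}
    (hC : ∀ᵐ ξ, ‖G ξ‖ ≤ C * ξ ^ 2) {b : ℝ} (hb : 0 < b) (hb1 : b ≤ 1) :
    ‖∫ y, 𝓕 G y * gauss b y‖ ≤ Real.sqrt b * (C * ∫ ξ, gauss (1 / 2) ξ) := by
  have hC0 : 0 ≤ C := by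
    obtain ⟨ξ, hξ, hξ0⟩ := (hC.and (Measure.ae_ne volume (0 : ℝ))).exists
    have := (norm_nonneg _).trans hξ
    exact nonneg_of_mul_nonneg_left this (by positivity)
  have hi : Integrable (fun y => (gauss b y : ℂ)) := (integrable_gauss hb).ofReal
  rw [integral_fourier_mul_eq hG hi, ← integral_const_mul,
    ← integral_const_mul]
  refine norm_integral_le_of_norm_le
    (((integrable_gauss (by norm_num)).const_mul C).const_mul (Real.sqrt b)) ?_
  filter_upwards [hC] with ξ hξ
  rw [fourier_gauss hb, norm_mul, Complex.norm_real, norm_mul, Real.norm_of_nonneg (by positivity),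
    Real.norm_of_nonneg (show 0 ≤ gauss b⁻¹ ξ from (Real.exp_pos _).le)]
  have h1 : ξ ^ 2 * gauss b⁻¹ ξ ≤ b * gauss (1 / 2) ξ := by
    have h2 : ξ ^ 2 * Real.exp (-(ξ ^ 2 / b)) ≤ b := by
      rw [Real.exp_neg, ← div_eq_mul_inv, div_le_iff₀ (Real.exp_pos _), ← div_le_iff₀' hb]
      linarith [Real.add_one_le_exp (ξ ^ 2 / b)]
    have h3 : gauss b⁻¹ ξ ≤ Real.exp (-(ξ ^ 2 / b)) * gauss (1 / 2) ξ := by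
      rw [gauss, gauss, ← Real.exp_add]
      refine Real.exp_le_exp.2 ?_
      have h4 : ξ ^ 2 ≤ ξ ^ 2 / b := by
        rw [le_div_iff₀ hb]; nlinarith [sq_nonneg ξ]
      have h5 : -Real.pi * b⁻¹ * ξ ^ 2 = -Real.pi * (ξ ^ 2 / b) := by ring
      rw [h5]
      nlinarith [Real.pi_gt_three]
    calc ξ ^ 2 * gauss b⁻¹ ξ ≤ ξ ^ 2 * (Real.exp (-(ξ ^ 2 / b)) * gauss (1 / 2) ξ) := by gcongr
      _ = ξ ^ 2 * Real.exp (-(ξ ^ 2 / b)) * gauss (1 / 2) ξ := by ring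
      _ ≤ _ := mul_le_mul_of_nonneg_right h2 (Real.exp_pos _).le
  have hs : 0 < Real.sqrt b := Real.sqrt_pos.2 hb
  have hg0 : 0 ≤ gauss b⁻¹ ξ := (Real.exp_pos _).le
  calc ‖G ξ‖ * ((Real.sqrt b)⁻¹ * gauss b⁻¹ ξ)
      ≤ (C * ξ ^ 2) * ((Real.sqrt b)⁻¹ * gauss b⁻¹ ξ) := by gcongr
    _ = C * (Real.sqrt b)⁻¹ * (ξ ^ 2 * gauss b⁻¹ ξ) := by ring
    _ ≤ C * (Real.sqrt b)⁻¹ * (b * gauss (1 / 2) ξ) := by gcongr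
    _ = ((Real.sqrt b)⁻¹ * b) * (C * gauss (1 / 2) ξ) := by ring
    _ = Real.sqrt b * (C * gauss (1 / 2) ξ) := by
      rw [inv_mul_eq_div, Real.div_sqrt]

/-- An integrable function that vanishes to second order at `0` and whose Fourier transform is
nonpositive is zero: its Fourier transform has mean zero. -/
theorem ae_eq_zero_of_fourier_nonpos {G : ℝ → ℂ} (hG : Integrable G) {C : ℝ}
    (hC : ∀ᵐ ξ, ‖G ξ‖ ≤ C * ξ ^ 2) {σ : ℝ → ℝ} (hσ : ∀ y, 𝓕 G y = σ y) (hneg : ∀ y, σ y ≤ 0) :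
    G =ᵐ[volume] 0 := by
  have hcσ : Continuous σ := by
    have : σ = fun y => (𝓕 G y).re := by ext y; rw [hσ, Complex.ofReal_re]
    rw [this]
    exact Complex.continuous_re.comp (continuous_fourier hG)
  have hbd : ∀ y, ‖σ y‖ ≤ ∫ x, ‖G x‖ := fun y => by
    rw [← Complex.norm_real, ← hσ]; exact norm_fourier_le_integral_norm G y
  have hint : ∀ b : ℝ, 0 < b → Integrable (fun y => -σ y * gauss b y) := fun b hb =>
    (integrable_gauss hb).bdd_mul hcσ.neg.aestronglyMeasurable
      (ae_of_all _ fun y => by rw [norm_neg]; exact hbd y)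
  have hle : ∀ b : ℝ, 0 < b → b ≤ 1 →
      ∫ y, -σ y * gauss 1 y ≤ Real.sqrt b * (C * ∫ ξ, gauss (1 / 2) ξ) := fun b hb hb1 => by
    refine le_trans ?_ (norm_integral_fourier_mul_gauss_le hG hC hb hb1)
    have h1 : ∫ y, 𝓕 G y * gauss b y = ((∫ y, σ y * gauss b y : ℝ) : ℂ) := by
      rw [← integral_complex_ofReal]
      refine integral_congr_ae (ae_of_all _ fun y => ?_)
      simp only [hσ]; push_cast; rfl
    rw [h1, Complex.norm_real]
    refine le_trans ?_ (neg_le_abs _)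
    rw [← integral_neg]
    refine integral_mono (hint 1 one_pos) ?_ fun y => ?_
    · simpa only [neg_mul] using hint b hb
    · have h2 : gauss 1 y ≤ gauss b y := by
        refine Real.exp_le_exp.2 ?_
        have h3 : b * y ^ 2 ≤ 1 * y ^ 2 := by gcongr
        have h4 := mul_le_mul_of_nonneg_left h3 Real.pi_pos.le
        linarith
      simp only
      nlinarith [hneg y]
  have h0 : ∫ y, -σ y * gauss 1 y ≤ 0 := by
    have ht : Tendsto (fun b => Real.sqrt b * (C * ∫ ξ, gauss (1 / 2) ξ)) (𝓝[>] 0) (𝓝 0) := by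
      have : Continuous fun b => Real.sqrt b * (C * ∫ ξ, gauss (1 / 2) ξ) := by fun_prop
      have h1 := this.tendsto 0
      simp only [Real.sqrt_zero, zero_mul] at h1
      exact h1.mono_left nhdsWithin_le_nhds
    refine ge_of_tendsto ht ?_
    filter_upwards [Ioc_mem_nhdsGT (zero_lt_one' ℝ)] with b hb
    exact hle b hb.1 hb.2
  have hnn : ∀ y, 0 ≤ -σ y * gauss 1 y := fun y =>
    mul_nonneg (neg_nonneg.2 (hneg y)) (Real.exp_pos _).le
  have h1 : ∫ y, -σ y * gauss 1 y = 0 := le_antisymm h0 (integral_nonneg hnn)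
  have h2 := (integral_eq_zero_iff_of_nonneg hnn (hint 1 one_pos)).1 h1
  have h3 : (fun y => -σ y * gauss 1 y) = 0 := by
    refine (Continuous.ae_eq_iff_eq volume ?_ continuous_const).1 h2
    have : Continuous (gauss 1) := by unfold gauss; fun_prop
    exact hcσ.neg.mul this
  refine ae_eq_zero_of_fourier_eq_zero hG ?_
  ext y
  have h4 : -σ y * gauss 1 y = 0 := congrFun h3 y
  have h5 : σ y = 0 := neg_eq_zero.1 ((mul_eq_zero.1 h4).resolve_right (Real.exp_pos _).ne')
  rw [hσ, h5]; simp

/-- A nonzero critical point has a positive inner product with some translate of its reflection.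
These inner products are the values of the Fourier transform of `g(-ξ)²`, and the Euler–Lagrange
equation makes `g²` vanish to second order at `ξ = 0`, because of the term `γ / (2πξ)²` of the
weight. Hence they have mean zero, and if none were positive, `g` would vanish. -/
theorem exists_inner_modHerm_pos {g : herm} {μ : ℝ} (hg : g ≠ 0) (hμ : μ ≠ 0)
    (h : ∀ k : herm, tri hγ hc g g k = μ * inner ℝ g k) :
    ∃ y, 0 < inner ℝ g (modHerm y (reflHerm g)) := by
  by_contra! hneg
  have hgrad := gradFreq_eq_of_forall hγ hc h
  set G : ℝ → ℂ := fun ξ => reflL (g : L2C) ξ * starRingEnd ℂ ((g : L2C) ξ) with hGdef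
  have hG : Integrable G := integrable_mul_conj _ _
  have hherm := mem_herm_iff_ae.1 g.2
  have hG2 : ∀ᵐ ξ, G ξ = starRingEnd ℂ ((g : L2C) ξ) ^ 2 := by
    filter_upwards [coeFn_reflL (g : L2C), hherm] with ξ h1 h2
    rw [hGdef]; simp only
    rw [h1, h2, sq]
  -- By the Euler–Lagrange equation, `g` is `weight^{-1/2}` times a bounded function.
  set D := ∫ x, ‖((fromFreq hγ hc g x ^ 2 : ℝ) : ℂ)‖
  have hgb : ∀ᵐ ξ, ‖G ξ‖ ≤ (|μ|⁻¹ * D) ^ 2 * (2 * Real.pi) ^ 2 / γ * ξ ^ 2 := by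
    have h1 := gradFreq_ae_eq hγ hc g
    rw [hgrad] at h1
    filter_upwards [hG2, h1, Lp.coeFn_smul μ (g : L2C), Measure.ae_ne volume (0 : ℝ)]
      with ξ h2 h3 h4 h0
    rw [h4, Pi.smul_apply] at h3
    have h5 := congrArg norm h3
    rw [norm_smul, norm_mul, Real.norm_eq_abs] at h5
    have h6 : ‖(g : L2C) ξ‖ ≤ |μ|⁻¹ * D * ‖symbRoot γ c ξ‖ := by
      have hμ' : 0 < |μ| := abs_pos.2 hμ
      have h7 : ‖(g : L2C) ξ‖ = |μ|⁻¹ * (|μ| * ‖(g : L2C) ξ‖) := by field_simp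
      rw [h7, h5, mul_assoc, mul_comm D]
      gcongr
      exact norm_fourier_le_integral_norm _ _
    rw [h2, norm_pow, RCLike.norm_conj]
    calc ‖(g : L2C) ξ‖ ^ 2 ≤ (|μ|⁻¹ * D * ‖symbRoot γ c ξ‖) ^ 2 := by gcongr
      _ = (|μ|⁻¹ * D) ^ 2 * (weight γ c ξ)⁻¹ := by rw [mul_pow, norm_symbRoot_sq hγ hc]
      _ ≤ (|μ|⁻¹ * D) ^ 2 * (γ * ((2 * Real.pi * ξ) ^ 2)⁻¹)⁻¹ := by
        gcongr
        unfold weight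
        have := abs_nonneg (2 * Real.pi * ξ)
        linarith
      _ = _ := by field_simp
  have hreal : ∀ y, 𝓕 G y = ((𝓕 G y).re : ℂ) := fun y => by
    refine (Complex.conj_eq_iff_re.1 ?_).symm
    rw [← neg_neg y, fourier_eq_symbTrans, ← integral_conj, ← integral_neg_eq_self]
    refine integral_congr_ae ?_
    filter_upwards [hG2, ae_comp_neg hG2, hherm] with ξ h1 h2 h3
    rw [h1, h2, h3, map_mul, symbTrans_neg, conj_symbTrans, neg_neg]
    simp
  have hs : ∀ y, (𝓕 G y).re ≤ 0 := fun y => by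
    have h1 : inner ℝ (modL (-y) (reflL (g : L2C))) (g : L2C) = (𝓕 G y).re := by
      rw [inner_modL, neg_neg]
    rw [← h1, real_inner_comm]
    exact hneg (-y)
  have hz := ae_eq_zero_of_fourier_nonpos hG hgb hreal hs
  refine hg (Subtype.ext (Lp.ext ?_))
  filter_upwards [hz, hG2, Lp.coeFn_zero ℂ 2 (volume : Measure ℝ)] with ξ h1 h2 h3
  rw [h1, Pi.zero_apply] at h2
  have h4 : starRingEnd ℂ ((g : L2C) ξ) = 0 := pow_eq_zero_iff two_ne_zero |>.1 h2.symm
  rw [(map_eq_zero _).1 h4]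
  exact h3.symm

/-- The cubic form `∫ u³` on the real Hilbert space `herm`, which `fromFreq` identifies with the
real functions of finite energy; translations act as modulations. -/
def energyForm : InvariantCubicForm herm where
  T f g h := tri hγ hc f g h
  add_left f f' g h := by
    rw [Submodule.coe_add, tri, prodFreq_add_left, inner_add_left, tri, tri]
  smul_left r f g h := by
    rw [Submodule.coe_smul, tri, prodFreq_smul_left, real_inner_smul_left, tri]
  swap_left f g h := tri_swap_left hγ hc f g h
  swap_right f g h := tri_swap_right hγ hc f g h
  bnd := embConst c ^ 2 * (Real.sqrt c)⁻¹
  bound f g h := tri_bound hγ hc f g h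
  τ := modHerm
  τ_zero f := Subtype.ext (modL_zero _)
  τ_add y z f := Subtype.ext (modL_add y z _)
  inner_τ y f g := inner_modL_modL y (f : L2C) g
  T_τ y f g h := tri_modL hγ hc y f g h
  τ_cont f := Continuous.subtype_mk (continuous_modL f) _
  τ_mixing f g := tendsto_inner_modL f g
  ρ := reflHerm
  ρ_ρ f := Subtype.ext (reflL_reflL _)
  ρ_τ y f := Subtype.ext (reflL_mulL (memLp_symbTrans y) (memLp_symbTrans (-y)) (symbTrans_neg y) _)
  inner_ρ f g := inner_reflL (f : L2C) g
  T_ρ f g h := tri_reflL hγ hc f g h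
  tendsto_zero _ _ h hB hu := tri_tendsto_zero hγ hc h hB hu
  vanishing _ _ hB hu := tri_vanishing hγ hc hB hu
  nondeg := tri_nondeg hγ hc
  interaction _ _ hg hμ h := exists_inner_modHerm_pos hγ hc hg hμ h

/-! ### Return to the physical side -/

theorem integral_norm_sq_L2C (f : L2C) : ∫ x, ‖f x‖ ^ 2 = ‖f‖ ^ 2 := by
  rw [← real_inner_self_eq_norm_sq, real_inner_L2C]
  simp only [real_inner_self_eq_norm_sq]

/-- Membership in `H^{1/2}`, which is defined by an identity between tempered distributions, means
that `(1 + ξ²)^{1/4} 𝓕 f ∈ L²`. -/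
theorem memSobolev_half_iff (f : L2C) :
    TemperedDistribution.MemSobolev (1 / 2) 2 (f : 𝓢'(ℝ, ℂ)) ↔
      MemLp (fun ξ => (((1 + ‖ξ‖ ^ 2) ^ ((1 / 2 : ℝ) / 2) : ℝ) : ℂ) * (𝓕 f : L2C) ξ) 2 volume := by
  set p : ℝ → ℂ := fun ξ => (((1 + ‖ξ‖ ^ 2) ^ ((1 / 2 : ℝ) / 2) : ℝ) : ℂ) with hp
  set q : ℝ → ℂ := fun ξ => (((1 + ‖ξ‖ ^ 2) ^ (-((1 / 2 : ℝ) / 2)) : ℝ) : ℂ) with hq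
  have hpq : ∀ ξ, p ξ * q ξ = 1 := fun ξ => by
    rw [hp, hq]; simp only
    rw [← Complex.ofReal_mul, ← Real.rpow_add (by positivity), add_neg_cancel, Real.rpow_zero,
      Complex.ofReal_one]
  have hpq' : p * q = fun _ => 1 := funext hpq
  have hqp : q * p = fun _ => 1 := funext fun ξ => (mul_comm _ _).trans (hpq ξ)
  have hpt : p.HasTemperateGrowth := by fun_prop
  have hqt : q.HasTemperateGrowth := by fun_prop
  have hqb : MemLp q ⊤ volume := by
    refine memLp_top_of_bound hqt.1.continuous.aestronglyMeasurable 1 (ae_of_all _ fun ξ => ?_)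
    rw [hq]; simp only
    rw [Complex.norm_real, Real.norm_of_nonneg (by positivity)]
    exact Real.rpow_le_one_of_one_le_of_nonpos (by linarith [sq_nonneg ‖ξ‖]) (by norm_num)
  rw [TemperedDistribution.memSobolev_iff_exists_smulLeftCLM_fourier,
    Lp.fourier_toTemperedDistribution_eq]
  change (∃ f' : L2C, TemperedDistribution.smulLeftCLM ℂ p _ = _) ↔ _
  constructor
  · rintro ⟨f', hf'⟩
    have h1 : (hqb.toLp q • f' : L2C) = 𝓕 f := by
      have hk := LinearMap.ker_eq_bot.1
        (Lp.ker_toTemperedDistributionCLM_eq_bot (E := ℝ) (F := ℂ) (μ := volume) (p := 2))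
      refine hk ?_
      change Lp.toTemperedDistribution _ = Lp.toTemperedDistribution _
      rw [Lp.toTemperedDistribution_smul_eq hqt, ← hf',
        TemperedDistribution.smulLeftCLM_smulLeftCLM_apply hpt hqt]
      rw [hpq', TemperedDistribution.smulLeftCLM_const, one_smul]
    refine (memLp_congr_ae ?_).1 (Lp.memLp f')
    filter_upwards [Lp.coeFn_lpSMul (r := 2) (hqb.toLp q) f', hqb.coeFn_toLp] with ξ h2 h3
    rw [← h1, h2, Pi.smul_apply', h3, smul_eq_mul, ← mul_assoc, hpq, one_mul]
  · intro h
    refine ⟨h.toLp _, ?_⟩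
    have h1 : (hqb.toLp q • h.toLp _ : L2C) = 𝓕 f := by
      refine Lp.ext ?_
      filter_upwards [Lp.coeFn_lpSMul (r := 2) (hqb.toLp q) (h.toLp _), hqb.coeFn_toLp,
        h.coeFn_toLp] with ξ h2 h3 h4
      rw [h2, Pi.smul_apply', h3, h4, smul_eq_mul, ← mul_assoc, mul_comm (q ξ), hpq, one_mul]
    have h2 := congrArg (fun F : L2C =>
      TemperedDistribution.smulLeftCLM ℂ p (F : 𝓢'(ℝ, ℂ))) h1
    refine h2.symm.trans ?_
    rw [Lp.toTemperedDistribution_smul_eq hqt,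
      TemperedDistribution.smulLeftCLM_smulLeftCLM_apply hqt hpt]
    rw [hqp, TemperedDistribution.smulLeftCLM_const, one_smul]

theorem norm_symbHalf_sq (ξ : ℝ) : ‖symbHalf ξ‖ ^ 2 = |2 * Real.pi * ξ| := by
  rw [symbHalf, Complex.norm_real, Real.norm_of_nonneg (Real.sqrt_nonneg _),
    Real.sq_sqrt (abs_nonneg _)]

theorem norm_symbAnti_sq (ξ : ℝ) : ‖symbAnti ξ‖ ^ 2 = ((2 * Real.pi * ξ) ^ 2)⁻¹ := by
  rw [symbAnti, symbDeriv, norm_inv, inv_pow]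
  congr 1
  simp only [norm_mul, Complex.norm_real, Complex.norm_I, Complex.norm_ofNat, Real.norm_eq_abs,
    mul_pow, sq_abs]
  ring

theorem measurable_symbHalf : Measurable symbHalf := by
  unfold symbHalf; fun_prop

theorem measurable_symbAnti : Measurable symbAnti := by
  unfold symbAnti symbDeriv; fun_prop

theorem norm_multiplier_sq {m : ℝ → ℂ} {u : L2R} (h : InDomain m u) :
    ‖multiplier m u‖ ^ 2 = ∫ ξ, ‖m ξ‖ ^ 2 * ‖(𝓕 (toC u) : L2C) ξ‖ ^ 2 := by
  rw [multiplier, dif_pos h, norm_fourierInv, ← integral_norm_sq_L2C]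
  refine integral_congr_ae ?_
  filter_upwards [h.coeFn_toLp] with ξ h1
  rw [h1, norm_mul, mul_pow]

theorem InDomain.integrable {m : ℝ → ℂ} {u : L2R} (h : InDomain m u) :
    Integrable (fun ξ => ‖m ξ‖ ^ 2 * ‖(𝓕 (toC u) : L2C) ξ‖ ^ 2) := by
  have h1 : MemLp (fun ξ => m ξ * (𝓕 (toC u) : L2C) ξ) 2 volume := h
  refine (h1.norm.integrable_sq).congr (ae_of_all _ fun ξ => ?_)
  simp only [norm_mul, mul_pow]

theorem norm_symbHalf_mul_symbRoot_le {γ c : ℝ} (hγ : 0 < γ) (hc : 0 < c) (ξ : ℝ) :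
    ‖symbHalf ξ * symbRoot γ c ξ‖ ≤ 1 := by
  refine (sq_le_one_iff₀ (norm_nonneg _)).1 ?_
  rw [norm_mul, mul_pow, norm_symbHalf_sq, norm_symbRoot_sq hγ hc, ← div_eq_mul_inv,
    div_le_one (weight_pos hγ hc ξ), weight]
  have : 0 ≤ γ * ((2 * Real.pi * ξ) ^ 2)⁻¹ := by positivity
  linarith

theorem norm_symbAnti_mul_symbRoot_le {γ c : ℝ} (hγ : 0 < γ) (hc : 0 < c) (ξ : ℝ) :
    ‖symbAnti ξ * symbRoot γ c ξ‖ ≤ (Real.sqrt γ)⁻¹ := by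
  refine le_of_sq_le_sq ?_ (by positivity)
  rw [norm_mul, mul_pow, norm_symbAnti_sq, norm_symbRoot_sq hγ hc, inv_pow, Real.sq_sqrt hγ.le,
    ← div_eq_mul_inv, div_le_iff₀ (weight_pos hγ hc ξ), weight, mul_add,
    inv_mul_cancel_left₀ hγ.ne']
  have : 0 ≤ γ⁻¹ * (|2 * Real.pi * ξ| + c) := by positivity
  linarith

theorem memLp_mul_fourier_fromFreq {m : ℝ → ℂ} (hm : Measurable m) {C : ℝ}
    (hC : ∀ ξ, ‖m ξ * symbRoot γ c ξ‖ ≤ C) {g : L2C} (hg : g ∈ herm) :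
    InDomain m (fromFreq hγ hc g) := by
  rw [InDomain, fourier_toC_fromFreq hγ hc hg]
  refine MemLp.of_le_mul (c := C) (Lp.memLp g)
    (hm.aestronglyMeasurable.mul (Lp.aestronglyMeasurable _)) ?_
  filter_upwards [coeFn_mulL _ (memLp_symbRoot hγ hc) g] with ξ h1
  rw [h1, ← mul_assoc, norm_mul]
  exact mul_le_mul_of_nonneg_right (hC ξ) (norm_nonneg _)

theorem inDomain_symbHalf {g : L2C} (hg : g ∈ herm) : InDomain symbHalf (fromFreq hγ hc g) :=
  memLp_mul_fourier_fromFreq hγ hc measurable_symbHalf (norm_symbHalf_mul_symbRoot_le hγ hc) hg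

theorem inDomain_symbAnti {g : L2C} (hg : g ∈ herm) : InDomain symbAnti (fromFreq hγ hc g) :=
  memLp_mul_fourier_fromFreq hγ hc measurable_symbAnti (norm_symbAnti_mul_symbRoot_le hγ hc) hg

theorem norm_multiplier_fromFreq_le {m : ℝ → ℂ} (hm : Measurable m) {C : ℝ}
    (hC : ∀ ξ, ‖m ξ * symbRoot γ c ξ‖ ≤ C) {g : L2C} (hg : g ∈ herm) :
    ‖multiplier m (fromFreq hγ hc g)‖ ≤ C * ‖g‖ := by
  have h := memLp_mul_fourier_fromFreq hγ hc hm hC hg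
  rw [multiplier, dif_pos h, norm_fourierInv]
  refine Lp.norm_le_mul_norm_of_ae_le_mul ?_
  filter_upwards [h.coeFn_toLp, coeFn_mulL _ (memLp_symbRoot hγ hc) g] with ξ h1 h2
  rw [h1, fourier_toC_fromFreq hγ hc hg, h2, ← mul_assoc, norm_mul]
  exact mul_le_mul_of_nonneg_right (hC ξ) (norm_nonneg _)

theorem normX_fromFreq_le {g : L2C} (hg : g ∈ herm) :
    normX (fromFreq hγ hc g) ≤ ((Real.sqrt c)⁻¹ + 1 + (Real.sqrt γ)⁻¹) * ‖g‖ := by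
  have h1 := norm_fromFreq_le hγ hc g
  have h2 : ‖halfDeriv (fromFreq hγ hc g)‖ ≤ 1 * ‖g‖ :=
    norm_multiplier_fromFreq_le hγ hc measurable_symbHalf
      (norm_symbHalf_mul_symbRoot_le hγ hc) hg
  have h3 : ‖antideriv (fromFreq hγ hc g)‖ ≤ (Real.sqrt γ)⁻¹ * ‖g‖ :=
    norm_multiplier_fromFreq_le hγ hc measurable_symbAnti
      (norm_symbAnti_mul_symbRoot_le hγ hc) hg
  have h4 : normHhalf (fromFreq hγ hc g) ≤
      ‖fromFreq hγ hc g‖ + ‖halfDeriv (fromFreq hγ hc g)‖ := by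
    refine Real.sqrt_le_iff.2 ⟨by positivity, ?_⟩
    nlinarith [norm_nonneg (fromFreq hγ hc g), norm_nonneg (halfDeriv (fromFreq hγ hc g))]
  rw [normX]
  linarith

theorem fromFreq_mem_X {g : L2C} (hg : g ∈ herm) (hr : reflL g = g) : fromFreq hγ hc g ∈ X := by
  refine ⟨(memSobolev_half_iff _).2 ?_, inDomain_symbAnti hγ hc hg, ?_⟩
  · refine memLp_mul_fourier_fromFreq hγ hc
      (m := fun ξ => (((1 + ‖ξ‖ ^ 2) ^ ((1 / 2 : ℝ) / 2) : ℝ) : ℂ)) (by fun_prop)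
      (C := Real.sqrt (c⁻¹ + 1)) (fun ξ => ?_) hg
    refine Real.le_sqrt_of_sq_le ?_
    have hw := weight_pos hγ hc ξ
    rw [norm_mul, mul_pow, norm_symbRoot_sq hγ hc, Complex.norm_real,
      Real.norm_of_nonneg (by positivity), ← Real.rpow_mul_natCast (by positivity)]
    have e : (1 / 2 : ℝ) / 2 * (2 : ℕ) = 1 / 2 := by norm_num
    rw [e, ← Real.sqrt_eq_rpow, ← div_eq_mul_inv, div_le_iff₀ hw]
    have h1 : Real.sqrt (1 + ‖ξ‖ ^ 2) ≤ 1 + |ξ| := by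
      refine Real.sqrt_le_iff.2 ⟨by positivity, ?_⟩
      rw [Real.norm_eq_abs]
      nlinarith [abs_nonneg ξ]
    have h2 : 1 ≤ c⁻¹ * weight γ c ξ := by
      rw [inv_mul_eq_div, one_le_div hc]; exact le_weight hγ ξ
    linarith [abs_le_weight hγ hc ξ]
  · have h1 := fromFreq_reflL hγ hc g
    rw [hr] at h1
    filter_upwards [h1] with x hx
    exact hx.symm

/-- `fromFreq` maps the even elements of `herm` onto `X`. -/
theorem exists_fromFreq_eq {u : L2R} (hu : u ∈ X) :
    ∃ g : L2C, g ∈ herm ∧ reflL g = g ∧ fromFreq hγ hc g = u := by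
  obtain ⟨hs, ha, he⟩ := hu
  have hs' := (memSobolev_half_iff _).1 hs
  set v : L2C := 𝓕 (toC u) with hv
  have hvh : v ∈ herm := fourier_mem_herm (conjL_toC u)
  have hvr : reflL v = v := by
    have h1 := fourierInv_reflL v
    rw [hv, FourierTransform.fourierInv_fourier_eq] at h1
    have h2 : reflL (toC u) = toC u := by
      refine Lp.ext ?_
      filter_upwards [coeFn_reflL (toC u), coeFn_toC u, ae_comp_neg (coeFn_toC u), he]
        with x h3 h4 h5 h6
      rw [h3, h4, h5, h6]
    rw [h2] at h1
    have h3 := congrArg (fun k : L2C => (𝓕 k : L2C)) h1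
    simp only [FourierTransform.fourier_fourierInv_eq] at h3
    exact h3
  have hg : MemLp (fun ξ => ((Real.sqrt (weight γ c ξ) : ℝ) : ℂ) * v ξ) 2 volume := by
    have hm : AEStronglyMeasurable (fun ξ => ((Real.sqrt (weight γ c ξ) : ℝ) : ℂ) * v ξ)
        volume := by
      have := measurable_weight (γ := γ) (c := c)
      refine AEStronglyMeasurable.mul ?_ (Lp.aestronglyMeasurable v)
      have h0 : Measurable fun ξ => ((Real.sqrt (weight γ c ξ) : ℝ) : ℂ) := by fun_prop
      exact h0.aestronglyMeasurable
    refine MemLp.of_le (((hs'.norm.const_mul (Real.sqrt (2 * Real.pi))).add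
      ((Lp.memLp v).norm.const_mul (Real.sqrt c))).add (ha.norm.const_mul (Real.sqrt γ))) hm
      (ae_of_all _ fun ξ => ?_)
    have h1 : Real.sqrt (weight γ c ξ) ≤ Real.sqrt (2 * Real.pi) *
        (1 + ‖ξ‖ ^ 2) ^ ((1 / 2 : ℝ) / 2) + Real.sqrt c + Real.sqrt γ * ‖symbAnti ξ‖ := by
      refine Real.sqrt_le_iff.2 ⟨by positivity, ?_⟩
      set p := (1 + ‖ξ‖ ^ 2) ^ ((1 / 2 : ℝ) / 2) with hp
      have hp2 : |ξ| ≤ p ^ 2 := by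
        rw [hp, ← Real.rpow_mul_natCast (by positivity)]
        have e : (1 / 2 : ℝ) / 2 * (2 : ℕ) = 1 / 2 := by norm_num
        rw [e, ← Real.sqrt_eq_rpow]
        refine Real.le_sqrt_of_sq_le ?_
        rw [Real.norm_eq_abs]; linarith
      have e1 : weight γ c ξ = 2 * Real.pi * |ξ| + c + γ * ‖symbAnti ξ‖ ^ 2 := by
        rw [weight, norm_symbAnti_sq, abs_mul, abs_of_pos (show 0 < 2 * Real.pi by positivity)]
      have hp0 : 0 ≤ p := by positivity
      have e2 : 2 * Real.pi * |ξ| ≤ (Real.sqrt (2 * Real.pi) * p) ^ 2 := by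
        rw [mul_pow, Real.sq_sqrt (by positivity)]; gcongr
      have e3 : Real.sqrt c ^ 2 = c := Real.sq_sqrt hc.le
      have e4 : (Real.sqrt γ * ‖symbAnti ξ‖) ^ 2 = γ * ‖symbAnti ξ‖ ^ 2 := by
        rw [mul_pow, Real.sq_sqrt hγ.le]
      have k1 : 0 ≤ Real.sqrt (2 * Real.pi) * p := by positivity
      have k2 : 0 ≤ Real.sqrt c := by positivity
      have k3 : 0 ≤ Real.sqrt γ * ‖symbAnti ξ‖ := by positivity
      rw [e1, ← e4]
      nlinarith [mul_nonneg k1 k2, mul_nonneg k1 k3, mul_nonneg k2 k3]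
    have h2 : ‖(((1 + ‖ξ‖ ^ 2) ^ ((1 / 2 : ℝ) / 2) : ℝ) : ℂ)‖ =
        (1 + ‖ξ‖ ^ 2) ^ ((1 / 2 : ℝ) / 2) := by
      rw [Complex.norm_real, Real.norm_of_nonneg (by positivity)]
    have h3 : ‖(((Real.sqrt (weight γ c ξ)) : ℝ) : ℂ)‖ = Real.sqrt (weight γ c ξ) := by
      rw [Complex.norm_real, Real.norm_of_nonneg (by positivity)]
    simp only [Pi.add_apply, norm_mul, h2, h3]
    refine (mul_le_mul_of_nonneg_right h1 (norm_nonneg _)).trans (le_trans (le_of_eq ?_)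
      (le_abs_self _))
    ring
  have hroot : rootL hγ hc (hg.toLp _) = v := by
    refine Lp.ext ?_
    filter_upwards [coeFn_mulL _ (memLp_symbRoot hγ hc) (hg.toLp _), hg.coeFn_toLp] with ξ h1 h2
    have hw := (Real.sqrt_pos.2 (weight_pos hγ hc ξ)).ne'
    rw [h1, h2, symbRoot, ← mul_assoc, ← Complex.ofReal_mul, inv_mul_cancel₀ hw,
      Complex.ofReal_one, one_mul]
  refine ⟨hg.toLp _, mem_herm_iff_ae.2 ?_, Lp.ext ?_, ?_⟩
  · filter_upwards [hg.coeFn_toLp, ae_comp_neg hg.coeFn_toLp, mem_herm_iff_ae.1 hvh] with ξ h1 h2 h3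
    rw [h1, h2, h3, weight_neg, map_mul, Complex.conj_ofReal]
  · have h0 := coeFn_reflL v
    rw [hvr] at h0
    filter_upwards [hg.coeFn_toLp, ae_comp_neg hg.coeFn_toLp, coeFn_reflL (hg.toLp _), h0]
      with ξ h1 h2 h3 h4
    rw [h3, h1, h2, h4, weight_neg]
  · rw [fromFreq_apply, hroot, hv, FourierTransform.fourierInv_fourier_eq, reL_toC]

theorem integral_add₃ {f g h : ℝ → ℝ} (hf : Integrable f) (hg : Integrable g)
    (hh : Integrable h) :
    ∫ x, (f x + g x + h x) = (∫ x, f x) + (∫ x, g x) + ∫ x, h x :=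
  (integral_add (hf.add hg) hh).trans (by rw [integral_add' hf hg])

/-- `fromFreq` turns the energy into half the squared norm. -/
theorem energyI_fromFreq {g : L2C} (hg : g ∈ herm) :
    energyI γ c (fromFreq hγ hc g) = 1 / 2 * ‖g‖ ^ 2 := by
  set u := fromFreq hγ hc g with hu
  have hh := inDomain_symbHalf hγ hc hg
  have ha := inDomain_symbAnti hγ hc hg
  set v : L2C := 𝓕 (toC u) with hv
  have i1 : Integrable (fun x => 1 / 2 * ‖halfDeriv u x‖ ^ 2) :=
    (Lp.memLp (halfDeriv u)).norm.integrable_sq.const_mul _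
  have i2 : Integrable (fun x => c / 2 * (u x) ^ 2) := (Lp.memLp u).integrable_sq.const_mul _
  have i3 : Integrable (fun x => γ / 2 * ‖antideriv u x‖ ^ 2) :=
    (Lp.memLp (antideriv u)).norm.integrable_sq.const_mul _
  have e2 : ∫ x, (u x) ^ 2 = ∫ ξ, ‖v ξ‖ ^ 2 := by
    rw [integral_norm_sq_L2C, hv, Lp.norm_fourier_eq, norm_toC, ← real_inner_self_eq_norm_sq,
      L2.inner_def]
    refine integral_congr_ae (ae_of_all _ fun x => ?_)
    simp only [RCLike.inner_apply, conj_trivial, sq]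
  have j2 : Integrable (fun ξ => ‖v ξ‖ ^ 2) := (Lp.memLp v).norm.integrable_sq
  have e1 := integral_add₃ i1 i2 i3
  have e3 := integral_add₃ (hh.integrable.const_mul (1 / 2)) (j2.const_mul (c / 2))
    (ha.integrable.const_mul (γ / 2))
  rw [integral_const_mul, integral_const_mul, integral_const_mul] at e1 e3
  rw [integral_norm_sq_L2C, integral_norm_sq_L2C, halfDeriv, antideriv, norm_multiplier_sq hh,
    norm_multiplier_sq ha, e2] at e1
  refine (e1.trans e3.symm).trans ?_
  rw [← integral_norm_sq_L2C, ← integral_const_mul]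
  refine integral_congr_ae ?_
  filter_upwards [coeFn_mulL _ (memLp_symbRoot hγ hc) g] with ξ h1
  have hw := weight_pos hγ hc ξ
  have h2 : ‖v ξ‖ ^ 2 = (weight γ c ξ)⁻¹ * ‖g ξ‖ ^ 2 := by
    rw [hv, hu, fourier_toC_fromFreq hγ hc hg, h1, norm_mul, mul_pow, norm_symbRoot_sq hγ hc]
  change 1 / 2 * (‖symbHalf ξ‖ ^ 2 * ‖v ξ‖ ^ 2) + c / 2 * ‖v ξ‖ ^ 2 +
    γ / 2 * (‖symbAnti ξ‖ ^ 2 * ‖v ξ‖ ^ 2) = 1 / 2 * ‖g ξ‖ ^ 2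
  rw [norm_symbHalf_sq, norm_symbAnti_sq, h2]
  have h3 : weight γ c ξ * ((weight γ c ξ)⁻¹ * ‖g ξ‖ ^ 2) = ‖g ξ‖ ^ 2 :=
    mul_inv_cancel_left₀ hw.ne' _
  generalize (weight γ c ξ)⁻¹ * ‖g ξ‖ ^ 2 = Y at h3 ⊢
  rw [← h3, weight]
  ring

theorem cubicK_fromFreq (g : herm) :
    cubicK (fromFreq hγ hc g) = 1 / 3 * (energyForm hγ hc).cub g := by
  change _ = 1 / 3 * tri hγ hc g g g
  rw [cubicK, tri_eq]
  congr 1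
  refine integral_congr_ae (ae_of_all _ fun x => ?_)
  simp only
  ring

theorem translate_zero (u : L2R) : translate 0 u = u := by
  refine Lp.ext ?_
  filter_upwards [Lp.coeFn_compMeasurePreserving u (measurePreserving_add_right volume (0 : ℝ))]
    with x hx
  rw [translate, hx, Function.comp_apply, add_zero]

theorem exists_mem_even_of_mem_X {u : L2R} (hu : u ∈ X) :
    ∃ g ∈ (energyForm hγ hc).even, fromFreq hγ hc (g : L2C) = u := by
  obtain ⟨g, hg, hr, h⟩ := exists_fromFreq_eq hγ hc hu
  exact ⟨⟨g, hg⟩, Subtype.ext hr, h⟩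

theorem fromFreq_mem_X_of_mem_even {g : herm} (hg : g ∈ (energyForm hγ hc).even) :
    fromFreq hγ hc g ∈ X :=
  fromFreq_mem_X hγ hc g.2 (congrArg Subtype.val hg)

theorem cubicK_fromFreq_eq_iff {g : herm} {lam : ℝ} :
    cubicK (fromFreq hγ hc g) = lam ↔ (energyForm hγ hc).cub g = 3 * lam := by
  rw [cubicK_fromFreq]
  constructor <;> intro h <;> linarith

theorem infM_le {lam : ℝ} {g : herm} (hg : g ∈ (energyForm hγ hc).even)
    (hk : (energyForm hγ hc).cub g = 3 * lam) : infM γ c lam ≤ 1 / 2 * ‖g‖ ^ 2 := by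
  refine csInf_le ⟨0, ?_⟩ ⟨fromFreq hγ hc g, ⟨fromFreq_mem_X_of_mem_even hγ hc hg,
    (cubicK_fromFreq_eq_iff hγ hc).2 hk⟩, energyI_fromFreq hγ hc g.2⟩
  rintro - ⟨u, ⟨hu, -⟩, rfl⟩
  obtain ⟨k, -, rfl⟩ := exists_mem_even_of_mem_X hγ hc hu
  rw [energyI_fromFreq hγ hc k.2]
  positivity

theorem isMinimizer_of_isMinimal {lam : ℝ} {g : herm}
    (hg : (energyForm hγ hc).IsMinimal (3 * lam) g) : IsMinimizer γ c lam (fromFreq hγ hc g) := by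
  obtain ⟨h1, h2, h3⟩ := hg
  have hX := fromFreq_mem_X_of_mem_even hγ hc h1
  have hK := (cubicK_fromFreq_eq_iff hγ hc).2 h2
  refine ⟨hX, hK, ?_⟩
  refine (IsLeast.csInf_eq (s := energyI γ c '' {u | u ∈ X ∧ cubicK u = lam}) ?_).symm
  refine ⟨⟨_, ⟨hX, hK⟩, rfl⟩, ?_⟩
  rintro - ⟨u, ⟨hu, huK⟩, rfl⟩
  obtain ⟨k, hk, rfl⟩ := exists_mem_even_of_mem_X hγ hc hu
  rw [energyI_fromFreq hγ hc g.2, energyI_fromFreq hγ hc k.2]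
  have := h3 k hk ((cubicK_fromFreq_eq_iff hγ hc).1 huK)
  have h5 : ‖(g : L2C)‖ ≤ ‖(k : L2C)‖ := this
  gcongr

theorem exists_isMinimizingSeq {γ c : ℝ} (hγ : 0 < γ) (hc : 0 < c) (lam : ℝ) :
    ∃ u, IsMinimizingSeq γ c lam u := by
  set S := energyI γ c '' {u | u ∈ X ∧ cubicK u = lam}
  obtain ⟨g, hg, hk⟩ := (energyForm hγ hc).exists_even_cub_eq (3 * lam)
  have hne : S.Nonempty := ⟨_, fromFreq hγ hc g, ⟨fromFreq_mem_X_of_mem_even hγ hc hg,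
    (cubicK_fromFreq_eq_iff hγ hc).2 hk⟩, rfl⟩
  have hb : BddBelow S := by
    refine ⟨0, ?_⟩
    rintro - ⟨u, ⟨hu, -⟩, rfl⟩
    obtain ⟨k, -, rfl⟩ := exists_mem_even_of_mem_X hγ hc hu
    rw [energyI_fromFreq hγ hc k.2]
    positivity
  obtain ⟨e, -, he, hS⟩ := exists_seq_tendsto_sInf hne hb
  choose u hu hue using hS
  exact ⟨u, hu, he.congr fun n => (hue n).symm⟩

/-- Minimizing sequences converge in the energy space along a subsequence. -/
theorem IsMinimizingSeq.exists_subseq {lam : ℝ} (hlam : 0 < lam) {u : ℕ → L2R}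
    (hu : IsMinimizingSeq γ c lam u) : ∃ (φ : ℕ → ℕ) (g : herm), StrictMono φ ∧
      (energyForm hγ hc).IsMinimal (3 * lam) g ∧
      Tendsto (fun k => normX (u (φ k) - fromFreq hγ hc g)) atTop (𝓝 0) := by
  obtain ⟨h1, h2⟩ := hu
  choose g hg hgu using fun n => exists_mem_even_of_mem_X hγ hc (h1 n).1
  have hc3 : ∀ n, (energyForm hγ hc).cub (g n) = 3 * lam := fun n =>
    (cubicK_fromFreq_eq_iff hγ hc).1 ((congrArg cubicK (hgu n)).trans (h1 n).2)
  have hI : ∀ n, energyI γ c (u n) = 1 / 2 * ‖g n‖ ^ 2 := fun n => by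
    rw [← hgu, energyI_fromFreq hγ hc (g n).2]; rfl
  have ht : Tendsto (fun n => ‖g n‖) atTop (𝓝 (Real.sqrt (2 * infM γ c lam))) := by
    refine (h2.const_mul 2).sqrt.congr fun n => ?_
    rw [hI, ← mul_assoc, mul_one_div_cancel two_ne_zero, one_mul, Real.sqrt_sq (norm_nonneg _)]
  obtain ⟨φ, k, hφ, hk, htk⟩ := (energyForm hγ hc).exists_isMinimal_of_tendsto
    (show 0 < 3 * lam by positivity) (fun f hf hfc => by
      refine Real.sqrt_le_iff.2 ⟨norm_nonneg _, ?_⟩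
      linarith [infM_le hγ hc hf hfc]) hg hc3 ht
  refine ⟨φ, k, hφ, hk, ?_⟩
  have hz := (tendsto_iff_norm_sub_tendsto_zero.1 htk).const_mul
    ((Real.sqrt c)⁻¹ + 1 + (Real.sqrt γ)⁻¹)
  rw [mul_zero] at hz
  refine squeeze_zero (fun n => ?_) (fun n => ?_) hz
  · unfold normX normHhalf; positivity
  · rw [← hgu, ← map_sub]
    exact normX_fromFreq_le hγ hc (g (φ n) - k).2

/-- The Euler–Lagrange equation with multiplier `1` is the solitary wave equation. -/
theorem solvesSolitaryEq_fromFreq {g : herm}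
    (hg : ∀ k : herm, tri hγ hc g g k = 1 * inner ℝ g k) :
    SolvesSolitaryEq γ c (fromFreq hγ hc g) := by
  have h1 := gradFreq_eq_of_forall hγ hc hg
  rw [one_smul] at h1
  have h2 := gradFreq_ae_eq hγ hc g
  rw [h1] at h2
  unfold SolvesSolitaryEq
  rw [fourier_toC_fromFreq hγ hc g.2]
  filter_upwards [h2, coeFn_mulL _ (memLp_symbRoot hγ hc) (g : L2C)] with ξ h3 h4
  rw [h4, h3]
  have h5 : symbHilbert ξ * symbDeriv ξ + c - γ * (symbDeriv ξ ^ 2)⁻¹ = (weight γ c ξ : ℂ) := by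
    have h6 : symbHilbert ξ * symbDeriv ξ = ((|2 * Real.pi * ξ| : ℝ) : ℂ) := by
      have h9 : |ξ| = Real.sign ξ * ξ := by
        rcases lt_trichotomy ξ 0 with h | h | h
        · rw [abs_of_neg h, Real.sign_of_neg h]; ring
        · simp [h]
        · rw [abs_of_pos h, Real.sign_of_pos h]; ring
      rw [abs_mul, abs_of_pos (show 0 < 2 * Real.pi by positivity), h9, symbHilbert, symbDeriv]
      push_cast
      linear_combination (-(Real.sign ξ : ℂ) * 2 * Real.pi * ξ) * Complex.I_mul_I
    have h7 : symbDeriv ξ ^ 2 = -(((2 * Real.pi * ξ) ^ 2 : ℝ) : ℂ) := by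
      rw [symbDeriv]
      push_cast
      linear_combination ((2 * Real.pi * ξ : ℂ) ^ 2) * Complex.I_mul_I
    rw [h6, h7, weight, inv_neg]
    push_cast
    ring
  have h8 : (weight γ c ξ : ℂ) * (symbRoot γ c ξ * symbRoot γ c ξ) = 1 := by
    have hw := weight_pos hγ hc ξ
    rw [symbRoot, ← Complex.ofReal_mul, ← Complex.ofReal_mul, ← mul_inv,
      Real.mul_self_sqrt hw.le, mul_inv_cancel₀ hw.ne', Complex.ofReal_one]
  rw [h5]
  linear_combination (𝓕 (fun x => ((fromFreq hγ hc g x ^ 2 : ℝ) : ℂ)) ξ) * h8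

/-- A minimizer solves the solitary wave equation up to a Lagrange multiplier `μ`; multiplication by
`μ⁻¹` removes it and gives a minimizer for another `λ`. -/
theorem exists_isEvenGroundState {lam : ℝ} (hlam : 0 < lam) {g : herm}
    (hg : (energyForm hγ hc).IsMinimal (3 * lam) g) : ∃ ψ, IsEvenGroundState γ c ψ := by
  obtain ⟨μ, hμ, hEL⟩ := hg.eulerLagrange _ (by positivity)
  have hm := hg.smul _ (inv_pos.2 hμ)
  refine ⟨fromFreq hγ hc (μ⁻¹ • g : herm), solvesSolitaryEq_fromFreq hγ hc fun k => ?_,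
    μ⁻¹ ^ 3 * lam, by positivity, isMinimizer_of_isMinimal hγ hc ?_⟩
  · have h1 := hEL k
    have h2 := (energyForm hγ hc).smul_left μ⁻¹ g (μ⁻¹ • g) k
    rw [(energyForm hγ hc).smul_mid μ⁻¹ g g k, h1, inv_mul_cancel_left₀ hμ.ne'] at h2
    rw [one_mul]
    exact h2.trans (real_inner_smul_left _ _ _).symm
  · rwa [mul_left_comm]

end EnergySpace

end RotationBO

end

theorem proposition2p3 (γ c lam : ℝ) (hγ : 0 < γ) (hc : 0 < c) (hlam : 0 < lam) :
    -- every minimizing sequence is relatively compact in the norm of `X` up to translations,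
    -- with a minimizer in the limit
    (∀ u : ℕ → RotationBO.L2R, RotationBO.IsMinimizingSeq γ c lam u →
      ∃ (φ : ℕ → ℕ) (y : ℕ → ℝ) (ψ : RotationBO.L2R),
        StrictMono φ ∧ RotationBO.IsMinimizer γ c lam ψ ∧
        Tendsto (fun k => RotationBO.normX (RotationBO.translate (y k) (u (φ k)) - ψ))
          atTop (𝓝 0)) ∧
    -- a minimizer for `lam` exists
    (∃ ψ : RotationBO.L2R, RotationBO.IsMinimizer γ c lam ψ) ∧
    -- an even ground state exists
    (∃ ψ : RotationBO.L2R, RotationBO.IsEvenGroundState γ c ψ) := by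
  obtain ⟨u, hu⟩ := RotationBO.exists_isMinimizingSeq hγ hc lam
  obtain ⟨-, g, -, hg, -⟩ := hu.exists_subseq hγ hc hlam
  refine ⟨fun u hu => ?_, ⟨_, RotationBO.isMinimizer_of_isMinimal hγ hc hg⟩,
    RotationBO.exists_isEvenGroundState hγ hc hlam hg⟩
  obtain ⟨φ, g, hφ, hg, ht⟩ := hu.exists_subseq hγ hc hlam
  -- Even minimizing sequences are compact without translations.
  refine ⟨φ, 0, _, hφ, RotationBO.isMinimizer_of_isMinimal hγ hc hg, ?_⟩
  simpa only [Pi.zero_apply, RotationBO.translate_zero] using ht
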